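/- **Setting.** Let $d\ge 1$ be an integer and $O=(\boldsymbol X,A,Y)$ with $\boldsymbol X$ uniform on $[0,1]^d$. Fix a compactly supported Cohen–Daubechies–Vial type orthonormal wavelet basis of $L^2([0,1])$ of regularity $S\ge 1$ and coarsest level $J_0$: at each level $l\ge J_0$ there are $2^l$ scaling functions and $2^l$ wavelets, which are the dilated translates $2^{l/2}\phi(2^l\cdot-m)$, $2^{l/2}\psi(2^l\cdot-m)$ of bounded, measurable, compactly supported functions in the interior and dilates of finitely many such edge functions at the end points; the span of the scaling functions of level $l$ contains the polynomials of degree $\le S-1$. Let $\Phi_{l\boldsymbol m}$, $\Psi^{\boldsymbol\iota}_{l\boldsymbol m}$ ($\boldsymbol\iota\in\{0,1\}^d\setminus\{\boldsymbol 0\}$) be the tensor product scaling functions and wavelets on $[0,1]^d$, and for $k=2^{jd}$, $j\ge J_0$, let $K_{V_k}(\boldsymbol x,\boldsymbol y)=\sum_{\boldsymbol m}\Phi_{j\boldsymbol m}(\boldsymbol x)\Phi_{j\boldsymbol m}(\boldsymbol y)$. For $0<s<S$ let $H(s,M)$ be the set of continuous $h$ on $[0,1]^d$ with $$2^{J_0(s+d/2)}\sup_{\boldsymbol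 m}|\langle h,\Phi_{J_0\boldsymbol m}\rangle|+\sup_{l\ge J_0,\boldsymbol m,\boldsymbol\iota}2^{l(s+d/2)}|\langle h,\Psi^{\boldsymbol\iota}_{l\boldsymbol m}\rangle|\le M .$$ Let $0<\alpha,\beta<S$, $M>0$, $C_1<C_2$, and let $\mathcal P_{(\alpha,\beta)}$ be the set of laws $\mathbb P$ of $(\boldsymbol X,A,Y)$ with $\boldsymbol X\sim\mathrm{Unif}([0,1]^d)$, $A,Y\in[C_1,C_2]$ a.s., $p(\boldsymbol x)=\mathbb E[A\mid\boldsymbol X=\boldsymbol x]\in H(\alpha,M)$ and $b(\boldsymbol x)=\mathbb E[Y\mid\boldsymbol X=\boldsymbol x]\in H(\beta,M)$. Assume that the constants leave room in the model: for some $M'<M$ there are $p_0\in H(\alpha,M')$ and $b_0\in H(\beta,M')$ with values in the open interval $(C_1,C_2)$ (for instance, this always holds if $C_1<0<C_2$). The target is $\psi(\mathbb P)=\mathbb E_{\mathbb P}[\mathrm{Cov}_{\mathbb P}(A,Y\mid\boldsymbol X)]$. Let $\mathcal D_1,\dots,\mathcal D_4$ be independent i.i.d. samples from $\mathbb P$ of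 size $n$ each, and for $k_1,k_2\in\{2^{jd}:j\ge J_0\}$ put $$\hat p_{k_1}(\boldsymbol x)=\tfrac1n\sum_{i\in\mathcal D_1}A_iK_{V_{k_1}}(\boldsymbol X_i,\boldsymbol x),\qquad \hat b_{k_2}(\boldsymbol x)=\tfrac1n\sum_{i\in\mathcal D_2}Y_iK_{V_{k_2}}(\boldsymbol X_i,\boldsymbol x),$$ $$\hat\psi^{\mathrm{INT}}_{k_1,k_2}=\tfrac1n\sum_{i\in\mathcal D_3}A_iY_i-\int_{[0,1]^d}\hat p_{k_1}\hat b_{k_2},\qquad \hat\psi^{\mathrm{MC}}_{k_1,k_2}=\tfrac1n\sum_{i\in\mathcal D_3}A_iY_i-\tfrac1n\sum_{i\in\mathcal D_4}\hat p_{k_1}(\boldsymbol X_i)\hat b_{k_2}(\boldsymbol X_i),$$ $$\hat\psi^{\mathrm{IF}}_{k_1,k_2}=\tfrac1n\sum_{i\in\mathcal D_3}(A_i-\hat p_{k_1}(\boldsymbol X_i))(Y_i-\hat b_{k_2}(\boldsymbol X_i)).$$ For each estimator let $R_n(k_1,k_2)=\sup_{\mathbb P\in\mathcal P_{(\alpha,\beta)}}\mathbb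 E_{\mathbb P}[(\hat\psi_{k_1,k_2}-\psi(\mathbb P))^2]$. Resolutions $k_\ell=k_\ell(n)$ *achieve* a rate $r_n$ if $R_n(k_1,k_2)=O(r_n)$; $r_n$ is the *best rate* of the estimator if some choice of resolutions achieves it and $R_n(k_1,k_2)\ge c\,r_n$ for some $c>0$, all large $n$ and all $k_1,k_2$. The *prediction-optimal* resolutions are $k_1^{\mathrm{pred}}\asymp n^{d/(2\alpha+d)}$ and $k_2^{\mathrm{pred}}\asymp n^{d/(2\beta+d)}$; $k_\ell$ is *undersmoothed* if $k_\ell/k_\ell^{\mathrm{pred}}\to\infty$. **Theorem.** (0) The best rate of $\hat\psi^{\mathrm{INT}}$ and of $\hat\psi^{\mathrm{IF}}$ is $n^{-1}$ if $\frac{\alpha+\beta}2\ge\frac d4$ and $n^{-\frac{4\alpha+4\beta}{2\alpha+2\beta+d}}$ if $\frac{\alpha+\beta}2<\frac d4$. The best rate of $\hat\psi^{\mathrm{MC}}$ is $n^{-1}$ if $\frac{\alpha+\beta}2\ge\frac d4$ and $n^{-\frac{3\alpha+3\beta}{\alpha+\beta+d}}$ if $\frac{\alpha+\beta}2<\frac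 d4$. (1) With any prediction-optimal resolutions $k_1=k_1^{\mathrm{pred}}$, $k_2=k_2^{\mathrm{pred}}$: $\hat\psi^{\mathrm{INT}}$ achieves its best rate if and only if $\alpha\wedge\beta\ge\frac d2$; $\hat\psi^{\mathrm{MC}}$ achieves its best rate if and only if $\alpha\wedge\beta\ge\frac d2$; $\hat\psi^{\mathrm{IF}}$ achieves its best rate if and only if $\alpha\vee\beta\ge\frac d2$. (2) If $k_1,k_2$ are resolutions with which $\hat\psi^{\mathrm{INT}}$ (respectively $\hat\psi^{\mathrm{MC}}$) achieves its best rate, then $k_1$ is undersmoothed when $\beta<\frac d2$, and $k_2$ is undersmoothed when $\alpha<\frac d2$. (3) Let $\alpha\vee\beta<\frac d2$. If $\hat\psi^{\mathrm{IF}}$ achieves its best rate with $k_1,k_2$, then $\max\bigl(k_1/n^{d/(2\alpha+d)},\,k_2/n^{d/(2\beta+d)}\bigr)\to\infty$, that is, $k_1$ or $k_2$ has to be undersmoothed. It does not matter which: there are resolutions achieving the best rate with $k_1$ undersmoothed and $k_2$ prediction-optimal, and others with $k_1$ prediction-optimal and $k_2$ undersmoothed. -/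

import Mathlib

open MeasureTheory ProbabilityTheory Filter Topology
open scoped ENNReal

/-! ## Boundary-adapted orthonormal wavelet bases -/

/-- Generating functions of one family (scaling functions, or wavelets) of a
Cohen--Daubechies--Vial system on `[0,1]`: the function that is translated and dilated in the
interior, and the edge functions attached to the end points `0` and `1`. -/
structure WaveletGen where
  main : ℝ → ℝ
  left : ℕ → ℝ → ℝ
  right : ℕ → ℝ → ℝ

/-- The `m`-th function of resolution level `l`, with `N` edge functions at each end point:
`2^{l/2} left_m(2^l x)` for `m < N`, `2^{l/2} main(2^l x - m)` for `N ≤ m < 2^l - N`, and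
`2^{l/2} right_{2^l-1-m}(2^l (1-x))` for `2^l - N ≤ m < 2^l`. -/
noncomputable def WaveletGen.fn (g : WaveletGen) (N l : ℕ) (m : Fin (2 ^ l)) (x : ℝ) : ℝ :=
  (2 : ℝ) ^ ((l : ℝ) / 2) *
    (if (m : ℕ) < N then g.left m ((2 : ℝ) ^ l * x)
      else if (m : ℕ) + N < 2 ^ l then g.main ((2 : ℝ) ^ l * x - ((m : ℕ) : ℝ))
      else g.right (2 ^ l - 1 - (m : ℕ)) ((2 : ℝ) ^ l * (1 - x)))

/-- Measurable, bounded and compactly supported generators; the interior generator is supported in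
`[-N, N+1]`, so that the interior functions `main(2^l x - m)`, `N ≤ m < 2^l - N`, live on `[0,1]`. -/
structure WaveletGen.IsAdmissible (g : WaveletGen) (N : ℕ) : Prop where
  measurable_main : Measurable g.main
  measurable_left : ∀ k, Measurable (g.left k)
  measurable_right : ∀ k, Measurable (g.right k)
  bounded : ∃ B : ℝ, ∀ u : ℝ, |g.main u| ≤ B ∧ ∀ k < N, |g.left k u| ≤ B ∧ |g.right k u| ≤ B
  support_main : ∀ u : ℝ, g.main u ≠ 0 → -(N : ℝ) ≤ u ∧ u ≤ (N : ℝ) + 1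
  support_edge : ∃ R : ℝ, ∀ u : ℝ, ∀ k < N, R < |u| → g.left k u = 0 ∧ g.right k u = 0

/-- A compactly supported orthonormal wavelet basis of `L²([0,1])` of
Cohen--Daubechies--Vial type and of regularity `S`. At every level `l ≥ J0` there are `2^l` scaling
functions `φ_{l,m}`, spanning `V_l`, and `2^l` wavelets `ψ_{l,m}`. By `refine_phi`, `refine_psi`,
orthogonality and counting dimensions, `V_{l+1}` is the orthogonal sum of `V_l` and the span of the
`ψ_{l,m}`. -/
structure CDVBasis (S : ℕ) where
  /-- coarsest level -/
  J0 : ℕ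
  /-- number of edge functions at each end point -/
  N : ℕ
  phi : WaveletGen
  psi : WaveletGen
  one_le_J0 : 1 ≤ J0
  S_le : S ≤ 2 ^ J0
  N_le : 2 * N ≤ 2 ^ J0
  adm_phi : phi.IsAdmissible N
  adm_psi : psi.IsAdmissible N
  orth_phi : ∀ l, J0 ≤ l → ∀ m m' : Fin (2 ^ l),
    ∫ x in Set.Icc (0 : ℝ) 1, phi.fn N l m x * phi.fn N l m' x = if m = m' then 1 else 0
  orth_psi : ∀ l, J0 ≤ l → ∀ m m' : Fin (2 ^ l),
    ∫ x in Set.Icc (0 : ℝ) 1, psi.fn N l m x * psi.fn N l m' x = if m = m' then 1 else 0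
  orth_phi_psi : ∀ l, J0 ≤ l → ∀ m m' : Fin (2 ^ l),
    ∫ x in Set.Icc (0 : ℝ) 1, phi.fn N l m x * psi.fn N l m' x = 0
  refine_phi : ∀ l, J0 ≤ l → ∀ m : Fin (2 ^ l), ∃ c : Fin (2 ^ (l + 1)) → ℝ,
    ∀ᵐ x ∂(volume.restrict (Set.Icc (0 : ℝ) 1)),
      phi.fn N l m x = ∑ m', c m' * phi.fn N (l + 1) m' x
  refine_psi : ∀ l, J0 ≤ l → ∀ m : Fin (2 ^ l), ∃ c : Fin (2 ^ (l + 1)) → ℝ,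
    ∀ᵐ x ∂(volume.restrict (Set.Icc (0 : ℝ) 1)),
      psi.fn N l m x = ∑ m', c m' * phi.fn N (l + 1) m' x
  /-- the union of the `V_l` is dense in `L²([0,1])` -/
  dense : ∀ f : ℝ → ℝ, MemLp f 2 (volume.restrict (Set.Icc (0 : ℝ) 1)) → ∀ ε : ℝ, 0 < ε →
    ∃ l, J0 ≤ l ∧ ∃ c : Fin (2 ^ l) → ℝ,
      ∫ x in Set.Icc (0 : ℝ) 1, (f x - ∑ m, c m * phi.fn N l m x) ^ 2 < ε
  /-- every `V_l` contains the polynomials of degree at most `S - 1` -/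
  poly : ∀ l, J0 ≤ l → ∀ r < S, ∃ c : Fin (2 ^ l) → ℝ,
    ∀ᵐ x ∂(volume.restrict (Set.Icc (0 : ℝ) 1)), x ^ r = ∑ m, c m * phi.fn N l m x

/-- The unit cube `[0,1]^d`. -/
def cube (d : ℕ) : Set (Fin d → ℝ) := Set.Icc 0 1

namespace CDVBasis

variable {S : ℕ} (W : CDVBasis S)

/-- The tensor product scaling function `Φ_{l,m}`. -/
noncomputable def Phi (d l : ℕ) (m : Fin d → Fin (2 ^ l)) (x : Fin d → ℝ) : ℝ :=
  ∏ i, W.phi.fn W.N l (m i) (x i)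

/-- The tensor product wavelet `Ψ^ι_{l,m}`: the factor `i` is a wavelet if `ι i` is true and a
scaling function otherwise. -/
noncomputable def Psi (d l : ℕ) (ι : Fin d → Bool) (m : Fin d → Fin (2 ^ l))
    (x : Fin d → ℝ) : ℝ :=
  ∏ i, if ι i then W.psi.fn W.N l (m i) (x i) else W.phi.fn W.N l (m i) (x i)

/-- The projection kernel onto `V_k`, `k = 2^{jd}`. -/
noncomputable def kernel (d j : ℕ) (x y : Fin d → ℝ) : ℝ :=
  ∑ m : Fin d → Fin (2 ^ j), W.Phi d j m x * W.Phi d j m y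

/-- The Hölder ball `H(s, M)` on `[0,1]^d`. On the compact cube, continuity is uniform continuity.
Since the two index sets are independent, the second condition says that the sum of
`2^{J0 (s + d/2)} sup_m |⟨h, Φ_{J0,m}⟩|` and `sup_{l,m,ι} 2^{l (s + d/2)} |⟨h, Ψ^ι_{l,m}⟩|`
is at most `M`. -/
def Holder (d : ℕ) (s M : ℝ) : Set ((Fin d → ℝ) → ℝ) :=
  {h | ContinuousOn h (cube d) ∧
    ∀ m₀ : Fin d → Fin (2 ^ W.J0), ∀ l, W.J0 ≤ l → ∀ m : Fin d → Fin (2 ^ l),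
      ∀ ι : Fin d → Bool, (∃ i, ι i = true) →
        (2 : ℝ) ^ ((W.J0 : ℝ) * (s + (d : ℝ) / 2)) * |∫ x in cube d, h x * W.Phi d W.J0 m₀ x| +
          (2 : ℝ) ^ ((l : ℝ) * (s + (d : ℝ) / 2)) * |∫ x in cube d, h x * W.Psi d l ι m x| ≤ M}

end CDVBasis

/-! ## The statistical model -/

/-- An observation `(X, A, Y)`. -/
abbrev Obs (d : ℕ) : Type := (Fin d → ℝ) × ℝ × ℝ

/-- The σ-algebra generated by `X`. -/
abbrev sigmaX (d : ℕ) : MeasurableSpace (Obs d) :=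
  MeasurableSpace.comap (fun o : Obs d => o.1) inferInstance

/-- `E[A | X]`. -/
noncomputable def condA {d : ℕ} (P : Measure (Obs d)) : Obs d → ℝ :=
  P[fun o : Obs d => o.2.1 | sigmaX d]

/-- `E[Y | X]`. -/
noncomputable def condY {d : ℕ} (P : Measure (Obs d)) : Obs d → ℝ :=
  P[fun o : Obs d => o.2.2 | sigmaX d]

/-- `Cov(A, Y | X)`. -/
noncomputable def condCovAY {d : ℕ} (P : Measure (Obs d)) : Obs d → ℝ :=
  P[fun o : Obs d => (o.2.1 - condA P o) * (o.2.2 - condY P o) | sigmaX d]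

/-- The functional `ψ(P) = E[Cov(A, Y | X)]`. -/
noncomputable def psiFunctional {d : ℕ} (P : Measure (Obs d)) : ℝ := ∫ o, condCovAY P o ∂P

/-- The model `P(α,β)`: `X` is uniform on `[0,1]^d`, `A` and `Y` lie in `[C₁, C₂]` a.s., and
the regression functions `p`, `b` of `A`, `Y` on `X` have versions in `H(α, M)`, `H(β, M)`. -/
def Model {S : ℕ} (W : CDVBasis S) (d : ℕ) (α β M C₁ C₂ : ℝ) : Set (Measure (Obs d)) :=
  {P | IsProbabilityMeasure P ∧
    P.map (fun o : Obs d => o.1) = volume.restrict (cube d) ∧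
    (∀ᵐ o ∂P, o.2.1 ∈ Set.Icc C₁ C₂ ∧ o.2.2 ∈ Set.Icc C₁ C₂) ∧
    (∃ p ∈ W.Holder d α M, condA P =ᵐ[P] fun o => p o.1) ∧
    (∃ b ∈ W.Holder d β M, condY P =ᵐ[P] fun o => b o.1)}

/-! ## Estimators under double sample splitting -/

/-- Four disjoint subsamples of size `n`. -/
abbrev Sample (d n : ℕ) : Type := Fin 4 → Fin n → Obs d

/-- The law of four independent subsamples of size `n`, each i.i.d. from `P`. -/
noncomputable def sampleLaw {d : ℕ} (P : Measure (Obs d)) (n : ℕ) : Measure (Sample d n) :=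
  Measure.pi fun _ : Fin 4 => Measure.pi fun _ : Fin n => P

namespace CDVBasis

variable {S : ℕ} (W : CDVBasis S)

/-- The estimator of `p` of resolution `2^{jd}` computed from one subsample. -/
noncomputable def pHat {d n : ℕ} (j : ℕ) (D : Fin n → Obs d) (x : Fin d → ℝ) : ℝ :=
  (1 / (n : ℝ)) * ∑ i, (D i).2.1 * W.kernel d j (D i).1 x

/-- The estimator of `b` of resolution `2^{jd}` computed from one subsample. -/
noncomputable def bHat {d n : ℕ} (j : ℕ) (D : Fin n → Obs d) (x : Fin d → ℝ) : ℝ :=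
  (1 / (n : ℝ)) * ∑ i, (D i).2.2 * W.kernel d j (D i).1 x

/-- The integral-based plug-in estimator (it does not use the subsample `D 3`). -/
noncomputable def estINT (d n j₁ j₂ : ℕ) (D : Sample d n) : ℝ :=
  (1 / (n : ℝ)) * ∑ i, (D 2 i).2.1 * (D 2 i).2.2 -
    ∫ x in cube d, W.pHat j₁ (D 0) x * W.bHat j₂ (D 1) x

/-- The Monte Carlo-based plug-in estimator. -/
noncomputable def estMC (d n j₁ j₂ : ℕ) (D : Sample d n) : ℝ :=
  (1 / (n : ℝ)) * ∑ i, (D 2 i).2.1 * (D 2 i).2.2 -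
    (1 / (n : ℝ)) * ∑ i, W.pHat j₁ (D 0) (D 3 i).1 * W.bHat j₂ (D 1) (D 3 i).1

/-- The first-order bias-corrected estimator (it does not use the subsample `D 3`). -/
noncomputable def estIF (d n j₁ j₂ : ℕ) (D : Sample d n) : ℝ :=
  (1 / (n : ℝ)) * ∑ i, ((D 2 i).2.1 - W.pHat j₁ (D 0) (D 2 i).1) *
    ((D 2 i).2.2 - W.bHat j₂ (D 1) (D 2 i).1)

end CDVBasis

/-! ## Rates -/

/-- The worst-case mean squared error over the model `Q`, as a function of the subsample size `n`
and of the levels `j₁`, `j₂` (the resolutions being `2^{j₁ d}`, `2^{j₂ d}`). -/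
noncomputable def worstMSE {d : ℕ} (Q : Set (Measure (Obs d)))
    (T : (n j₁ j₂ : ℕ) → Sample d n → ℝ) (n j₁ j₂ : ℕ) : ℝ≥0∞ :=
  ⨆ P ∈ Q, ∫⁻ D, ENNReal.ofReal ((T n j₁ j₂ D - psiFunctional P) ^ 2) ∂(sampleLaw P n)

/-- Worst-case mean squared error of the integral-based plug-in estimator. -/
noncomputable def riskINT {S : ℕ} (W : CDVBasis S) (d : ℕ) (α β M C₁ C₂ : ℝ) :
    ℕ → ℕ → ℕ → ℝ≥0∞ :=
  worstMSE (Model W d α β M C₁ C₂) (W.estINT d)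

/-- Worst-case mean squared error of the Monte Carlo-based plug-in estimator. -/
noncomputable def riskMC {S : ℕ} (W : CDVBasis S) (d : ℕ) (α β M C₁ C₂ : ℝ) :
    ℕ → ℕ → ℕ → ℝ≥0∞ :=
  worstMSE (Model W d α β M C₁ C₂) (W.estMC d)

/-- Worst-case mean squared error of the first-order bias-corrected estimator. -/
noncomputable def riskIF {S : ℕ} (W : CDVBasis S) (d : ℕ) (α β M C₁ C₂ : ℝ) :
    ℕ → ℕ → ℕ → ℝ≥0∞ :=
  worstMSE (Model W d α β M C₁ C₂) (W.estIF d)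

/-- With the levels `j₁ n`, `j₂ n`, the risk `R` is `O(r n)`. -/
def AchievesRate (R : ℕ → ℕ → ℕ → ℝ≥0∞) (j₁ j₂ : ℕ → ℕ) (r : ℕ → ℝ) : Prop :=
  ∃ C : ℝ, 0 < C ∧ ∀ᶠ n in atTop, R n (j₁ n) (j₂ n) ≤ ENNReal.ofReal (C * r n)

/-- `r` is the best rate of the risk `R` over all choices of levels `≥ J0`: no choice beats the
order `r`, and some choice achieves it. -/
def IsBestRate (R : ℕ → ℕ → ℕ → ℝ≥0∞) (J0 : ℕ) (r : ℕ → ℝ) : Prop :=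
  (∃ c : ℝ, 0 < c ∧ ∀ᶠ n in atTop, ∀ j₁ j₂ : ℕ, J0 ≤ j₁ → J0 ≤ j₂ →
      ENNReal.ofReal (c * r n) ≤ R n j₁ j₂) ∧
    ∃ j₁ j₂ : ℕ → ℕ, (∀ n, J0 ≤ j₁ n) ∧ (∀ n, J0 ≤ j₂ n) ∧ AchievesRate R j₁ j₂ r

/-- The minimax rate for estimating `ψ(P)`. -/
noncomputable def minimaxRate (d : ℕ) (α β : ℝ) (n : ℕ) : ℝ :=
  if (d : ℝ) / 4 ≤ (α + β) / 2 then (n : ℝ) ^ (-1 : ℝ)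
  else (n : ℝ) ^ (-((4 * α + 4 * β) / (2 * α + 2 * β + d)))

/-- The best rate of the Monte Carlo-based plug-in estimator. -/
noncomputable def mcRate (d : ℕ) (α β : ℝ) (n : ℕ) : ℝ :=
  if (d : ℝ) / 4 ≤ (α + β) / 2 then (n : ℝ) ^ (-1 : ℝ)
  else (n : ℝ) ^ (-((3 * α + 3 * β) / (α + β + d)))

/-- The resolution `2^{jd}`. -/
noncomputable def resolution (d j : ℕ) : ℝ := (2 : ℝ) ^ (j * d)

/-- The order `n^{d/(2s+d)}` of the prediction-optimal resolution for smoothness `s`. -/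
noncomputable def predOrder (d : ℕ) (s : ℝ) (n : ℕ) : ℝ := (n : ℝ) ^ ((d : ℝ) / (2 * s + d))

/-- Prediction-optimal resolutions for smoothness `s`: `2^{j(n) d} ≍ n^{d/(2s+d)}`. -/
def PredOptimal (d : ℕ) (s : ℝ) (j : ℕ → ℕ) : Prop :=
  (fun n => resolution d (j n)) =Θ[atTop] predOrder d s

/-- Undersmoothing: the resolutions grow faster than the prediction-optimal ones. -/
def Undersmooths (d : ℕ) (s : ℝ) (j : ℕ → ℕ) : Prop :=
  Tendsto (fun n => resolution d (j n) / predOrder d s n) atTop atTop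

/-!
The theorem is read off from bounds on the three worst-case risks that hold for all `n`, `k₁`, `k₂`
at once. Put `e = 2(α+β)/d`, so that `k^{-e}` is the order of the squared bias at resolution `k`,
and write `k_min`, `k_max` for the smaller and the larger of the two resolutions.

*Bias.* Since the spaces `V_k` are nested, `⟨Π₁p, Π₂b⟩` only depends on the coarser projection, and
the bias of both plug-in estimators is `⟨p, b⟩ - ⟨Πp, Πb⟩` at resolution `k_min`; the bias of the
first-order estimator is `⟨p - Π₁p, b - Π₂b⟩`, which is the same form (`CDVBasis.errForm`) at
resolution `k_max`. The telescoping sum of the wavelet levels bounds it by a multiple of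
`2^{-j(α+β)}` (`CDVBasis.abs_integral_sub_projForm_le`). Conversely, among the first `2^{j+1}`
orthonormal cosine functions one has at most half of its energy in the `2^j`-dimensional space
`V_j`, while its wavelet coefficients decay as required because the wavelets have `S` vanishing
moments; adding multiples of tensor powers of this function to an interior point of the model, with
suitable signs, gives a bias of order `2^{-j(α+β)}` (`CDVBasis.exists_errForm_ge`).

*Variance.* Each estimator is an average over one subsample given the others, so that its mean
squared error is computed by integrating out the subsamples one after the other
(`lintegral_sampleLaw_update`, `lintegral_sq_add_avg`). This gives the upper bounds
`1/n + k_min/n² + k_min^{-e}` for the integral-based estimator, where `k_min` is the squared `L²`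
norm of the composed kernel, and `(1 + k₁/n)(1 + k₂/n)/n + k^{-e}`, with `k = k_min` or
`k = k_max`, for the other two. For the lower bounds a single law is enough at each pair of levels:
`A = p(X) ± δ`, `Y = b(X) ± δ` with independent fair signs and with the regression functions of
maximal bias (`signLaw`). The conditional variance of a weighted average of `A` or `Y` is then at
least `δ²/n` times the squared norm of the weight, whence risks of order at least
`1/n + k_min/n² + k_min^{-e}`, `1/n + k_min²/n³ + k_min^{-e}` and `1/n + k_max/n² + k_max^{-e}`
respectively (`CDVBasis.riskLower_riskINT`, `CDVBasis.riskLower_riskMC`,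
`CDVBasis.riskLower_riskIF`).

*Rates.* Balancing `k^{-e}` against `k^a/n^{a+1}`, with `a = 2` for Monte Carlo integration and
`a = 1` otherwise, gives the best rate `n^{-ρ}`. Achieving it forces `k^{-e} = O(n^{-ρ})` for the
resolution `k` that governs the bias, hence `k ≥ c n^{ρ/e}`. By `lt_rateExp_div` the exponent `ρ/e`
exceeds `d/(2α+d)` as soon as `β < d/2`, and symmetrically, which is the necessity of
undersmoothing: of both resolutions if the bias is governed by `k_min`, of one of them if it is
governed by `k_max`.
-/


/-! ### One-dimensional scaling functions and wavelets -/

lemma two_rpow_half_mul_self (l : ℕ) : (2 : ℝ) ^ ((l : ℝ) / 2) * (2 : ℝ) ^ ((l : ℝ) / 2) = 2 ^ l := by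
  rw [← Real.rpow_add two_pos, add_halves, Real.rpow_natCast]

lemma two_rpow_half_pos (l : ℕ) : 0 < (2 : ℝ) ^ ((l : ℝ) / 2) := Real.rpow_pos_of_pos two_pos _

namespace WaveletGen

variable {g : WaveletGen} {N : ℕ}

lemma IsAdmissible.measurable_fn (h : g.IsAdmissible N) (l : ℕ) (m : Fin (2 ^ l)) :
    Measurable (g.fn N l m) := by
  have h1 := h.measurable_main
  have h2 := h.measurable_left
  have h3 := h.measurable_right
  unfold WaveletGen.fn
  refine Measurable.const_mul ?_ _
  split_ifs
  · exact (h2 _).comp (by fun_prop)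
  · exact h1.comp (by fun_prop)
  · exact (h3 _).comp (by fun_prop)

/-- The functions of level `l` are of size `2^{l/2}` and live within `R 2^{-l}` of the grid point
`m 2^{-l}`. -/
lemma IsAdmissible.exists_bound (h : g.IsAdmissible N) :
    ∃ B R : ℝ, 0 < B ∧ 1 ≤ R ∧ ∀ (l : ℕ) (m : Fin (2 ^ l)) (x : ℝ),
      |g.fn N l m x| ≤ B * (2 : ℝ) ^ ((l : ℝ) / 2) ∧
      (g.fn N l m x ≠ 0 → |2 ^ l * x - (m : ℕ)| ≤ R) := by
  obtain ⟨B, hB⟩ := h.bounded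
  obtain ⟨R, hR⟩ := h.support_edge
  refine ⟨|B| + 1, |R| + N + 1, by positivity, by
    have := abs_nonneg R; have : (0 : ℝ) ≤ N := by positivity
    linarith, fun l m x => ?_⟩
  have hs := two_rpow_half_pos l
  have hN0 : (0 : ℝ) ≤ N := by positivity
  have hR0 := abs_nonneg R
  have hBB : ∀ v : ℝ, |v| ≤ B → |v| ≤ |B| + 1 := fun v hv => by
    have := le_abs_self B; linarith
  unfold WaveletGen.fn
  split_ifs with h1 h2
  · refine ⟨?_, fun hne => ?_⟩
    · rw [abs_mul, abs_of_pos hs, mul_comm]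
      exact mul_le_mul_of_nonneg_right (hBB _ ((hB _).2 _ h1).1) hs.le
    · have hle : |(2 : ℝ) ^ l * x| ≤ R := by
        by_contra hcon
        exact hne (by rw [(hR _ _ h1 (not_le.1 hcon)).1, mul_zero])
      have hm : ((m : ℕ) : ℝ) ≤ N := by exact_mod_cast h1.le
      have hm0 : (0 : ℝ) ≤ ((m : ℕ) : ℝ) := by positivity
      have := le_abs_self R
      rw [abs_le] at hle ⊢
      constructor <;> linarith
  · refine ⟨?_, fun hne => ?_⟩
    · rw [abs_mul, abs_of_pos hs, mul_comm]
      exact mul_le_mul_of_nonneg_right (hBB _ (hB _).1) hs.le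
    · have := h.support_main _ (right_ne_zero_of_mul hne)
      rw [abs_le]
      constructor <;> linarith [this.1, this.2]
  · have hm := m.2
    have h3 : 2 ^ l - 1 - (m : ℕ) < N := by omega
    refine ⟨?_, fun hne => ?_⟩
    · rw [abs_mul, abs_of_pos hs, mul_comm]
      exact mul_le_mul_of_nonneg_right (hBB _ ((hB _).2 _ h3).2) hs.le
    · have hle : |(2 : ℝ) ^ l * (1 - x)| ≤ R := by
        by_contra hcon
        exact hne (by rw [(hR _ _ h3 (not_le.1 hcon)).2, mul_zero])
      have hm1 : ((m : ℕ) : ℝ) ≤ 2 ^ l := by exact_mod_cast hm.le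
      have hm2 : (2 : ℝ) ^ l ≤ (m : ℕ) + N := by exact_mod_cast (not_lt.1 h2)
      have := le_abs_self R
      rw [abs_le] at hle ⊢
      constructor <;> linarith

end WaveletGen

lemma card_fin_near_le (n : ℕ) (y R : ℝ) (hR : 0 ≤ R) :
    ((Finset.univ.filter fun m : Fin n => |y - (m : ℕ)| ≤ R).card : ℝ) ≤ 2 * R + 1 := by
  have hsub : (Finset.univ.filter fun m : Fin n => |y - (m : ℕ)| ≤ R).card ≤
      (Finset.Icc ⌈y - R⌉ ⌊y + R⌋).card := by
    refine Finset.card_le_card_of_injOn (fun m => ((m : ℕ) : ℤ)) ?_ ?_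
    · intro m hm
      simp only [Finset.coe_filter, Finset.mem_univ, true_and, Set.mem_ofPred_eq, abs_le] at hm
      simp only [Finset.coe_Icc, Set.mem_Icc, Int.ceil_le, Int.le_floor]
      push_cast
      constructor <;> linarith [hm.1, hm.2]
    · intro a _ b _ hab
      exact Fin.ext (by simpa using hab)
  have hcard : ((Finset.Icc ⌈y - R⌉ ⌊y + R⌋).card : ℝ) ≤ 2 * R + 1 := by
    rw [Int.card_Icc]
    have h1 := Int.le_ceil (y - R)
    have h2 := Int.floor_le (y + R)
    rcases le_total 0 (⌊y + R⌋ + 1 - ⌈y - R⌉) with h | h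
    · have : (((⌊y + R⌋ + 1 - ⌈y - R⌉).toNat : ℤ) : ℝ) = ((⌊y + R⌋ + 1 - ⌈y - R⌉ : ℤ) : ℝ) := by
        rw [Int.toNat_of_nonneg h]
      rw [Int.cast_natCast] at this
      rw [this]; push_cast; linarith
    · rw [Int.toNat_of_nonpos h]; simp; linarith
  exact (Nat.cast_le.2 hsub).trans hcard

instance isProbabilityMeasure_unitInterval :
    IsProbabilityMeasure (volume.restrict (Set.Icc (0 : ℝ) 1)) :=
  ⟨by simp⟩

/-- A bounded measurable function on a finite measure space is integrable. -/
lemma integrable_of_abs_le {Ω : Type*} [MeasurableSpace Ω] {P : Measure Ω} [IsFiniteMeasure P]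
    {f : Ω → ℝ} (hf : Measurable f) {C : ℝ} (hC : ∀ x, |f x| ≤ C) : Integrable f P :=
  Integrable.of_bound hf.aestronglyMeasurable C (Eventually.of_forall hC)

/-- Size and localization of a family of `2^l` functions at level `l`. -/
structure IsLocalized (B R : ℝ) (l : ℕ) (f : Fin (2 ^ l) → ℝ → ℝ) : Prop where
  measurable : ∀ m, Measurable (f m)
  bound : ∀ m x, |f m x| ≤ B * (2 : ℝ) ^ ((l : ℝ) / 2)
  support : ∀ m x, f m x ≠ 0 → |2 ^ l * x - (m : ℕ)| ≤ R

namespace IsLocalized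

variable {B R : ℝ} {l : ℕ} {f : Fin (2 ^ l) → ℝ → ℝ}

lemma sum_abs_pow_le (h : IsLocalized B R l f) (hB : 0 < B) (hR : 1 ≤ R) (r : ℕ) (hr : r ≠ 0)
    (x : ℝ) :
    ∑ m, |f m x| ^ r ≤ (2 * R + 1) * (B * (2 : ℝ) ^ ((l : ℝ) / 2)) ^ r := by
  have hs := two_rpow_half_pos l
  calc ∑ m, |f m x| ^ r
      = ∑ m ∈ Finset.univ.filter (fun m : Fin (2 ^ l) => |2 ^ l * x - (m : ℕ)| ≤ R),
          |f m x| ^ r := by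
        symm
        refine Finset.sum_subset (Finset.filter_subset _ _) fun m _ hm => ?_
        have : f m x = 0 := by
          by_contra hne
          exact hm (by simpa using h.support m x hne)
        simp [this, hr]
    _ ≤ ∑ m ∈ Finset.univ.filter (fun m : Fin (2 ^ l) => |2 ^ l * x - (m : ℕ)| ≤ R),
          (B * (2 : ℝ) ^ ((l : ℝ) / 2)) ^ r :=
        Finset.sum_le_sum fun m _ => pow_le_pow_left₀ (abs_nonneg _) (h.bound m x) r
    _ ≤ _ := by
        rw [Finset.sum_const, nsmul_eq_mul]
        exact mul_le_mul_of_nonneg_right (card_fin_near_le _ _ _ (by linarith)) (by positivity)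

lemma integral_abs_mul_le (h : IsLocalized B R l f) (hB : 0 < B) (hR : 1 ≤ R) (m : Fin (2 ^ l))
    {u : ℝ → ℝ} {A : ℝ} (hA : 0 ≤ A) (hu : ∀ x : ℝ, |2 ^ l * x - (m : ℕ)| ≤ R → |u x| ≤ A) :
    ∫ x in Set.Icc (0 : ℝ) 1, |f m x * u x| ≤ 2 * R * B * A * (2 : ℝ) ^ (-((l : ℝ) / 2)) := by
  have hs := two_rpow_half_pos l
  have h2l : (0 : ℝ) < 2 ^ l := by positivity
  set s := Set.Icc (((m : ℕ) - R) / 2 ^ l) (((m : ℕ) + R) / 2 ^ l) with hsdef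
  have hle : ∀ x, |f m x * u x| ≤ s.indicator (fun _ => B * (2 : ℝ) ^ ((l : ℝ) / 2) * A) x := by
    intro x
    by_cases hx : f m x = 0
    · rw [hx, zero_mul, abs_zero]
      exact Set.indicator_nonneg (fun _ _ => by positivity) x
    · have h1 := h.support m x hx
      have hmem : x ∈ s := by
        rw [abs_le] at h1
        rw [hsdef, Set.mem_Icc, div_le_iff₀ h2l, le_div_iff₀ h2l]
        constructor <;> linarith [h1.1, h1.2]
      rw [Set.indicator_of_mem hmem, abs_mul]
      exact mul_le_mul (h.bound m x) (hu x h1) (abs_nonneg _) (by positivity)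
  have hint : IntegrableOn (fun _ : ℝ => B * (2 : ℝ) ^ ((l : ℝ) / 2) * A) s :=
    integrableOn_const (by simp [hsdef])
  have hint' := (integrable_indicator_iff (measurableSet_Icc : MeasurableSet s)).2 hint
  calc ∫ x in Set.Icc (0 : ℝ) 1, |f m x * u x|
      ≤ ∫ x in Set.Icc (0 : ℝ) 1, s.indicator (fun _ => B * (2 : ℝ) ^ ((l : ℝ) / 2) * A) x :=
        integral_mono_of_nonneg (Eventually.of_forall fun _ => abs_nonneg _) hint'.integrableOn
          (Eventually.of_forall hle)
    _ ≤ ∫ x, s.indicator (fun _ => B * (2 : ℝ) ^ ((l : ℝ) / 2) * A) x :=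
        setIntegral_le_integral hint' (Eventually.of_forall fun x =>
          Set.indicator_nonneg (fun _ _ => by positivity) x)
    _ = 2 * R * B * A * (2 : ℝ) ^ (-((l : ℝ) / 2)) := by
        rw [integral_indicator measurableSet_Icc, setIntegral_const, Real.volume_real_Icc,
          max_eq_left (by rw [sub_nonneg]; gcongr; linarith), Real.rpow_neg two_pos.le, smul_eq_mul,
          ← sub_div, ← two_rpow_half_mul_self]
        field_simp
        ring

end IsLocalized

namespace CDVBasis

variable {S : ℕ} (W : CDVBasis S)

/-- Common constants in the size and localization bounds of the scaling functions and wavelets. -/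
lemma exists_isLocalized : ∃ B R : ℝ, 0 < B ∧ 1 ≤ R ∧ ∀ l,
    IsLocalized B R l (W.phi.fn W.N l) ∧ IsLocalized B R l (W.psi.fn W.N l) := by
  obtain ⟨B₁, R₁, hB₁, hR₁, h₁⟩ := W.adm_phi.exists_bound
  obtain ⟨B₂, R₂, hB₂, hR₂, h₂⟩ := W.adm_psi.exists_bound
  refine ⟨max B₁ B₂, max R₁ R₂, lt_max_of_lt_left hB₁, le_max_of_le_left hR₁, fun l => ⟨?_, ?_⟩⟩
  · exact ⟨W.adm_phi.measurable_fn l, fun m x => ((h₁ l m x).1).trans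
      (mul_le_mul_of_nonneg_right (le_max_left _ _) (two_rpow_half_pos l).le),
      fun m x hne => ((h₁ l m x).2 hne).trans (le_max_left _ _)⟩
  · exact ⟨W.adm_psi.measurable_fn l, fun m x => ((h₂ l m x).1).trans
      (mul_le_mul_of_nonneg_right (le_max_right _ _) (two_rpow_half_pos l).le),
      fun m x hne => ((h₂ l m x).2 hne).trans (le_max_right _ _)⟩

/-- The constant `B` of `exists_isLocalized`. -/
noncomputable def sizeConst : ℝ := W.exists_isLocalized.choose

/-- The constant `R` of `exists_isLocalized`. -/
noncomputable def locConst : ℝ := W.exists_isLocalized.choose_spec.choose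

lemma sizeConst_pos : 0 < W.sizeConst := W.exists_isLocalized.choose_spec.choose_spec.1

lemma one_le_locConst : 1 ≤ W.locConst := W.exists_isLocalized.choose_spec.choose_spec.2.1

lemma isLocalized_phi (l : ℕ) : IsLocalized W.sizeConst W.locConst l (W.phi.fn W.N l) :=
  (W.exists_isLocalized.choose_spec.choose_spec.2.2 l).1

lemma isLocalized_psi (l : ℕ) : IsLocalized W.sizeConst W.locConst l (W.psi.fn W.N l) :=
  (W.exists_isLocalized.choose_spec.choose_spec.2.2 l).2

/-- Interval kernel of the projection onto `V_l`. -/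
noncomputable def kernelOne (l : ℕ) (x y : ℝ) : ℝ :=
  ∑ m : Fin (2 ^ l), W.phi.fn W.N l m x * W.phi.fn W.N l m y

/-- Interval kernel of the projection onto the wavelets of level `l`. -/
noncomputable def waveKernelOne (l : ℕ) (x y : ℝ) : ℝ :=
  ∑ m : Fin (2 ^ l), W.psi.fn W.N l m x * W.psi.fn W.N l m y

lemma measurable_phi (l : ℕ) (m : Fin (2 ^ l)) : Measurable (W.phi.fn W.N l m) :=
  W.adm_phi.measurable_fn l m

lemma measurable_psi (l : ℕ) (m : Fin (2 ^ l)) : Measurable (W.psi.fn W.N l m) :=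
  W.adm_psi.measurable_fn l m

lemma integrable_phi_mul_phi (l l' : ℕ) (m : Fin (2 ^ l)) (m' : Fin (2 ^ l')) :
    Integrable (fun x => W.phi.fn W.N l m x * W.phi.fn W.N l' m' x)
      (volume.restrict (Set.Icc (0 : ℝ) 1)) :=
  integrable_of_abs_le ((W.measurable_phi l m).mul (W.measurable_phi l' m')) fun x => by
    rw [abs_mul]
    exact mul_le_mul ((W.isLocalized_phi l).bound m x) ((W.isLocalized_phi l').bound m' x)
      (abs_nonneg _) (mul_nonneg W.sizeConst_pos.le (two_rpow_half_pos l).le)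

/-- `K(x,x) ≲ 2^l` uniformly in `x`. -/
lemma kernelOne_self_le (l : ℕ) (x : ℝ) :
    W.kernelOne l x x ≤ (2 * W.locConst + 1) * W.sizeConst ^ 2 * 2 ^ l := by
  have h := (W.isLocalized_phi l).sum_abs_pow_le W.sizeConst_pos W.one_le_locConst 2 two_ne_zero x
  simp only [sq_abs] at h
  have h2 := two_rpow_half_mul_self l
  calc W.kernelOne l x x = ∑ m, W.phi.fn W.N l m x ^ 2 := by simp [kernelOne, sq]
    _ ≤ _ := h
    _ = _ := by rw [mul_pow, sq ((2 : ℝ) ^ ((l : ℝ) / 2)), h2]; ring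

lemma integral_abs_phi_le (l : ℕ) (m : Fin (2 ^ l)) :
    ∫ y in Set.Icc (0 : ℝ) 1, |W.phi.fn W.N l m y| ≤
      2 * W.locConst * W.sizeConst * (2 : ℝ) ^ (-((l : ℝ) / 2)) := by
  simpa using (W.isLocalized_phi l).integral_abs_mul_le W.sizeConst_pos W.one_le_locConst m
    (u := fun _ => 1) zero_le_one (fun x _ => by simp)

lemma integrable_phi (l : ℕ) (m : Fin (2 ^ l)) :
    Integrable (W.phi.fn W.N l m) (volume.restrict (Set.Icc (0 : ℝ) 1)) :=
  integrable_of_abs_le (W.measurable_phi l m) ((W.isLocalized_phi l).bound m)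

/-- The kernels are bounded on `L^∞` uniformly in the level. -/
lemma integral_abs_kernelOne_le (l : ℕ) (x : ℝ) :
    ∫ y in Set.Icc (0 : ℝ) 1, |W.kernelOne l x y| ≤
      (2 * W.locConst + 1) * (2 * W.locConst) * W.sizeConst ^ 2 := by
  have hB := W.sizeConst_pos
  have hR := W.one_le_locConst
  have hs := two_rpow_half_pos l
  have h1 := (W.isLocalized_phi l).sum_abs_pow_le hB hR 1 one_ne_zero x
  simp only [pow_one] at h1
  calc ∫ y in Set.Icc (0 : ℝ) 1, |W.kernelOne l x y|
      ≤ ∫ y in Set.Icc (0 : ℝ) 1, ∑ m, |W.phi.fn W.N l m x| * |W.phi.fn W.N l m y| := by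
        refine integral_mono_of_nonneg (Eventually.of_forall fun _ => abs_nonneg _) ?_
          (Eventually.of_forall fun y => ?_)
        · exact integrable_finsetSum _ fun m _ => ((W.integrable_phi l m).abs).const_mul _
        · refine (Finset.abs_sum_le_sum_abs _ _).trans_eq ?_
          simp only [abs_mul]
    _ = ∑ m, |W.phi.fn W.N l m x| * ∫ y in Set.Icc (0 : ℝ) 1, |W.phi.fn W.N l m y| := by
        rw [integral_finsetSum _ fun m _ => ((W.integrable_phi l m).abs).const_mul _]
        simp only [integral_const_mul]
    _ ≤ ∑ m, |W.phi.fn W.N l m x| *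
          (2 * W.locConst * W.sizeConst * (2 : ℝ) ^ (-((l : ℝ) / 2))) :=
        Finset.sum_le_sum fun m _ => mul_le_mul_of_nonneg_left (W.integral_abs_phi_le l m)
          (abs_nonneg _)
    _ ≤ (2 * W.locConst + 1) * (W.sizeConst * (2 : ℝ) ^ ((l : ℝ) / 2)) *
          (2 * W.locConst * W.sizeConst * (2 : ℝ) ^ (-((l : ℝ) / 2))) := by
        rw [← Finset.sum_mul]
        exact mul_le_mul_of_nonneg_right h1 (by positivity)
    _ = _ := by
        rw [Real.rpow_neg two_pos.le]; field_simp

lemma abs_sub_le_of_kernelOne_ne_zero {l : ℕ} {x y : ℝ} (h : W.kernelOne l x y ≠ 0) :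
    |x - y| ≤ 2 * W.locConst / 2 ^ l := by
  obtain ⟨m, -, hm⟩ := Finset.exists_ne_zero_of_sum_ne_zero h
  have h1 := (W.isLocalized_phi l).support m x (left_ne_zero_of_mul hm)
  have h2 := (W.isLocalized_phi l).support m y (right_ne_zero_of_mul hm)
  rw [le_div_iff₀ (by positivity), ← abs_of_pos (show (0 : ℝ) < 2 ^ l by positivity), ← abs_mul]
  rw [abs_le] at *
  constructor <;> linarith [h1.1, h1.2, h2.1, h2.2]

/-- Coefficients in `V_l` are inner products with the scaling functions. -/
lemma eq_sum_integral_mul_phi {l : ℕ} (hl : W.J0 ≤ l) {f : ℝ → ℝ} {c : Fin (2 ^ l) → ℝ}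
    (hf : ∀ᵐ x ∂(volume.restrict (Set.Icc (0 : ℝ) 1)), f x = ∑ m, c m * W.phi.fn W.N l m x)
    (m : Fin (2 ^ l)) : ∫ x in Set.Icc (0 : ℝ) 1, f x * W.phi.fn W.N l m x = c m := by
  have h1 : ∫ x in Set.Icc (0 : ℝ) 1, f x * W.phi.fn W.N l m x =
      ∫ x in Set.Icc (0 : ℝ) 1, ∑ m', c m' * (W.phi.fn W.N l m' x * W.phi.fn W.N l m x) := by
    refine integral_congr_ae (hf.mono fun x hx => ?_)
    simp only [hx, Finset.sum_mul, mul_assoc]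
  rw [h1, integral_finsetSum _ fun m' _ => (W.integrable_phi_mul_phi l l m' m).const_mul _]
  simp only [integral_const_mul, W.orth_phi l hl]
  simp

/-- The spaces `V_l` increase. -/
lemma exists_refine_phi {i j : ℕ} (hi : W.J0 ≤ i) (hij : i ≤ j) (m : Fin (2 ^ i)) :
    ∃ c : Fin (2 ^ j) → ℝ, ∀ᵐ x ∂(volume.restrict (Set.Icc (0 : ℝ) 1)),
      W.phi.fn W.N i m x = ∑ m', c m' * W.phi.fn W.N j m' x := by
  induction j, hij using Nat.le_induction with
  | base =>
    exact ⟨fun m' => if m' = m then 1 else 0, Eventually.of_forall fun x => by simp⟩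
  | succ j hij ih =>
    obtain ⟨c, hc⟩ := ih
    choose c' hc' using fun m' => W.refine_phi j (hi.trans hij) m'
    refine ⟨fun k => ∑ m', c m' * c' m' k, ?_⟩
    have hall : ∀ᵐ x ∂(volume.restrict (Set.Icc (0 : ℝ) 1)), ∀ m',
        W.phi.fn W.N j m' x = ∑ k, c' m' k * W.phi.fn W.N (j + 1) k x :=
      ae_all_iff.2 hc'
    filter_upwards [hc, hall] with x h1 h2
    rw [h1]
    simp only [h2, Finset.mul_sum, Finset.sum_mul]
    rw [Finset.sum_comm]
    simp only [mul_assoc]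

lemma phi_eq_sum_of_le {i j : ℕ} (hi : W.J0 ≤ i) (hij : i ≤ j) (m : Fin (2 ^ i)) :
    ∀ᵐ x ∂(volume.restrict (Set.Icc (0 : ℝ) 1)), W.phi.fn W.N i m x =
      ∑ m', (∫ y in Set.Icc (0 : ℝ) 1, W.phi.fn W.N i m y * W.phi.fn W.N j m' y) *
        W.phi.fn W.N j m' x := by
  obtain ⟨c, hc⟩ := W.exists_refine_phi hi hij m
  simpa only [W.eq_sum_integral_mul_phi (hi.trans hij) hc] using hc

/-- Polynomials of degree less than `S` are reproduced at every level. -/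
lemma exists_eq_sum_phi_of_polynomial {l : ℕ} (hl : W.J0 ≤ l) (q : Polynomial ℝ)
    (hq : q.natDegree < S) : ∃ c : Fin (2 ^ l) → ℝ,
    ∀ᵐ x ∂(volume.restrict (Set.Icc (0 : ℝ) 1)), q.eval x = ∑ m, c m * W.phi.fn W.N l m x := by
  have hpoly := W.poly l hl
  have : ∀ r : Fin (q.natDegree + 1), ∃ c : Fin (2 ^ l) → ℝ,
    ∀ᵐ x ∂(volume.restrict (Set.Icc (0 : ℝ) 1)), x ^ (r : ℕ) = ∑ m, c m * W.phi.fn W.N l m x :=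
    fun r => hpoly r (by omega)
  choose c hc using this
  refine ⟨fun m => ∑ r : Fin (q.natDegree + 1), q.coeff r * c r m, ?_⟩
  filter_upwards [ae_all_iff.2 hc] with x hx
  rw [Polynomial.eval_eq_sum_range, Finset.sum_range (fun i => q.coeff i * x ^ i)]
  simp only [hx, Finset.mul_sum, Finset.sum_mul]
  rw [Finset.sum_comm]
  simp only [mul_assoc]

/-- The wavelets have `S` vanishing moments. -/
lemma integral_psi_mul_polynomial {l : ℕ} (hl : W.J0 ≤ l) (m : Fin (2 ^ l)) (q : Polynomial ℝ)
    (hq : q.natDegree < S) :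
    ∫ x in Set.Icc (0 : ℝ) 1, W.psi.fn W.N l m x * q.eval x = 0 := by
  obtain ⟨c, hc⟩ := W.exists_eq_sum_phi_of_polynomial hl q hq
  have hint : ∀ m', Integrable (fun x => W.phi.fn W.N l m' x * W.psi.fn W.N l m x)
      (volume.restrict (Set.Icc (0 : ℝ) 1)) := fun m' =>
    integrable_of_abs_le ((W.measurable_phi l m').mul (W.measurable_psi l m)) fun x => by
      rw [abs_mul]
      exact mul_le_mul ((W.isLocalized_phi l).bound m' x) ((W.isLocalized_psi l).bound m x)
        (abs_nonneg _) (mul_nonneg W.sizeConst_pos.le (two_rpow_half_pos l).le)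
  have h1 : ∫ x in Set.Icc (0 : ℝ) 1, W.psi.fn W.N l m x * q.eval x =
      ∫ x in Set.Icc (0 : ℝ) 1, ∑ m', c m' * (W.phi.fn W.N l m' x * W.psi.fn W.N l m x) := by
    refine integral_congr_ae (hc.mono fun x hx => ?_)
    simp only [hx, Finset.mul_sum]
    exact Finset.sum_congr rfl fun _ _ => by ring
  rw [h1, integral_finsetSum _ fun m' _ => (hint m').const_mul _]
  simp only [integral_const_mul, W.orth_phi_psi l hl, mul_zero, Finset.sum_const_zero]

/-- The kernels integrate to one, since `V_l` contains the constants. -/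
lemma integral_kernelOne (hS : 1 ≤ S) {l : ℕ} (hl : W.J0 ≤ l) :
    ∀ᵐ x ∂(volume.restrict (Set.Icc (0 : ℝ) 1)),
      ∫ y in Set.Icc (0 : ℝ) 1, W.kernelOne l x y = 1 := by
  obtain ⟨c, hc⟩ := W.poly l hl 0 hS
  have hc' := W.eq_sum_integral_mul_phi hl hc
  simp only [pow_zero, one_mul] at hc'
  filter_upwards [hc] with x hx
  simp only [kernelOne]
  rw [integral_finsetSum _ fun m _ => (W.integrable_phi l m).const_mul _]
  simp only [integral_const_mul, hc']
  rw [pow_zero] at hx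
  rw [hx]
  exact Finset.sum_congr rfl fun _ _ => mul_comm _ _

/-- `2^l ≲ K(x,x)`: the constant `1` is reproduced by boundedly many functions near `x`, each with
a coefficient of size `2^{-l/2}`. -/
lemma le_kernelOne_self (hS : 1 ≤ S) {l : ℕ} (hl : W.J0 ≤ l) :
    ∀ᵐ x ∂(volume.restrict (Set.Icc (0 : ℝ) 1)),
      2 ^ l ≤ (2 * W.locConst + 1) * (2 * W.locConst * W.sizeConst) ^ 2 * W.kernelOne l x x := by
  have hR := W.one_le_locConst
  have hB := W.sizeConst_pos
  obtain ⟨c, hc⟩ := W.poly l hl 0 hS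
  have hc' := W.eq_sum_integral_mul_phi hl hc
  simp only [pow_zero, one_mul] at hc'
  have hcb : ∀ m, c m ^ 2 ≤ (2 * W.locConst * W.sizeConst) ^ 2 * (2 ^ l)⁻¹ := by
    intro m
    have h1 : |c m| ≤ 2 * W.locConst * W.sizeConst * (2 : ℝ) ^ (-((l : ℝ) / 2)) := by
      rw [← hc' m]
      exact (abs_integral_le_integral_abs).trans (W.integral_abs_phi_le l m)
    have h2 := pow_le_pow_left₀ (abs_nonneg _) h1 2
    rw [sq_abs, mul_pow _ ((2 : ℝ) ^ (-((l : ℝ) / 2))), Real.rpow_neg two_pos.le, inv_pow,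
      sq ((2 : ℝ) ^ ((l : ℝ) / 2)), two_rpow_half_mul_self] at h2
    exact h2
  filter_upwards [hc] with x hx
  rw [pow_zero] at hx
  set T := Finset.univ.filter (fun m : Fin (2 ^ l) => |2 ^ l * x - (m : ℕ)| ≤ W.locConst)
  have h1 : 1 = ∑ m ∈ T, c m * W.phi.fn W.N l m x := by
    rw [hx]; symm
    refine Finset.sum_subset (Finset.filter_subset _ _) fun m _ hm => ?_
    have : W.phi.fn W.N l m x = 0 := by
      by_contra hne
      exact hm (by simpa [T] using (W.isLocalized_phi l).support m x hne)
    simp [this]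
  have h2 := Finset.sum_mul_sq_le_sq_mul_sq T c (fun m => W.phi.fn W.N l m x)
  rw [← h1] at h2
  have h3 : ∑ m ∈ T, c m ^ 2 ≤
      (2 * W.locConst + 1) * ((2 * W.locConst * W.sizeConst) ^ 2 * (2 ^ l)⁻¹) := by
    refine (Finset.sum_le_sum fun m _ => hcb m).trans ?_
    rw [Finset.sum_const, nsmul_eq_mul]
    exact mul_le_mul_of_nonneg_right (card_fin_near_le _ _ _ (by linarith)) (by positivity)
  have h4 : ∑ m ∈ T, W.phi.fn W.N l m x ^ 2 ≤ W.kernelOne l x x := by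
    have : W.kernelOne l x x = ∑ m, W.phi.fn W.N l m x ^ 2 := by simp [kernelOne, sq]
    rw [this]
    exact Finset.sum_le_sum_of_subset_of_nonneg (Finset.filter_subset _ _) fun _ _ _ => sq_nonneg _
  have h5 : (1 : ℝ) ≤ (2 * W.locConst + 1) * ((2 * W.locConst * W.sizeConst) ^ 2 * (2 ^ l)⁻¹) *
      W.kernelOne l x x := by
    rw [one_pow] at h2
    exact h2.trans (mul_le_mul h3 h4 (Finset.sum_nonneg fun _ _ => sq_nonneg _) (by positivity))
  have h2l : (0 : ℝ) < 2 ^ l := by positivity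
  calc (2 : ℝ) ^ l = 2 ^ l * 1 := by ring
    _ ≤ 2 ^ l * ((2 * W.locConst + 1) * ((2 * W.locConst * W.sizeConst) ^ 2 * (2 ^ l)⁻¹) *
      W.kernelOne l x x) := mul_le_mul_of_nonneg_left h5 h2l.le
    _ = _ := by field_simp

end CDVBasis

/-! ### Bounded measurable functions -/

/-- Bounded measurable real functions, the class in which all integrability questions below are
settled. -/
def BddMeasurable {Ω : Type*} [MeasurableSpace Ω] (f : Ω → ℝ) : Prop :=
  Measurable f ∧ ∃ C, ∀ x, |f x| ≤ C

namespace BddMeasurable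

variable {Ω Ω' : Type*} [MeasurableSpace Ω] [MeasurableSpace Ω'] {f g : Ω → ℝ}

lemma measurable (hf : BddMeasurable f) : Measurable f := hf.1

lemma integrable (hf : BddMeasurable f) (P : Measure Ω) [IsFiniteMeasure P] : Integrable f P :=
  integrable_of_abs_le hf.1 hf.2.choose_spec

lemma const (c : ℝ) : BddMeasurable fun _ : Ω => c := ⟨measurable_const, |c|, fun _ => le_rfl⟩

lemma mul (hf : BddMeasurable f) (hg : BddMeasurable g) : BddMeasurable fun x => f x * g x := by
  obtain ⟨hf, C, hC⟩ := hf
  obtain ⟨hg, D, hD⟩ := hg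
  refine ⟨hf.mul hg, C * D, fun x => ?_⟩
  rw [abs_mul]
  exact mul_le_mul (hC x) (hD x) (abs_nonneg _) ((abs_nonneg _).trans (hC x))

lemma add (hf : BddMeasurable f) (hg : BddMeasurable g) : BddMeasurable fun x => f x + g x := by
  obtain ⟨hf, C, hC⟩ := hf
  obtain ⟨hg, D, hD⟩ := hg
  exact ⟨hf.add hg, C + D, fun x => (abs_add_le _ _).trans (add_le_add (hC x) (hD x))⟩

lemma neg (hf : BddMeasurable f) : BddMeasurable fun x => -f x := by
  obtain ⟨hf, C, hC⟩ := hf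
  exact ⟨hf.neg, C, fun x => by rw [abs_neg]; exact hC x⟩

lemma sub (hf : BddMeasurable f) (hg : BddMeasurable g) : BddMeasurable fun x => f x - g x := by
  simpa only [sub_eq_add_neg] using hf.add hg.neg

lemma const_mul (c : ℝ) (hf : BddMeasurable f) : BddMeasurable fun x => c * f x :=
  (const c).mul hf

lemma pow (hf : BddMeasurable f) (n : ℕ) : BddMeasurable fun x => f x ^ n := by
  obtain ⟨hf, C, hC⟩ := hf
  exact ⟨hf.pow_const n, C ^ n, fun x => by
    rw [abs_pow]; exact pow_le_pow_left₀ (abs_nonneg _) (hC x) n⟩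

lemma sum {ι : Type*} {s : Finset ι} {F : ι → Ω → ℝ} (h : ∀ i ∈ s, BddMeasurable (F i)) :
    BddMeasurable fun x => ∑ i ∈ s, F i x := by
  refine ⟨Finset.measurable_fun_sum s fun i hi => (h i hi).1, ?_⟩
  have : ∀ i, ∃ C, i ∈ s → ∀ x, |F i x| ≤ C := fun i => by
    by_cases hi : i ∈ s
    · exact (h i hi).2.imp fun C hC _ => hC
    · exact ⟨0, fun h => absurd h hi⟩
  choose C hC using this
  exact ⟨∑ i ∈ s, C i, fun x => (Finset.abs_sum_le_sum_abs _ _).trans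
    (Finset.sum_le_sum fun i hi => hC i hi x)⟩

lemma prod {ι : Type*} {s : Finset ι} {F : ι → Ω → ℝ} (h : ∀ i, BddMeasurable (F i)) :
    BddMeasurable fun x => ∏ i ∈ s, F i x := by
  refine ⟨Finset.measurable_fun_prod s fun i _ => (h i).1, ?_⟩
  choose C hC using fun i => (h i).2
  exact ⟨∏ i ∈ s, C i, fun x => by
    rw [Finset.abs_prod]
    exact Finset.prod_le_prod (fun _ _ => abs_nonneg _) fun i _ => hC i x⟩

lemma comp (hf : BddMeasurable f) {u : Ω' → Ω} (hu : Measurable u) :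
    BddMeasurable fun x => f (u x) :=
  ⟨hf.1.comp hu, hf.2.imp fun _ h x => h (u x)⟩

lemma integral_right {F : Ω → Ω' → ℝ} (hF : BddMeasurable fun z : Ω × Ω' => F z.1 z.2)
    (P : Measure Ω') [IsProbabilityMeasure P] : BddMeasurable fun x => ∫ y, F x y ∂P := by
  obtain ⟨h, C, hC⟩ := hF
  refine ⟨(h.stronglyMeasurable.integral_prod_right' (ν := P)).measurable, C, fun x => ?_⟩
  have := norm_integral_le_of_norm_le_const (μ := P) (f := fun y => F x y) (C := C)
    (Eventually.of_forall fun y => hC (x, y))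
  simpa using this

lemma section_left {F : Ω → Ω' → ℝ} (hF : BddMeasurable fun z : Ω × Ω' => F z.1 z.2) (x : Ω) :
    BddMeasurable fun y => F x y := hF.comp measurable_prodMk_left

lemma section_right {F : Ω → Ω' → ℝ} (hF : BddMeasurable fun z : Ω × Ω' => F z.1 z.2) (y : Ω') :
    BddMeasurable fun x => F x y := hF.comp (u := fun x => (x, y)) (by fun_prop)

lemma integral_swap {F : Ω → Ω' → ℝ} (hF : BddMeasurable fun z : Ω × Ω' => F z.1 z.2)
    (P : Measure Ω) (P' : Measure Ω') [IsProbabilityMeasure P] [IsProbabilityMeasure P'] :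
    ∫ x, ∫ y, F x y ∂P' ∂P = ∫ y, ∫ x, F x y ∂P ∂P' :=
  integral_integral_swap (hF.integrable _)

lemma abs_integral_le {C : ℝ} (hC : ∀ x, |f x| ≤ C) (P : Measure Ω) [IsProbabilityMeasure P] :
    |∫ x, f x ∂P| ≤ C := by
  simpa using norm_integral_le_of_norm_le_const (μ := P) (f := f) (C := C) (Eventually.of_forall hC)

end BddMeasurable

/-! ### The uniform law on the cube -/

lemma measurableSet_cube (d : ℕ) : MeasurableSet (cube d) := measurableSet_Icc

lemma restrict_cube_eq_pi (d : ℕ) : (volume.restrict (cube d) : Measure (Fin d → ℝ)) =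
    Measure.pi fun _ : Fin d => (volume.restrict (Set.Icc (0 : ℝ) 1)) := by
  rw [cube, ← Set.pi_univ_Icc, volume_pi, Measure.restrict_pi_pi]
  rfl

instance isProbabilityMeasure_cube (d : ℕ) :
    IsProbabilityMeasure (volume.restrict (cube d) : Measure (Fin d → ℝ)) := by
  rw [restrict_cube_eq_pi]; infer_instance

lemma ae_cube_of_ae {d : ℕ} {p : ℝ → Prop}
    (h : ∀ᵐ t ∂(volume.restrict (Set.Icc (0 : ℝ) 1)), p t) :
    ∀ᵐ x ∂(volume.restrict (cube d)), ∀ i, p (x i) := by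
  rw [restrict_cube_eq_pi]
  exact ae_all_iff.2 fun i => (Measure.quasiMeasurePreserving_eval _ i).ae h

lemma integral_cube_prod {d : ℕ} (f : Fin d → ℝ → ℝ) :
    ∫ x in cube d, ∏ i, f i (x i) = ∏ i, ∫ t in Set.Icc (0 : ℝ) 1, f i t := by
  rw [restrict_cube_eq_pi, integral_fintype_prod_eq_prod]

lemma prod_sum_eq_sum_prod {d : ℕ} {κ : Type*} [Fintype κ] (f : Fin d → κ → ℝ) :
    ∏ i, ∑ k, f i k = ∑ m : Fin d → κ, ∏ i, f i (m i) := by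
  classical
  rw [Finset.prod_univ_sum, Fintype.piFinset_univ]

/-! ### Tensor product kernels -/

namespace CDVBasis

variable {S : ℕ} (W : CDVBasis S)

lemma bddMeasurable_phi (l : ℕ) (m : Fin (2 ^ l)) : BddMeasurable (W.phi.fn W.N l m) :=
  ⟨W.measurable_phi l m, _, (W.isLocalized_phi l).bound m⟩

lemma bddMeasurable_psi (l : ℕ) (m : Fin (2 ^ l)) : BddMeasurable (W.psi.fn W.N l m) :=
  ⟨W.measurable_psi l m, _, (W.isLocalized_psi l).bound m⟩

/-- The matrix that expresses the `2^l + 2^l` scaling functions and wavelets of level `l` in the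
scaling functions of level `l + 1` is square with orthonormal rows, hence orthogonal, so that the
kernel of `V_{l+1}` is the sum of the kernels of `V_l` and of the wavelets of level `l`. -/
lemma exists_kernelOne_succ {l : ℕ} (hl : W.J0 ≤ l) :
    ∃ s : Set ℝ, (∀ᵐ x ∂(volume.restrict (Set.Icc (0 : ℝ) 1)), x ∈ s) ∧ ∀ x ∈ s, ∀ y ∈ s,
      W.kernelOne (l + 1) x y = W.kernelOne l x y + W.waveKernelOne l x y := by
  let F : Fin (2 ^ l) ⊕ Fin (2 ^ l) → ℝ → ℝ :=
    Sum.elim (fun m => W.phi.fn W.N l m) (fun m => W.psi.fn W.N l m)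
  have hFb : ∀ r, BddMeasurable (F r) := by
    rintro (m | m)
    · exact W.bddMeasurable_phi l m
    · exact W.bddMeasurable_psi l m
  have hFo : ∀ r r', ∫ x in Set.Icc (0 : ℝ) 1, F r x * F r' x = if r = r' then 1 else 0 := by
    rintro (m | m) (m' | m')
    · simpa [F] using W.orth_phi l hl m m'
    · simpa [F] using W.orth_phi_psi l hl m m'
    · simpa [F, mul_comm] using W.orth_phi_psi l hl m' m
    · simpa [F] using W.orth_psi l hl m m'
  have hFr : ∀ r, ∃ c : Fin (2 ^ (l + 1)) → ℝ, ∀ᵐ x ∂(volume.restrict (Set.Icc (0 : ℝ) 1)),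
      F r x = ∑ m', c m' * W.phi.fn W.N (l + 1) m' x := by
    rintro (m | m)
    · exact W.refine_phi l hl m
    · exact W.refine_psi l hl m
  choose c hc using hFr
  have hcoef : ∀ r m', ∫ x in Set.Icc (0 : ℝ) 1, F r x * W.phi.fn W.N (l + 1) m' x = c r m' :=
    fun r m' => W.eq_sum_integral_mul_phi (hl.trans (Nat.le_succ l)) (hc r) m'
  let U : Matrix (Fin (2 ^ l) ⊕ Fin (2 ^ l)) (Fin (2 ^ (l + 1))) ℝ := Matrix.of c
  have hUU : U * U.transpose = 1 := by
    ext r r'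
    rw [Matrix.mul_apply, Matrix.one_apply, ← hFo r r']
    have : ∫ x in Set.Icc (0 : ℝ) 1, F r x * F r' x =
        ∫ x in Set.Icc (0 : ℝ) 1, ∑ m', c r m' * (F r' x * W.phi.fn W.N (l + 1) m' x) := by
      refine integral_congr_ae ((hc r).mono fun x hx => ?_)
      simp only [hx, Finset.sum_mul]
      exact Finset.sum_congr rfl fun _ _ => by ring
    rw [this, integral_finsetSum _ fun m' _ =>
      (((hFb r').mul (W.bddMeasurable_phi _ m')).const_mul _).integrable _]
    simp only [integral_const_mul, hcoef]
    rfl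
  have hUU' : U.transpose * U = 1 := by
    have hcard : Fintype.card (Fin (2 ^ l) ⊕ Fin (2 ^ l)) = Fintype.card (Fin (2 ^ (l + 1))) := by
      simp [pow_succ, mul_two]
    exact (Matrix.mul_eq_one_comm_of_card_eq _ _ _ hcard).1 hUU
  refine ⟨{x | ∀ r, F r x = ∑ m', c r m' * W.phi.fn W.N (l + 1) m' x}, ae_all_iff.2 hc,
    fun x hx y hy => ?_⟩
  have hsum : W.kernelOne l x y + W.waveKernelOne l x y = ∑ r, F r x * F r y := by
    rw [Fintype.sum_sum_type]; rfl
  have hdelta : ∀ m m', ∑ r, c r m * c r m' = if m = m' then 1 else 0 := fun m m' => by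
    have := congrFun (congrFun hUU' m) m'
    rwa [Matrix.mul_apply, Matrix.one_apply] at this
  rw [hsum]
  calc W.kernelOne (l + 1) x y
      = ∑ m, ∑ m', (if m = m' then 1 else 0) *
          (W.phi.fn W.N (l + 1) m x * W.phi.fn W.N (l + 1) m' y) := by simp [kernelOne]
    _ = ∑ m, ∑ m', ∑ r, (c r m * W.phi.fn W.N (l + 1) m x) *
          (c r m' * W.phi.fn W.N (l + 1) m' y) := by
        refine Finset.sum_congr rfl fun m _ => Finset.sum_congr rfl fun m' _ => ?_
        rw [← hdelta, Finset.sum_mul]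
        exact Finset.sum_congr rfl fun _ _ => by ring
    _ = ∑ r, F r x * F r y := by
        have : ∀ r, F r x * F r y = ∑ m, ∑ m', (c r m * W.phi.fn W.N (l + 1) m x) *
          (c r m' * W.phi.fn W.N (l + 1) m' y) := fun r => by
            rw [hx r, hy r, Finset.sum_mul_sum]
        simp only [this]
        rw [Finset.sum_comm]
        conv_rhs => rw [Finset.sum_comm]
        rw [Finset.sum_comm]
        exact Finset.sum_congr rfl fun m _ => Finset.sum_comm

variable (d : ℕ)

lemma bddMeasurable_Phi (j : ℕ) (m : Fin d → Fin (2 ^ j)) : BddMeasurable (W.Phi d j m) :=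
  BddMeasurable.prod fun i => (W.bddMeasurable_phi j (m i)).comp (measurable_pi_apply i)

lemma bddMeasurable_Psi (l : ℕ) (ι : Fin d → Bool) (m : Fin d → Fin (2 ^ l)) :
    BddMeasurable (W.Psi d l ι m) := by
  refine BddMeasurable.prod fun i => ?_
  split_ifs
  · exact (W.bddMeasurable_psi l (m i)).comp (measurable_pi_apply i)
  · exact (W.bddMeasurable_phi l (m i)).comp (measurable_pi_apply i)

lemma bddMeasurable_kernel (j : ℕ) :
    BddMeasurable fun z : (Fin d → ℝ) × (Fin d → ℝ) => W.kernel d j z.1 z.2 :=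
  BddMeasurable.sum fun m _ => ((W.bddMeasurable_Phi d j m).comp measurable_fst).mul
    ((W.bddMeasurable_Phi d j m).comp measurable_snd)

variable {d}

lemma kernel_eq_prod (j : ℕ) (x y : Fin d → ℝ) :
    W.kernel d j x y = ∏ i, W.kernelOne j (x i) (y i) := by
  simp only [kernelOne, prod_sum_eq_sum_prod, kernel, Phi, Finset.prod_mul_distrib]

lemma kernel_comm (j : ℕ) (x y : Fin d → ℝ) : W.kernel d j x y = W.kernel d j y x :=
  Finset.sum_congr rfl fun _ _ => mul_comm _ _

lemma kernelOne_self_nonneg (j : ℕ) (x : ℝ) : 0 ≤ W.kernelOne j x x :=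
  Finset.sum_nonneg fun _ _ => mul_self_nonneg _

lemma kernel_self_nonneg (j : ℕ) (x : Fin d → ℝ) : 0 ≤ W.kernel d j x x :=
  Finset.sum_nonneg fun _ _ => mul_self_nonneg _

/-- A constant that dominates the diagonal and the `L¹` norms of the kernels, and the inverse of
the diagonal, in units of the resolution. -/
noncomputable def kernelConst (d : ℕ) : ℝ :=
  ((2 * W.locConst + 1) * W.sizeConst ^ 2) ^ d +
    ((2 * W.locConst + 1) * (2 * W.locConst) * W.sizeConst ^ 2) ^ d +
    ((2 * W.locConst + 1) * (2 * W.locConst * W.sizeConst) ^ 2) ^ d + 1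

lemma one_le_kernelConst (d : ℕ) : 1 ≤ W.kernelConst d := by
  have hR := W.one_le_locConst
  have hB := W.sizeConst_pos
  have h1 : 0 ≤ ((2 * W.locConst + 1) * W.sizeConst ^ 2) ^ d := by positivity
  have h2 : 0 ≤ ((2 * W.locConst + 1) * (2 * W.locConst) * W.sizeConst ^ 2) ^ d := by positivity
  have h3 : 0 ≤ ((2 * W.locConst + 1) * (2 * W.locConst * W.sizeConst) ^ 2) ^ d := by positivity
  unfold kernelConst
  linarith

lemma kernelConst_pos (d : ℕ) : 0 < W.kernelConst d := one_pos.trans_le (W.one_le_kernelConst d)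

lemma kernel_self_le (j : ℕ) (x : Fin d → ℝ) :
    W.kernel d j x x ≤ W.kernelConst d * resolution d j := by
  have hR := W.one_le_locConst
  have hB := W.sizeConst_pos
  have h2 : 0 ≤ ((2 * W.locConst + 1) * (2 * W.locConst) * W.sizeConst ^ 2) ^ d := by positivity
  have h3 : 0 ≤ ((2 * W.locConst + 1) * (2 * W.locConst * W.sizeConst) ^ 2) ^ d := by positivity
  rw [kernel_eq_prod]
  calc ∏ i, W.kernelOne j (x i) (x i)
      ≤ ∏ _i : Fin d, ((2 * W.locConst + 1) * W.sizeConst ^ 2 * 2 ^ j) :=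
        Finset.prod_le_prod (fun i _ => W.kernelOne_self_nonneg j _)
          fun i _ => W.kernelOne_self_le j _
    _ = ((2 * W.locConst + 1) * W.sizeConst ^ 2) ^ d * resolution d j := by
        rw [Finset.prod_const, Finset.card_univ, Fintype.card_fin, mul_pow, resolution, pow_mul]
    _ ≤ _ := by
        refine mul_le_mul_of_nonneg_right ?_ (by unfold resolution; positivity)
        unfold kernelConst; linarith

lemma integral_abs_kernel_le (j : ℕ) (x : Fin d → ℝ) :
    ∫ y in cube d, |W.kernel d j x y| ≤ W.kernelConst d := by
  have hR := W.one_le_locConst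
  have hB := W.sizeConst_pos
  have h1 : 0 ≤ ((2 * W.locConst + 1) * W.sizeConst ^ 2) ^ d := by positivity
  have h3 : 0 ≤ ((2 * W.locConst + 1) * (2 * W.locConst * W.sizeConst) ^ 2) ^ d := by positivity
  simp only [kernel_eq_prod, Finset.abs_prod]
  rw [integral_cube_prod (fun i t => |W.kernelOne j (x i) t|)]
  refine (Finset.prod_le_prod (fun i _ => integral_nonneg fun _ => abs_nonneg _)
    fun i _ => W.integral_abs_kernelOne_le j (x i)).trans ?_
  rw [Finset.prod_const, Finset.card_univ, Fintype.card_fin]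
  unfold kernelConst; linarith

lemma integral_kernel (hS : 1 ≤ S) {j : ℕ} (hj : W.J0 ≤ j) :
    ∀ᵐ x ∂(volume.restrict (cube d)), ∫ y in cube d, W.kernel d j x y = 1 := by
  filter_upwards [ae_cube_of_ae (W.integral_kernelOne hS hj)] with x hx
  simp only [kernel_eq_prod]
  rw [integral_cube_prod (fun i t => W.kernelOne j (x i) t)]
  simp [hx]

lemma resolution_le_kernel_self (hS : 1 ≤ S) {j : ℕ} (hj : W.J0 ≤ j) :
    ∀ᵐ x ∂(volume.restrict (cube d)), resolution d j ≤ W.kernelConst d * W.kernel d j x x := by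
  have hR := W.one_le_locConst
  have hB := W.sizeConst_pos
  have h1 : 0 ≤ ((2 * W.locConst + 1) * W.sizeConst ^ 2) ^ d := by positivity
  have h2 : 0 ≤ ((2 * W.locConst + 1) * (2 * W.locConst) * W.sizeConst ^ 2) ^ d := by positivity
  filter_upwards [ae_cube_of_ae (W.le_kernelOne_self hS hj)] with x hx
  have := Finset.prod_le_prod (s := Finset.univ) (f := fun _ : Fin d => (2 : ℝ) ^ j)
    (fun i _ => by positivity) (fun i _ => hx i)
  rw [Finset.prod_const, Finset.card_univ, Fintype.card_fin, Finset.prod_mul_distrib,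
    Finset.prod_const, Finset.card_univ, Fintype.card_fin, ← kernel_eq_prod, ← pow_mul] at this
  refine this.trans (mul_le_mul_of_nonneg_right ?_ (W.kernel_self_nonneg j x))
  unfold kernelConst; linarith

lemma abs_sub_le_of_kernel_ne_zero {j : ℕ} {x y : Fin d → ℝ} (h : W.kernel d j x y ≠ 0)
    (i : Fin d) : |x i - y i| ≤ 2 * W.locConst / 2 ^ j := by
  rw [kernel_eq_prod] at h
  exact W.abs_sub_le_of_kernelOne_ne_zero (Finset.prod_ne_zero_iff.1 h i (Finset.mem_univ i))

lemma orth_Phi {j : ℕ} (hj : W.J0 ≤ j) (m m' : Fin d → Fin (2 ^ j)) :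
    ∫ x in cube d, W.Phi d j m x * W.Phi d j m' x = if m = m' then 1 else 0 := by
  simp only [Phi, ← Finset.prod_mul_distrib]
  rw [integral_cube_prod (fun i t => W.phi.fn W.N j (m i) t * W.phi.fn W.N j (m' i) t)]
  simp only [W.orth_phi j hj, Finset.prod_ite_zero]
  simp [funext_iff]

/-- Coefficient of `h` with respect to `Φ_{j,m}`. -/
noncomputable def coef (d j : ℕ) (h : (Fin d → ℝ) → ℝ) (m : Fin d → Fin (2 ^ j)) : ℝ :=
  ∫ x in cube d, h x * W.Phi d j m x

/-- The projection of `h` onto `V_k`, `k = 2^{jd}`. -/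
noncomputable def proj (d j : ℕ) (h : (Fin d → ℝ) → ℝ) (x : Fin d → ℝ) : ℝ :=
  ∫ y in cube d, W.kernel d j x y * h y

/-- The inner product of the projections of `f` and `g` onto `V_k`, `k = 2^{jd}`. -/
noncomputable def projForm (d j : ℕ) (f g : (Fin d → ℝ) → ℝ) : ℝ :=
  ∑ m, W.coef d j f m * W.coef d j g m

lemma proj_eq_sum (j : ℕ) {h : (Fin d → ℝ) → ℝ} (hh : BddMeasurable h) (x : Fin d → ℝ) :
    W.proj d j h x = ∑ m, W.coef d j h m * W.Phi d j m x := by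
  simp only [proj, kernel, Finset.sum_mul]
  rw [integral_finsetSum _ fun m _ =>
    (((W.bddMeasurable_Phi d j m).const_mul _).mul hh).integrable _]
  refine Finset.sum_congr rfl fun m _ => ?_
  rw [coef, ← integral_mul_const]
  exact integral_congr_ae (Eventually.of_forall fun y => by ring)

lemma bddMeasurable_proj (j : ℕ) {h : (Fin d → ℝ) → ℝ} (hh : BddMeasurable h) :
    BddMeasurable (W.proj d j h) :=
  BddMeasurable.integral_right ((W.bddMeasurable_kernel d j).mul (hh.comp measurable_snd)) _

lemma abs_proj_le (j : ℕ) {h : (Fin d → ℝ) → ℝ} {C : ℝ} (hC0 : 0 ≤ C)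
    (hC : ∀ᵐ x ∂(volume.restrict (cube d)), |h x| ≤ C) (x : Fin d → ℝ) :
    |W.proj d j h x| ≤ W.kernelConst d * C := by
  have hk : BddMeasurable fun y => W.kernel d j x y := (W.bddMeasurable_kernel d j).section_left x
  calc |W.proj d j h x| ≤ ∫ y in cube d, |W.kernel d j x y * h y| := abs_integral_le_integral_abs
    _ ≤ ∫ y in cube d, |W.kernel d j x y| * C := by
        refine integral_mono_of_nonneg (Eventually.of_forall fun _ => abs_nonneg _)
          ((hk.integrable _).abs.mul_const C) (hC.mono fun y hy => ?_)
        simp only [abs_mul]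
        exact mul_le_mul_of_nonneg_left hy (abs_nonneg _)
    _ ≤ _ := by
        rw [integral_mul_const]
        exact mul_le_mul_of_nonneg_right (W.integral_abs_kernel_le j x) hC0

lemma integral_mul_proj (j : ℕ) {f g : (Fin d → ℝ) → ℝ} (hf : BddMeasurable f)
    (hg : BddMeasurable g) : ∫ x in cube d, f x * W.proj d j g x = W.projForm d j f g := by
  simp only [W.proj_eq_sum j hg, Finset.mul_sum]
  rw [integral_finsetSum _ fun m _ =>
    (hf.mul ((W.bddMeasurable_Phi d j m).const_mul _)).integrable _]
  refine Finset.sum_congr rfl fun m _ => ?_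
  rw [mul_comm, coef, coef, ← integral_const_mul]
  exact integral_congr_ae (Eventually.of_forall fun y => by ring)

lemma projForm_comm (j : ℕ) (f g : (Fin d → ℝ) → ℝ) :
    W.projForm d j f g = W.projForm d j g f :=
  Finset.sum_congr rfl fun _ _ => mul_comm _ _

lemma integral_mul_proj_comm (j : ℕ) {f g : (Fin d → ℝ) → ℝ} (hf : BddMeasurable f)
    (hg : BddMeasurable g) :
    ∫ x in cube d, f x * W.proj d j g x = ∫ x in cube d, W.proj d j f x * g x := by
  rw [W.integral_mul_proj j hf hg, projForm_comm, ← W.integral_mul_proj j hg hf]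
  simp only [mul_comm]

lemma Phi_eq_sum_of_le {i j : ℕ} (hi : W.J0 ≤ i) (hij : i ≤ j) (m : Fin d → Fin (2 ^ i)) :
    ∀ᵐ x ∂(volume.restrict (cube d)), W.proj d j (W.Phi d i m) x = W.Phi d i m x := by
  filter_upwards [ae_cube_of_ae (ae_all_iff.2 fun m : Fin (2 ^ i) =>
    W.phi_eq_sum_of_le hi hij m)] with x hx
  rw [W.proj_eq_sum j (W.bddMeasurable_Phi d i m)]
  have : W.Phi d i m x = ∏ a, W.phi.fn W.N i (m a) (x a) := rfl
  rw [this, Finset.prod_congr rfl fun a _ => hx a (m a), prod_sum_eq_sum_prod]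
  refine Finset.sum_congr rfl fun m' _ => ?_
  rw [Finset.prod_mul_distrib]
  congr 1
  simp only [coef, Phi, ← Finset.prod_mul_distrib]
  rw [integral_cube_prod (fun a t => W.phi.fn W.N i (m a) t * W.phi.fn W.N j (m' a) t)]

lemma coef_proj_of_le {i j : ℕ} (hi : W.J0 ≤ i) (hij : i ≤ j) {h : (Fin d → ℝ) → ℝ}
    (hh : BddMeasurable h) (m : Fin d → Fin (2 ^ i)) :
    W.coef d i (W.proj d j h) m = W.coef d i h m := by
  rw [coef, ← W.integral_mul_proj_comm j hh (W.bddMeasurable_Phi d i m), coef]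
  exact integral_congr_ae ((W.Phi_eq_sum_of_le hi hij m).mono fun x hx => by simp only [hx])

/-- Since the spaces are nested, `⟨Π_i f, Π_j g⟩` is the form of the coarser level. -/
lemma integral_proj_mul_proj {i j : ℕ} (hi : W.J0 ≤ i) (hj : W.J0 ≤ j) {f g : (Fin d → ℝ) → ℝ}
    (hf : BddMeasurable f) (hg : BddMeasurable g) :
    ∫ x in cube d, W.proj d i f x * W.proj d j g x = W.projForm d (min i j) f g := by
  rcases le_total i j with h | h
  · rw [min_eq_left h, ← W.integral_mul_proj_comm i hf (W.bddMeasurable_proj j hg),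
      W.integral_mul_proj i hf (W.bddMeasurable_proj j hg)]
    simp only [projForm, W.coef_proj_of_le hi h hg]
  · rw [min_eq_right h, W.integral_mul_proj j (W.bddMeasurable_proj i hf) hg]
    simp only [projForm, W.coef_proj_of_le hj h hf]

/-- The composed kernel `∫ K_i(x,z) K_j(z,y) dz`, as a function of `x` and `y`. -/
noncomputable def kernelComp (d i j : ℕ) (x y : Fin d → ℝ) : ℝ :=
  W.proj d i (fun z => W.kernel d j y z) x

lemma bddMeasurable_kernelComp (i j : ℕ) :
    BddMeasurable fun z : (Fin d → ℝ) × (Fin d → ℝ) => W.kernelComp d i j z.1 z.2 := by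
  unfold kernelComp proj
  have h : BddMeasurable fun w : ((Fin d → ℝ) × (Fin d → ℝ)) × (Fin d → ℝ) =>
      W.kernel d i w.1.1 w.2 * W.kernel d j w.1.2 w.2 :=
    ((W.bddMeasurable_kernel d i).comp
      (u := fun w : ((Fin d → ℝ) × (Fin d → ℝ)) × (Fin d → ℝ) => (w.1.1, w.2)) (by fun_prop)).mul
    ((W.bddMeasurable_kernel d j).comp
      (u := fun w : ((Fin d → ℝ) × (Fin d → ℝ)) × (Fin d → ℝ) => (w.1.2, w.2)) (by fun_prop))
  exact h.integral_right (F := fun (z : (Fin d → ℝ) × (Fin d → ℝ)) (w : Fin d → ℝ) =>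
    W.kernel d i z.1 w * W.kernel d j z.2 w) _

lemma kernelComp_comm (i j : ℕ) (x y : Fin d → ℝ) :
    W.kernelComp d i j x y = W.kernelComp d j i y x := by
  simp only [kernelComp, proj]
  exact integral_congr_ae (Eventually.of_forall fun z => by
    simp only [mul_comm])

lemma proj_kernel_of_le {i j : ℕ} (hi : W.J0 ≤ i) (hij : i ≤ j) (y : Fin d → ℝ) :
    ∀ᵐ x ∂(volume.restrict (cube d)), W.proj d j (fun z => W.kernel d i y z) x =
      W.kernel d i y x := by
  filter_upwards [ae_all_iff.2 fun m => W.Phi_eq_sum_of_le hi hij m] with x hx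
  have h1 : W.proj d j (fun z => W.kernel d i y z) x =
      ∑ m, W.Phi d i m y * W.proj d j (W.Phi d i m) x := by
    simp only [proj, kernel.eq_1 W d i, Finset.mul_sum]
    rw [integral_finsetSum _ fun m _ => (((W.bddMeasurable_kernel d j).section_left x).mul
      ((W.bddMeasurable_Phi d i m).const_mul _)).integrable _]
    refine Finset.sum_congr rfl fun m _ => ?_
    rw [← integral_const_mul]
    exact integral_congr_ae (Eventually.of_forall fun z => by ring)
  rw [h1]
  simp only [hx]
  rfl

lemma integral_kernel_sq {j : ℕ} (hj : W.J0 ≤ j) (x : Fin d → ℝ) :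
    ∫ y in cube d, W.kernel d j x y ^ 2 = W.kernel d j x x := by
  simp only [kernel, sq, Finset.sum_mul_sum]
  rw [integral_finsetSum _ fun m _ => BddMeasurable.integrable (BddMeasurable.sum fun m' _ =>
    (((W.bddMeasurable_Phi d j m).const_mul _).mul ((W.bddMeasurable_Phi d j m').const_mul _))) _]
  refine Finset.sum_congr rfl fun m _ => ?_
  rw [integral_finsetSum _ fun m' _ => BddMeasurable.integrable
    (((W.bddMeasurable_Phi d j m).const_mul _).mul ((W.bddMeasurable_Phi d j m').const_mul _)) _]
  have : ∀ m', ∫ y in cube d, W.Phi d j m x * W.Phi d j m y * (W.Phi d j m' x * W.Phi d j m' y) =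
      W.Phi d j m x * W.Phi d j m' x * (if m = m' then 1 else 0) := fun m' => by
    rw [← W.orth_Phi hj m m', ← integral_const_mul]
    exact integral_congr_ae (Eventually.of_forall fun z => by ring)
  simp only [this]
  simp

lemma integral_kernel_self {j : ℕ} (hj : W.J0 ≤ j) :
    ∫ x in cube d, W.kernel d j x x = resolution d j := by
  simp only [kernel]
  rw [integral_finsetSum _ fun m _ => BddMeasurable.integrable
    ((W.bddMeasurable_Phi d j m).mul (W.bddMeasurable_Phi d j m)) _]
  simp only [W.orth_Phi hj]
  simp [resolution, pow_mul]

/-- `∫∫ κ² = min(k₁, k₂)` for the composed kernel `κ`. -/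
lemma integral_kernelComp_sq {i j : ℕ} (hi : W.J0 ≤ i) (hj : W.J0 ≤ j) :
    ∫ x in cube d, ∫ y in cube d, W.kernelComp d i j x y ^ 2 =
      min (resolution d i) (resolution d j) := by
  have key : ∀ i j, W.J0 ≤ i → W.J0 ≤ j → i ≤ j →
      ∫ x in cube d, ∫ y in cube d, W.kernelComp d i j x y ^ 2 = resolution d i := by
    intro i j hi hj hij
    rw [← W.integral_kernel_self hi]
    refine integral_congr_ae (Eventually.of_forall fun x => ?_)
    simp only [W.kernelComp_comm i j]
    rw [← W.integral_kernel_sq hi x]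
    exact integral_congr_ae ((W.proj_kernel_of_le hi hij x).mono fun y hy => by
      simp only [kernelComp, hy])
  have hmono : ∀ i j, i ≤ j → resolution d i ≤ resolution d j := fun i j h =>
    pow_le_pow_right₀ one_le_two (Nat.mul_le_mul_right d h)
  rcases le_total i j with h | h
  · rw [key i j hi hj h, min_eq_left (hmono i j h)]
  · rw [BddMeasurable.integral_swap (F := fun x y => W.kernelComp d i j x y ^ 2)
      ((W.bddMeasurable_kernelComp i j).pow 2)]
    simp only [W.kernelComp_comm i j]
    rw [key j i hj hi h, min_eq_right (hmono j i h)]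

end CDVBasis

/-! ### The approximation bias -/

namespace CDVBasis

variable {S : ℕ} (W : CDVBasis S) {d : ℕ}

/-- Coefficient of `h` with respect to `Ψ^ι_{l,m}`. -/
noncomputable def waveCoef (d l : ℕ) (h : (Fin d → ℝ) → ℝ) (ι : Fin d → Bool)
    (m : Fin d → Fin (2 ^ l)) : ℝ :=
  ∫ x in cube d, h x * W.Psi d l ι m x

/-- Expanding the product over the coordinates of `K_{l+1} = K_l + Q_l`. -/
lemma exists_kernel_succ (d : ℕ) {l : ℕ} (hl : W.J0 ≤ l) :
    ∃ s : Set (Fin d → ℝ), (∀ᵐ x ∂(volume.restrict (cube d)), x ∈ s) ∧ ∀ x ∈ s, ∀ y ∈ s,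
      W.kernel d (l + 1) x y = W.kernel d l x y +
        ∑ ι ∈ Finset.univ.erase (fun _ : Fin d => false), ∑ m, W.Psi d l ι m x * W.Psi d l ι m y := by
  obtain ⟨s, hs, hk⟩ := W.exists_kernelOne_succ hl
  refine ⟨{x | ∀ i, x i ∈ s}, ae_cube_of_ae hs, fun x hx y hy => ?_⟩
  have h0 : W.kernel d l x y =
      ∑ m, W.Psi d l (fun _ => false) m x * W.Psi d l (fun _ => false) m y := by
    simp [kernel, Psi, Phi]
  rw [h0, Finset.add_sum_erase _ (fun ι => ∑ m, W.Psi d l ι m x * W.Psi d l ι m y)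
    (Finset.mem_univ _), kernel_eq_prod]
  have h1 : ∀ i, W.kernelOne (l + 1) (x i) (y i) =
      ∑ b : Bool, ∑ m, (if b then W.psi.fn W.N l m (x i) else W.phi.fn W.N l m (x i)) *
        (if b then W.psi.fn W.N l m (y i) else W.phi.fn W.N l m (y i)) := fun i => by
    rw [hk _ (hx i) _ (hy i), Fintype.sum_bool, add_comm]
    simp [kernelOne, waveKernelOne]
  simp only [h1]
  rw [prod_sum_eq_sum_prod]
  refine Finset.sum_congr rfl fun ι _ => ?_
  rw [prod_sum_eq_sum_prod]
  exact Finset.sum_congr rfl fun m _ => by simp only [Psi, Finset.prod_mul_distrib]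

lemma projForm_succ {l : ℕ} (hl : W.J0 ≤ l) {f g : (Fin d → ℝ) → ℝ} (hf : BddMeasurable f)
    (hg : BddMeasurable g) :
    W.projForm d (l + 1) f g = W.projForm d l f g +
      ∑ ι ∈ Finset.univ.erase (fun _ : Fin d => false),
        ∑ m, W.waveCoef d l f ι m * W.waveCoef d l g ι m := by
  obtain ⟨s, hs, hk⟩ := W.exists_kernel_succ d hl
  have hP : ∀ ι m, BddMeasurable (W.Psi d l ι m) := W.bddMeasurable_Psi d l
  rw [← W.integral_mul_proj (l + 1) hf hg, ← W.integral_mul_proj l hf hg]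
  have h1 : ∀ᵐ x ∂(volume.restrict (cube d)), f x * W.proj d (l + 1) g x =
      f x * W.proj d l g x + ∑ ι ∈ Finset.univ.erase (fun _ : Fin d => false),
        ∑ m, (f x * W.Psi d l ι m x) * W.waveCoef d l g ι m := by
    filter_upwards [hs] with x hx
    have h2 : W.proj d (l + 1) g x = ∫ y in cube d, W.kernel d l x y * g y +
        ∑ ι ∈ Finset.univ.erase (fun _ : Fin d => false),
          ∑ m, W.Psi d l ι m x * (g y * W.Psi d l ι m y) := by
      refine integral_congr_ae (hs.mono fun y hy => ?_)
      simp only [hk x hx y hy, add_mul, Finset.sum_mul]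
      congr 1
      exact Finset.sum_congr rfl fun _ _ => Finset.sum_congr rfl fun _ _ => by ring
    have hb : ∀ ι m, BddMeasurable fun y => W.Psi d l ι m x * (g y * W.Psi d l ι m y) :=
      fun ι m => (hg.mul (hP ι m)).const_mul _
    rw [h2, integral_add ((((W.bddMeasurable_kernel d l).section_left x).mul hg).integrable _)
      ((BddMeasurable.sum fun ι _ => BddMeasurable.sum fun m _ => hb ι m).integrable _),
      integral_finsetSum _ fun ι _ => (BddMeasurable.sum fun m _ => hb ι m).integrable _, mul_add]
    congr 1
    rw [Finset.mul_sum]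
    refine Finset.sum_congr rfl fun ι _ => ?_
    rw [integral_finsetSum _ fun m _ => (hb ι m).integrable _, Finset.mul_sum]
    refine Finset.sum_congr rfl fun m _ => ?_
    rw [integral_const_mul, waveCoef]
    ring
  have hb : ∀ ι m, BddMeasurable fun x => (f x * W.Psi d l ι m x) * W.waveCoef d l g ι m :=
    fun ι m => (hf.mul (hP ι m)).mul (BddMeasurable.const _)
  rw [integral_congr_ae h1, integral_add ((hf.mul (W.bddMeasurable_proj l hg)).integrable _)
      ((BddMeasurable.sum fun ι _ => BddMeasurable.sum fun m _ => hb ι m).integrable _),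
      integral_finsetSum _ fun ι _ => (BddMeasurable.sum fun m _ => hb ι m).integrable _]
  congr 1
  refine Finset.sum_congr rfl fun ι _ => ?_
  rw [integral_finsetSum _ fun m _ => (hb ι m).integrable _]
  refine Finset.sum_congr rfl fun m _ => ?_
  rw [integral_mul_const, ← waveCoef]

/-- By the localization of the kernel and uniform continuity, `⟨f, Π_j g⟩ → ⟨f, g⟩`. -/
lemma tendsto_projForm (hS : 1 ≤ S) {f g : (Fin d → ℝ) → ℝ} (hf : BddMeasurable f)
    (hg : BddMeasurable g) (hgc : ContinuousOn g (cube d)) :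
    Tendsto (fun j => W.projForm d j f g) atTop (𝓝 (∫ x in cube d, f x * g x)) := by
  obtain ⟨-, A, hA⟩ := id hf
  have hK := W.kernelConst_pos d
  have hA1 : 0 < |A| + 1 := by positivity
  have huc : UniformContinuousOn g (cube d) := isCompact_Icc.uniformContinuousOn_of_continuous hgc
  rw [Metric.uniformContinuousOn_iff] at huc
  rw [Metric.tendsto_atTop]
  intro ε hε
  obtain ⟨δ, hδ, hδg⟩ := huc (ε / (2 * (W.kernelConst d * (|A| + 1)))) (by positivity)
  obtain ⟨n, hn⟩ : ∃ n : ℕ, 2 * W.locConst / δ < 2 ^ n := pow_unbounded_of_one_lt _ one_lt_two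
  refine ⟨max n W.J0, fun j hj => ?_⟩
  have hjn : 2 * W.locConst / 2 ^ j < δ := by
    have : (2 : ℝ) ^ n ≤ 2 ^ j := pow_le_pow_right₀ one_le_two ((le_max_left _ _).trans hj)
    rw [div_lt_iff₀ (by positivity)]
    rw [div_lt_iff₀ hδ] at hn
    nlinarith
  rw [Real.dist_eq, ← W.integral_mul_proj j hf hg, ← integral_sub
    ((hf.mul (W.bddMeasurable_proj j hg)).integrable _) ((hf.mul hg).integrable _)]
  have hpt : ∀ᵐ x ∂(volume.restrict (cube d)), ‖f x * W.proj d j g x - f x * g x‖ ≤ ε / 2 := by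
    filter_upwards [W.integral_kernel (d := d) hS ((le_max_right _ _).trans hj),
      ae_restrict_mem (measurableSet_cube d)] with x hx hxc
    have hk : BddMeasurable fun y => W.kernel d j x y := (W.bddMeasurable_kernel d j).section_left x
    have h1 : W.proj d j g x - g x = ∫ y in cube d, W.kernel d j x y * (g y - g x) := by
      have : g x = ∫ y in cube d, W.kernel d j x y * g x := by rw [integral_mul_const, hx, one_mul]
      conv_lhs => rw [this]
      rw [proj, ← integral_sub ((hk.mul hg).integrable _)
        ((hk.mul (BddMeasurable.const _)).integrable _)]
      simp only [mul_sub]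
    have h2 : |W.proj d j g x - g x| ≤
        W.kernelConst d * (ε / (2 * (W.kernelConst d * (|A| + 1)))) := by
      rw [h1]
      refine (abs_integral_le_integral_abs).trans ?_
      refine (integral_mono_of_nonneg (g := fun y => |W.kernel d j x y| *
        (ε / (2 * (W.kernelConst d * (|A| + 1))))) (Eventually.of_forall fun _ => abs_nonneg _)
        ((hk.integrable _).abs.mul_const _) ?_).trans ?_
      · filter_upwards [ae_restrict_mem (measurableSet_cube d)] with y hy
        rw [abs_mul]
        by_cases hne : W.kernel d j x y = 0
        · simp [hne]
        refine mul_le_mul_of_nonneg_left ?_ (abs_nonneg _)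
        have hd : dist y x < δ := by
          refine (dist_pi_lt_iff hδ).2 fun i => ?_
          rw [dist_comm, Real.dist_eq]
          exact (W.abs_sub_le_of_kernel_ne_zero hne i).trans_lt hjn
        have := hδg y hy x hxc hd
        rw [Real.dist_eq] at this
        exact this.le
      · rw [integral_mul_const]
        exact mul_le_mul_of_nonneg_right (W.integral_abs_kernel_le j x) (by positivity)
    rw [← mul_sub, Real.norm_eq_abs, abs_mul]
    have hfx : |f x| ≤ |A| + 1 := (hA x).trans ((le_abs_self A).trans (by linarith))
    calc |f x| * |W.proj d j g x - g x|
        ≤ (|A| + 1) * (W.kernelConst d * (ε / (2 * (W.kernelConst d * (|A| + 1))))) :=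
          mul_le_mul hfx h2 (abs_nonneg _) hA1.le
      _ = ε / 2 := by field_simp
  have := norm_integral_le_of_norm_le_const hpt
  simp only [probReal_univ, mul_one, Real.norm_eq_abs] at this
  linarith

/-- The constant in the upper bound of the bias. -/
noncomputable def biasConst (d : ℕ) (s M : ℝ) : ℝ := 2 ^ d * M ^ 2 / (1 - (2 : ℝ) ^ (-s))

/-- `|⟨(I - Π_j) f, (I - Π_j) g⟩| ≲ 2^{-j(α+β)}` for functions with decaying wavelet
coefficients. -/
lemma abs_integral_sub_projForm_le (hS : 1 ≤ S) {f g : (Fin d → ℝ) → ℝ} (hf : BddMeasurable f)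
    (hg : BddMeasurable g) (hgc : ContinuousOn g (cube d)) {α β M : ℝ} (hM : 0 ≤ M)
    (hs : 0 < α + β)
    (hfw : ∀ l, W.J0 ≤ l → ∀ ι : Fin d → Bool, (∃ i, ι i = true) → ∀ m,
      |W.waveCoef d l f ι m| ≤ M * (2 : ℝ) ^ (-((l : ℝ) * (α + (d : ℝ) / 2))))
    (hgw : ∀ l, W.J0 ≤ l → ∀ ι : Fin d → Bool, (∃ i, ι i = true) → ∀ m,
      |W.waveCoef d l g ι m| ≤ M * (2 : ℝ) ^ (-((l : ℝ) * (β + (d : ℝ) / 2))))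
    {j : ℕ} (hj : W.J0 ≤ j) :
    |(∫ x in cube d, f x * g x) - W.projForm d j f g| ≤
      biasConst d (α + β) M * (2 : ℝ) ^ (-((j : ℝ) * (α + β))) := by
  set q : ℝ := (2 : ℝ) ^ (-(α + β)) with hq
  have hq0 : 0 < q := Real.rpow_pos_of_pos two_pos _
  have hq1 : q < 1 := Real.rpow_lt_one_of_one_lt_of_neg one_lt_two (by linarith)
  have hqp : ∀ l : ℕ, (2 : ℝ) ^ (-((l : ℝ) * (α + β))) = q ^ l := fun l => by
    rw [hq, ← Real.rpow_natCast, ← Real.rpow_mul two_pos.le]; ring_nf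
  have hstep : ∀ l, W.J0 ≤ l →
      |W.projForm d (l + 1) f g - W.projForm d l f g| ≤ 2 ^ d * M ^ 2 * q ^ l := by
    intro l hl
    rw [W.projForm_succ hl hf hg, add_sub_cancel_left]
    have hterm : ∀ ι ∈ Finset.univ.erase (fun _ : Fin d => false), ∀ m : Fin d → Fin (2 ^ l),
        |W.waveCoef d l f ι m * W.waveCoef d l g ι m| ≤
          M ^ 2 * (q ^ l * (((2 : ℝ) ^ l) ^ d)⁻¹) := by
      intro ι hι m
      have hι' : ∃ i, ι i = true := by
        by_contra hcon
        push Not at hcon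
        exact (Finset.mem_erase.1 hι).1 (funext fun i => by simpa using hcon i)
      rw [abs_mul]
      refine (mul_le_mul (hfw l hl ι hι' m) (hgw l hl ι hι' m) (abs_nonneg _)
        (by positivity)).trans_eq ?_
      have : (2 : ℝ) ^ (-((l : ℝ) * (α + (d : ℝ) / 2))) * (2 : ℝ) ^ (-((l : ℝ) * (β + (d : ℝ) / 2)))
          = q ^ l * (((2 : ℝ) ^ l) ^ d)⁻¹ := by
        rw [← hqp, ← pow_mul, ← Real.rpow_natCast, ← Real.rpow_neg two_pos.le,
          ← Real.rpow_add two_pos, ← Real.rpow_add two_pos]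
        congr 1
        push_cast
        ring
      rw [← this]; ring
    calc |∑ ι ∈ Finset.univ.erase (fun _ : Fin d => false),
          ∑ m, W.waveCoef d l f ι m * W.waveCoef d l g ι m|
        ≤ ∑ ι ∈ Finset.univ.erase (fun _ : Fin d => false), ∑ _m : Fin d → Fin (2 ^ l),
            M ^ 2 * (q ^ l * (((2 : ℝ) ^ l) ^ d)⁻¹) :=
          (Finset.abs_sum_le_sum_abs _ _).trans (Finset.sum_le_sum fun ι hι =>
            (Finset.abs_sum_le_sum_abs _ _).trans (Finset.sum_le_sum fun m _ => hterm ι hι m))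
      _ ≤ ∑ ι : Fin d → Bool, ∑ _m : Fin d → Fin (2 ^ l),
            M ^ 2 * (q ^ l * (((2 : ℝ) ^ l) ^ d)⁻¹) :=
          Finset.sum_le_sum_of_subset_of_nonneg (Finset.erase_subset _ _) fun _ _ _ =>
            Finset.sum_nonneg fun _ _ => by positivity
      _ = 2 ^ d * M ^ 2 * q ^ l := by
          simp only [Finset.sum_const, Finset.card_univ, Fintype.card_fun, Fintype.card_fin,
            Fintype.card_bool, nsmul_eq_mul]
          push_cast
          field_simp
  have hgeo : ∀ n : ℕ, |W.projForm d (j + n) f g - W.projForm d j f g| ≤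
      biasConst d (α + β) M * (q ^ j * (1 - q ^ n)) := by
    have h1q : 0 < 1 - q := by linarith
    have hbc : biasConst d (α + β) M * (1 - q) = 2 ^ d * M ^ 2 := by
      unfold biasConst; rw [← hq]; field_simp
    intro n
    induction n with
    | zero => simp
    | succ n ih =>
      have h1 := hstep (j + n) (hj.trans (Nat.le_add_right _ _))
      rw [← hbc] at h1
      have h2 := abs_sub_le (W.projForm d (j + n + 1) f g) (W.projForm d (j + n) f g)
        (W.projForm d j f g)
      rw [← add_assoc]
      calc _ ≤ _ := h2
        _ ≤ biasConst d (α + β) M * (1 - q) * q ^ (j + n) +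
            biasConst d (α + β) M * (q ^ j * (1 - q ^ n)) := add_le_add h1 ih
        _ = _ := by rw [pow_add, pow_succ]; ring
  have hbc0 : 0 ≤ biasConst d (α + β) M := by
    unfold biasConst
    exact div_nonneg (by positivity) (by rw [← hq]; linarith)
  rw [hqp]
  have hlim : Tendsto (fun n => |W.projForm d (j + n) f g - W.projForm d j f g|) atTop
      (𝓝 |(∫ x in cube d, f x * g x) - W.projForm d j f g|) := by
    have := (tendsto_add_atTop_iff_nat j).2 (W.tendsto_projForm hS hf hg hgc)
    simp only [add_comm _ j] at this
    exact (this.sub_const _).abs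
  refine le_of_tendsto hlim (Eventually.of_forall fun n => (hgeo n).trans ?_)
  refine mul_le_mul_of_nonneg_left ?_ hbc0
  have : 0 < q ^ n := by positivity
  have : 0 < q ^ j := by positivity
  nlinarith

end CDVBasis

/-! ### Functions that are far from `V_j` -/

/-- Bessel's inequality for a finite orthonormal family of bounded functions. -/
lemma sum_sq_integral_mul_le {Ω : Type*} [MeasurableSpace Ω] (P : Measure Ω)
    [IsProbabilityMeasure P] {ι : Type*} (s : Finset ι) [DecidableEq ι] {e : ι → Ω → ℝ} {f : Ω → ℝ}
    (he : ∀ i, BddMeasurable (e i)) (hf : BddMeasurable f)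
    (ho : ∀ i ∈ s, ∀ i' ∈ s, ∫ x, e i x * e i' x ∂P = if i = i' then 1 else 0) :
    ∑ i ∈ s, (∫ x, e i x * f x ∂P) ^ 2 ≤ ∫ x, f x * f x ∂P := by
  set c : ι → ℝ := fun i => ∫ x, e i x * f x ∂P with hc
  have hsum : BddMeasurable fun x => ∑ i ∈ s, c i * e i x :=
    BddMeasurable.sum fun i _ => (he i).const_mul _
  have h0 : 0 ≤ ∫ x, (f x - ∑ i ∈ s, c i * e i x) ^ 2 ∂P := integral_nonneg fun _ => sq_nonneg _
  have h1 : ∫ x, (∑ i ∈ s, c i * e i x) * f x ∂P = ∑ i ∈ s, c i ^ 2 := by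
    simp only [Finset.sum_mul]
    rw [integral_finsetSum _ fun i _ => (((he i).const_mul _).mul hf).integrable _]
    refine Finset.sum_congr rfl fun i _ => ?_
    simp only [mul_assoc]
    rw [integral_const_mul, sq]
  have h2 : ∫ x, (∑ i ∈ s, c i * e i x) * (∑ i ∈ s, c i * e i x) ∂P = ∑ i ∈ s, c i ^ 2 := by
    simp only [Finset.sum_mul_sum]
    rw [integral_finsetSum _ fun i _ => (BddMeasurable.sum fun i' _ =>
      ((he i).const_mul _).mul ((he i').const_mul _)).integrable _]
    refine Finset.sum_congr rfl fun i hi => ?_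
    rw [integral_finsetSum _ fun i' _ => (((he i).const_mul _).mul
      ((he i').const_mul _)).integrable _]
    have : ∀ i' ∈ s, ∫ x, c i * e i x * (c i' * e i' x) ∂P =
        c i * c i' * (if i = i' then 1 else 0) := fun i' hi' => by
      rw [← ho i hi i' hi', ← integral_const_mul]
      exact integral_congr_ae (Eventually.of_forall fun x => by ring)
    rw [Finset.sum_congr rfl this]
    simp [hi, sq]
  have h3 : ∫ x, (f x - ∑ i ∈ s, c i * e i x) ^ 2 ∂P = ∫ x, f x * f x -
      2 * ((∑ i ∈ s, c i * e i x) * f x) +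
      (∑ i ∈ s, c i * e i x) * (∑ i ∈ s, c i * e i x) ∂P :=
    integral_congr_ae (Eventually.of_forall fun x => by ring)
  rw [h3, integral_add (((hf.mul hf).sub ((hsum.mul hf).const_mul 2)).integrable _)
    ((hsum.mul hsum).integrable _), integral_sub ((hf.mul hf).integrable _)
    (((hsum.mul hf).const_mul 2).integrable _), integral_const_mul, h1, h2] at h0
  linarith

/-- The orthonormal cosine functions `√2 cos(π q t)` on `[0,1]`, `q ≥ 1`. -/
noncomputable def cosFn (q : ℕ) (t : ℝ) : ℝ := √2 * Real.cos (Real.pi * q * t)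

lemma continuous_cosFn (q : ℕ) : Continuous (cosFn q) := by
  unfold cosFn; fun_prop

lemma abs_cosFn_le (q : ℕ) (t : ℝ) : |cosFn q t| ≤ 2 := by
  have h1 : √2 ≤ 2 := by
    rw [Real.sqrt_le_left (by norm_num)]; norm_num
  rw [cosFn, abs_mul, abs_of_nonneg (Real.sqrt_nonneg 2)]
  calc √2 * |Real.cos (Real.pi * q * t)| ≤ 2 * 1 :=
        mul_le_mul h1 (Real.abs_cos_le_one _) (abs_nonneg _) (by norm_num)
    _ = 2 := mul_one 2

lemma bddMeasurable_cosFn (q : ℕ) : BddMeasurable (cosFn q) :=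
  ⟨(continuous_cosFn q).measurable, 2, abs_cosFn_le q⟩

lemma integral_cos_pi_mul_int (k : ℤ) (hk : k ≠ 0) :
    ∫ t in (0 : ℝ)..1, Real.cos (Real.pi * k * t) = 0 := by
  have hne : Real.pi * (k : ℝ) ≠ 0 := mul_ne_zero Real.pi_ne_zero (by exact_mod_cast hk)
  rw [intervalIntegral.integral_comp_mul_left (fun t => Real.cos t) hne, integral_cos]
  simp [mul_comm Real.pi, Real.sin_int_mul_pi]

lemma integral_cosFn_mul_cosFn {q q' : ℕ} (hq : 1 ≤ q) :
    ∫ t in Set.Icc (0 : ℝ) 1, cosFn q t * cosFn q' t = if q = q' then 1 else 0 := by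
  rw [integral_Icc_eq_integral_Ioc, ← intervalIntegral.integral_of_le zero_le_one]
  have h1 : ∀ t, cosFn q t * cosFn q' t =
      Real.cos (Real.pi * ((q - q' : ℤ) : ℝ) * t) + Real.cos (Real.pi * ((q + q' : ℤ) : ℝ) * t) := by
    intro t
    have e1 : Real.pi * ((q - q' : ℤ) : ℝ) * t = Real.pi * q * t - Real.pi * q' * t := by
      push_cast; ring
    have e2 : Real.pi * ((q + q' : ℤ) : ℝ) * t = Real.pi * q * t + Real.pi * q' * t := by
      push_cast; ring
    rw [e1, e2, Real.cos_sub, Real.cos_add]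
    have := Real.mul_self_sqrt (show (0 : ℝ) ≤ 2 by norm_num)
    unfold cosFn
    linear_combination (Real.cos (Real.pi * q * t) * Real.cos (Real.pi * q' * t)) * this
  simp only [h1]
  rw [intervalIntegral.integral_add (Continuous.intervalIntegrable (by fun_prop) _ _)
    (Continuous.intervalIntegrable (by fun_prop) _ _),
    integral_cos_pi_mul_int (q + q') (by omega), add_zero]
  split_ifs with h
  · subst h; simp
  · exact integral_cos_pi_mul_int _ (by omega)

/-- Local approximation of the cosine functions by polynomials, from the exponential series. -/
lemma exists_polynomial_cosFn (q n : ℕ) (hn : 1 ≤ n) (t₀ : ℝ) :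
    ∃ p : Polynomial ℝ, p.natDegree < n ∧ ∀ t, |cosFn q t - p.eval t| ≤
      2 * ((Real.pi * q * |t - t₀|) ^ n * Real.exp (Real.pi * q * |t - t₀|)) := by
  set z : ℂ := Complex.exp (((Real.pi * q * t₀ : ℝ) : ℂ) * Complex.I) with hz
  set a : ℕ → ℝ := fun r => (z * (((Real.pi * q : ℝ) : ℂ) * Complex.I) ^ r / (r.factorial : ℂ)).re
  refine ⟨∑ r ∈ Finset.range n, Polynomial.C (√2 * a r) * (Polynomial.X - Polynomial.C t₀) ^ r,
    ?_, fun t => ?_⟩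
  · refine lt_of_le_of_lt (Polynomial.natDegree_sum_le_of_forall_le (n := n - 1) _ _
      fun r hr => ?_) (by omega)
    refine (Polynomial.natDegree_C_mul_le _ _).trans ?_
    refine (Polynomial.natDegree_pow_le).trans ?_
    rw [Polynomial.natDegree_X_sub_C]
    have := Finset.mem_range.1 hr
    omega
  · set v : ℝ := Real.pi * q * (t - t₀) with hv
    have hcos : Real.cos (Real.pi * q * t) = (z * Complex.exp ((v : ℂ) * Complex.I)).re := by
      rw [hz, ← Complex.exp_add, ← add_mul, ← Complex.ofReal_add, Complex.exp_ofReal_mul_I_re]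
      congr 1; rw [hv]; ring
    have hsum : ∑ r ∈ Finset.range n, a r * (t - t₀) ^ r =
        (z * ∑ r ∈ Finset.range n, ((v : ℂ) * Complex.I) ^ r / (r.factorial : ℂ)).re := by
      rw [Finset.mul_sum, Complex.re_sum]
      refine Finset.sum_congr rfl fun r _ => ?_
      have : z * (((v : ℂ) * Complex.I) ^ r / (r.factorial : ℂ)) =
          z * (((Real.pi * q : ℝ) : ℂ) * Complex.I) ^ r / (r.factorial : ℂ) *
            (((t - t₀) ^ r : ℝ) : ℂ) := by
        have e : (v : ℂ) * Complex.I =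
            ((Real.pi * q : ℝ) : ℂ) * Complex.I * ((t - t₀ : ℝ) : ℂ) := by
          rw [hv]; push_cast; ring
        rw [e, mul_pow, Complex.ofReal_pow]; ring
      rw [this, Complex.re_mul_ofReal]
    have heval : (∑ r ∈ Finset.range n, Polynomial.C (√2 * a r) *
        (Polynomial.X - Polynomial.C t₀) ^ r).eval t =
        √2 * ∑ r ∈ Finset.range n, a r * (t - t₀) ^ r := by
      rw [Polynomial.eval_finsetSum, Finset.mul_sum]
      exact Finset.sum_congr rfl fun r _ => by simp [mul_assoc]
    rw [heval, cosFn, ← mul_sub, abs_mul, abs_of_nonneg (Real.sqrt_nonneg 2), hcos, hsum,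
      ← Complex.sub_re, ← mul_sub]
    have hz1 : ‖z‖ = 1 := Complex.norm_exp_ofReal_mul_I _
    have hb := Complex.norm_exp_sub_sum_le_norm_mul_exp ((v : ℂ) * Complex.I) n
    have hv1 : ‖(v : ℂ) * Complex.I‖ = Real.pi * q * |t - t₀| := by
      rw [norm_mul, Complex.norm_I, mul_one, Complex.norm_real, Real.norm_eq_abs, hv, abs_mul,
        abs_of_nonneg (show 0 ≤ Real.pi * q by positivity)]
    rw [hv1] at hb
    have h2 : √2 ≤ 2 := by rw [Real.sqrt_le_left (by norm_num)]; norm_num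
    refine mul_le_mul h2 ?_ (abs_nonneg _) (by norm_num)
    refine (Complex.abs_re_le_norm _).trans ?_
    rw [norm_mul, hz1, one_mul]
    exact hb

namespace CDVBasis

variable {S : ℕ} (W : CDVBasis S)

/-- Since `V_l` has dimension `2^l`, one of the first `2^{l+1}` cosine functions has at most half
of its energy in `V_l`. -/
lemma exists_cosFn_far (l : ℕ) (hl : W.J0 ≤ l) : ∃ q : ℕ, 1 ≤ q ∧ q ≤ 2 ^ (l + 1) ∧
    ∑ m, (∫ t in Set.Icc (0 : ℝ) 1, cosFn q t * W.phi.fn W.N l m t) ^ 2 ≤ 1 / 2 := by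
  have h1 : ∀ m, ∑ q ∈ Finset.Icc 1 (2 ^ (l + 1)),
      (∫ t in Set.Icc (0 : ℝ) 1, cosFn q t * W.phi.fn W.N l m t) ^ 2 ≤ 1 := fun m => by
    refine (sum_sq_integral_mul_le _ _ bddMeasurable_cosFn (W.bddMeasurable_phi l m)
      fun q hq q' _ => integral_cosFn_mul_cosFn (Finset.mem_Icc.1 hq).1).trans_eq ?_
    simpa using W.orth_phi l hl m m
  have h2 : ∑ q ∈ Finset.Icc 1 (2 ^ (l + 1)),
      ∑ m, (∫ t in Set.Icc (0 : ℝ) 1, cosFn q t * W.phi.fn W.N l m t) ^ 2 ≤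
      ∑ _q ∈ Finset.Icc 1 (2 ^ (l + 1)), (1 / 2 : ℝ) := by
    rw [Finset.sum_comm]
    refine (Finset.sum_le_sum fun m _ => h1 m).trans_eq ?_
    simp [pow_succ]
  obtain ⟨q, hq, hle⟩ := Finset.exists_le_of_sum_le ⟨1, by simp [Nat.one_le_two_pow]⟩ h2
  exact ⟨q, (Finset.mem_Icc.1 hq).1, (Finset.mem_Icc.1 hq).2, hle⟩

/-- The constant in the coefficient bounds of the cosine functions. -/
noncomputable def cosConst : ℝ :=
  4 * W.locConst * W.sizeConst *
    ((2 * Real.pi * W.locConst) ^ S * Real.exp (2 * Real.pi * W.locConst) + 1)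

lemma cosConst_pos : 0 < W.cosConst := by
  have hR := W.one_le_locConst
  have hB := W.sizeConst_pos
  unfold cosConst; positivity

lemma abs_integral_cosFn_phi_le (q l : ℕ) (m : Fin (2 ^ l)) :
    |∫ t in Set.Icc (0 : ℝ) 1, cosFn q t * W.phi.fn W.N l m t| ≤
      W.cosConst * (2 : ℝ) ^ (-((l : ℝ) / 2)) := by
  have hR := W.one_le_locConst
  have hB := W.sizeConst_pos
  have h := (W.isLocalized_phi l).integral_abs_mul_le hB hR m (u := cosFn q) (A := 2) (by norm_num)
    fun x _ => abs_cosFn_le q x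
  simp only [mul_comm (cosFn q _)]
  refine abs_integral_le_integral_abs.trans (h.trans ?_)
  refine mul_le_mul_of_nonneg_right ?_ (Real.rpow_pos_of_pos two_pos _).le
  have : 0 ≤ 4 * W.locConst * W.sizeConst *
    ((2 * Real.pi * W.locConst) ^ S * Real.exp (2 * Real.pi * W.locConst)) := by positivity
  unfold cosConst
  linarith

/-- Wavelet coefficients of cosine functions of frequency `q ≤ 2^{j+1}`: the trivial bound, and
the gain `2^{(j-l)S}` from the vanishing moments beyond level `j`. -/
lemma abs_integral_cosFn_psi_le (hS : 1 ≤ S) {q j l : ℕ} (hl : W.J0 ≤ l) (hq : q ≤ 2 ^ (j + 1))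
    (m : Fin (2 ^ l)) :
    |∫ t in Set.Icc (0 : ℝ) 1, cosFn q t * W.psi.fn W.N l m t| ≤
      W.cosConst * (2 : ℝ) ^ (-((l : ℝ) / 2)) * min 1 ((2 ^ j / 2 ^ l) ^ S) := by
  have hR := W.one_le_locConst
  have hB := W.sizeConst_pos
  have hπ := Real.pi_pos
  have hs : 0 < (2 : ℝ) ^ (-((l : ℝ) / 2)) := Real.rpow_pos_of_pos two_pos _
  have hE : 0 ≤ (2 * Real.pi * W.locConst) ^ S * Real.exp (2 * Real.pi * W.locConst) := by
    positivity
  have htriv : |∫ t in Set.Icc (0 : ℝ) 1, cosFn q t * W.psi.fn W.N l m t| ≤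
      W.cosConst * (2 : ℝ) ^ (-((l : ℝ) / 2)) := by
    have h := (W.isLocalized_psi l).integral_abs_mul_le hB hR m (u := cosFn q) (A := 2)
      (by norm_num) fun x _ => abs_cosFn_le q x
    simp only [mul_comm (cosFn q _)]
    refine abs_integral_le_integral_abs.trans (h.trans (mul_le_mul_of_nonneg_right ?_ hs.le))
    have : 0 ≤ 4 * W.locConst * W.sizeConst *
      ((2 * Real.pi * W.locConst) ^ S * Real.exp (2 * Real.pi * W.locConst)) := by positivity
    unfold cosConst
    linarith
  have hx0 : (0 : ℝ) < 2 ^ j / 2 ^ l := by positivity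
  rcases le_total (1 : ℝ) (2 ^ j / 2 ^ l) with hjl | hjl
  · rw [min_eq_left (one_le_pow₀ hjl), mul_one]; exact htriv
  · rw [min_eq_right (pow_le_one₀ hx0.le hjl)]
    obtain ⟨p, hpdeg, hp⟩ := exists_polynomial_cosFn q S hS ((m : ℕ) / 2 ^ l)
    have hpint : Integrable (fun t => W.psi.fn W.N l m t * p.eval t)
        (volume.restrict (Set.Icc (0 : ℝ) 1)) :=
      (p.continuous.continuousOn.integrableOn_Icc (μ := volume)).integrable.bdd_mul
        (W.measurable_psi l m).aestronglyMeasurable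
        (Eventually.of_forall ((W.isLocalized_psi l).bound m))
    have hpsi : Integrable (fun t => W.psi.fn W.N l m t * cosFn q t)
        (volume.restrict (Set.Icc (0 : ℝ) 1)) :=
      ((W.bddMeasurable_psi l m).mul (bddMeasurable_cosFn q)).integrable _
    have heq : ∫ t in Set.Icc (0 : ℝ) 1, cosFn q t * W.psi.fn W.N l m t =
        ∫ t in Set.Icc (0 : ℝ) 1, W.psi.fn W.N l m t * (cosFn q t - p.eval t) := by
      simp only [mul_sub, mul_comm (cosFn q _)]
      rw [integral_sub hpsi hpint, W.integral_psi_mul_polynomial hl m p hpdeg, sub_zero]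
    have h := (W.isLocalized_psi l).integral_abs_mul_le hB hR m
      (u := fun t => cosFn q t - p.eval t)
      (A := 2 * ((2 * Real.pi * W.locConst) ^ S * Real.exp (2 * Real.pi * W.locConst)) *
        (2 ^ j / 2 ^ l) ^ S) (by positivity) fun x hx => by
        refine (hp x).trans ?_
        have h2l : (0 : ℝ) < 2 ^ l := by positivity
        have hdist : |x - (m : ℕ) / 2 ^ l| ≤ W.locConst / 2 ^ l := by
          rw [le_div_iff₀ h2l, ← abs_of_pos h2l, ← abs_mul, abs_of_pos h2l, sub_mul,
            div_mul_cancel₀ _ h2l.ne', mul_comm]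
          exact hx
        have hq' : (q : ℝ) ≤ 2 * 2 ^ j := by
          have : (q : ℝ) ≤ 2 ^ (j + 1) := by exact_mod_cast hq
          rwa [pow_succ, mul_comm] at this
        have hv : Real.pi * q * |x - (m : ℕ) / 2 ^ l| ≤
            2 * Real.pi * W.locConst * (2 ^ j / 2 ^ l) := by
          calc Real.pi * q * |x - (m : ℕ) / 2 ^ l|
              ≤ Real.pi * (2 * 2 ^ j) * (W.locConst / 2 ^ l) := by gcongr
            _ = _ := by ring
        have hv2 : Real.pi * q * |x - (m : ℕ) / 2 ^ l| ≤ 2 * Real.pi * W.locConst :=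
          hv.trans (mul_le_of_le_one_right (by positivity) hjl)
        calc 2 * ((Real.pi * q * |x - (m : ℕ) / 2 ^ l|) ^ S *
              Real.exp (Real.pi * q * |x - (m : ℕ) / 2 ^ l|))
            ≤ 2 * ((2 * Real.pi * W.locConst * (2 ^ j / 2 ^ l)) ^ S *
              Real.exp (2 * Real.pi * W.locConst)) := by gcongr
          _ = _ := by rw [mul_pow (2 * Real.pi * W.locConst)]; ring
    rw [heq]
    refine abs_integral_le_integral_abs.trans (h.trans ?_)
    have hnn : 0 ≤ 4 * W.locConst * W.sizeConst * (2 : ℝ) ^ (-((l : ℝ) / 2)) *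
      (2 ^ j / 2 ^ l) ^ S := by positivity
    unfold cosConst
    linarith

end CDVBasis

/-! ### Lower bound on the approximation bias -/

namespace CDVBasis

variable {S : ℕ} (W : CDVBasis S) {d : ℕ}

lemma Holder_add {s M₁ M₂ : ℝ} {f g : (Fin d → ℝ) → ℝ} (hf : f ∈ W.Holder d s M₁)
    (hg : g ∈ W.Holder d s M₂) (hfb : BddMeasurable f) (hgb : BddMeasurable g) :
    (fun x => f x + g x) ∈ W.Holder d s (M₁ + M₂) := by
  refine ⟨hf.1.add hg.1, fun m₀ l hl m ι hι => ?_⟩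
  have h1 := hf.2 m₀ l hl m ι hι
  have h2 := hg.2 m₀ l hl m ι hι
  have hP := W.bddMeasurable_Phi d W.J0 m₀
  have hQ := W.bddMeasurable_Psi d l ι m
  simp only [add_mul]
  rw [integral_add ((hfb.mul hP).integrable _) ((hgb.mul hP).integrable _),
    integral_add ((hfb.mul hQ).integrable _) ((hgb.mul hQ).integrable _)]
  have h3 := mul_le_mul_of_nonneg_left (abs_add_le (∫ x in cube d, f x * W.Phi d W.J0 m₀ x)
    (∫ x in cube d, g x * W.Phi d W.J0 m₀ x))
    (Real.rpow_pos_of_pos two_pos ((W.J0 : ℝ) * (s + (d : ℝ) / 2))).le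
  have h4 := mul_le_mul_of_nonneg_left (abs_add_le (∫ x in cube d, f x * W.Psi d l ι m x)
    (∫ x in cube d, g x * W.Psi d l ι m x))
    (Real.rpow_pos_of_pos two_pos ((l : ℝ) * (s + (d : ℝ) / 2))).le
  linarith

lemma Holder_const_mul {s M : ℝ} {f : (Fin d → ℝ) → ℝ} (hf : f ∈ W.Holder d s M) (c : ℝ) :
    (fun x => c * f x) ∈ W.Holder d s (|c| * M) := by
  refine ⟨continuousOn_const.mul hf.1, fun m₀ l hl m ι hι => ?_⟩
  have h1 := mul_le_mul_of_nonneg_left (hf.2 m₀ l hl m ι hι) (abs_nonneg c)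
  simp only [mul_assoc, integral_const_mul, abs_mul] at h1 ⊢
  linarith

lemma Holder_mono {s M₁ M₂ : ℝ} (h : M₁ ≤ M₂) : W.Holder d s M₁ ⊆ W.Holder d s M₂ :=
  fun _ hf => ⟨hf.1, fun m₀ l hl m ι hι => (hf.2 m₀ l hl m ι hι).trans h⟩

lemma indicator_mem_Holder {s M : ℝ} {f : (Fin d → ℝ) → ℝ} (hf : f ∈ W.Holder d s M) :
    (cube d).indicator f ∈ W.Holder d s M := by
  refine ⟨hf.1.congr fun x hx => Set.indicator_of_mem hx f, fun m₀ l hl m ι hι => ?_⟩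
  have h : ∀ u : (Fin d → ℝ) → ℝ, ∫ x in cube d, (cube d).indicator f x * u x =
      ∫ x in cube d, f x * u x := fun u =>
    setIntegral_congr_fun (measurableSet_cube d) fun x hx => by
      simp only [Set.indicator_of_mem hx]
  rw [h, h]
  exact hf.2 m₀ l hl m ι hι

end CDVBasis

lemma bddMeasurable_indicator_cube {d : ℕ} {f : (Fin d → ℝ) → ℝ} (hf : ContinuousOn f (cube d)) :
    BddMeasurable ((cube d).indicator f) := by
  refine ⟨?_, ?_⟩
  · classical
    rw [← Set.piecewise_eq_indicator]
    exact ContinuousOn.measurable_piecewise hf continuousOn_const (measurableSet_cube d)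
  · obtain ⟨C, hC⟩ := isCompact_Icc.exists_bound_of_continuousOn hf
    refine ⟨|C|, fun x => ?_⟩
    by_cases hx : x ∈ cube d
    · rw [Set.indicator_of_mem hx]; exact (hC x hx).trans (le_abs_self C)
    · rw [Set.indicator_of_notMem hx, abs_zero]; exact abs_nonneg C

namespace CDVBasis

variable {S : ℕ} (W : CDVBasis S) {d : ℕ}

/-- The error form `⟨(I - Π_j) f, (I - Π_j) g⟩`. -/
noncomputable def errForm (d j : ℕ) (f g : (Fin d → ℝ) → ℝ) : ℝ :=
  (∫ x in cube d, f x * g x) - W.projForm d j f g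

lemma errForm_comm (j : ℕ) (f g : (Fin d → ℝ) → ℝ) : W.errForm d j f g = W.errForm d j g f := by
  simp only [errForm, W.projForm_comm j f g, mul_comm]

lemma errForm_add_const_mul (j : ℕ) {f g h : (Fin d → ℝ) → ℝ} (hf : BddMeasurable f)
    (hg : BddMeasurable g) (hh : BddMeasurable h) (c : ℝ) :
    W.errForm d j (fun x => f x + c * g x) h = W.errForm d j f h + c * W.errForm d j g h := by
  have h1 : ∀ u : (Fin d → ℝ) → ℝ, BddMeasurable u →
      ∫ x in cube d, (f x + c * g x) * u x =
        (∫ x in cube d, f x * u x) + c * ∫ x in cube d, g x * u x := fun u hu => by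
    simp only [add_mul, mul_assoc]
    rw [integral_add ((hf.mul hu).integrable _) (((hg.mul hu).const_mul c).integrable _),
      integral_const_mul]
  have h2 : W.projForm d j (fun x => f x + c * g x) h =
      W.projForm d j f h + c * W.projForm d j g h := by
    simp only [projForm, Finset.mul_sum, ← Finset.sum_add_distrib]
    refine Finset.sum_congr rfl fun m _ => ?_
    rw [coef, h1 _ (W.bddMeasurable_Phi d j m), ← coef, ← coef]
    ring
  rw [errForm, h1 h hh, h2, errForm, errForm]
  ring

/-- Products of cosine functions, rescaled, lie in the Hölder balls, and half of their energy is
outside `V_j`. -/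
lemma exists_rough (hd : 1 ≤ d) (hS : 1 ≤ S) : ∃ D : ℝ, 0 < D ∧ ∀ j, W.J0 ≤ j →
    ∃ G : (Fin d → ℝ) → ℝ, BddMeasurable G ∧ (∀ x, |G x| ≤ D) ∧
      (∀ s : ℝ, 0 < s → s ≤ S →
        (fun x => (2 : ℝ) ^ (-((j : ℝ) * s)) * G x) ∈ W.Holder d s D) ∧
      1 / 2 ≤ W.errForm d j G G := by
  have hE := W.cosConst_pos
  refine ⟨2 ^ d + 2 * W.cosConst ^ d, by positivity, fun j hj => ?_⟩
  obtain ⟨q, hq1, hq2, hfar⟩ := W.exists_cosFn_far j hj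
  set G : (Fin d → ℝ) → ℝ := fun x => ∏ a, cosFn q (x a) with hG
  have hGc : Continuous G := continuous_finsetProd _ fun a _ =>
    (continuous_cosFn q).comp (continuous_apply a)
  have hGb : ∀ x, |G x| ≤ 2 ^ d := fun x => by
    rw [hG, Finset.abs_prod]
    refine (Finset.prod_le_prod (fun _ _ => abs_nonneg _) fun a _ => abs_cosFn_le q (x a)).trans_eq ?_
    simp
  have hGm : BddMeasurable G := ⟨hGc.measurable, _, hGb⟩
  refine ⟨G, hGm, fun x => (hGb x).trans (by
    have : 0 ≤ 2 * W.cosConst ^ d := by positivity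
    linarith), fun s hs hsS => ⟨(continuous_const.mul hGc).continuousOn,
      fun m₀ l hl m ι hι => ?_⟩, ?_⟩
  · have hPhi : |∫ x in cube d, G x * W.Phi d W.J0 m₀ x| ≤
        (W.cosConst * (2 : ℝ) ^ (-((W.J0 : ℝ) / 2))) ^ d := by
      simp only [hG, Phi, ← Finset.prod_mul_distrib]
      rw [integral_cube_prod (fun a t => cosFn q t * W.phi.fn W.N W.J0 (m₀ a) t), Finset.abs_prod]
      refine (Finset.prod_le_prod (fun _ _ => abs_nonneg _)
        fun a _ => W.abs_integral_cosFn_phi_le q W.J0 (m₀ a)).trans_eq ?_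
      simp
    have hPsi : |∫ x in cube d, G x * W.Psi d l ι m x| ≤
        (W.cosConst * (2 : ℝ) ^ (-((l : ℝ) / 2))) ^ d * min 1 ((2 ^ j / 2 ^ l) ^ S) := by
      have hs0 : 0 < (2 : ℝ) ^ (-((l : ℝ) / 2)) := Real.rpow_pos_of_pos two_pos _
      have hmin : 0 ≤ min (1 : ℝ) ((2 ^ j / 2 ^ l) ^ S) := le_min zero_le_one (by positivity)
      simp only [hG, Psi, ← Finset.prod_mul_distrib]
      rw [integral_cube_prod (fun a t => cosFn q t *
        if ι a then W.psi.fn W.N l (m a) t else W.phi.fn W.N l (m a) t), Finset.abs_prod]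
      have hterm : ∀ a, |∫ t in Set.Icc (0 : ℝ) 1, cosFn q t *
          if ι a then W.psi.fn W.N l (m a) t else W.phi.fn W.N l (m a) t| ≤
          (W.cosConst * (2 : ℝ) ^ (-((l : ℝ) / 2))) *
            (if ι a then min 1 ((2 ^ j / 2 ^ l) ^ S) else 1) := fun a => by
        cases ι a
        · simpa using W.abs_integral_cosFn_phi_le q l (m a)
        · simpa using W.abs_integral_cosFn_psi_le hS hl hq2 (m a)
      refine (Finset.prod_le_prod (fun _ _ => abs_nonneg _) fun a _ => hterm a).trans ?_
      rw [Finset.prod_mul_distrib]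
      simp only [Finset.prod_const, Finset.card_univ, Fintype.card_fin]
      refine mul_le_mul_of_nonneg_left ?_ (by positivity)
      obtain ⟨i, hi⟩ := hι
      rw [← Finset.mul_prod_erase _ _ (Finset.mem_univ i), if_pos hi]
      refine mul_le_of_le_one_right hmin (Finset.prod_le_one (fun a _ => ?_) fun a _ => ?_)
      · split_ifs
        · exact hmin
        · exact zero_le_one
      · split_ifs
        · exact min_le_left _ _
        · exact le_rfl
    have hgain : (2 : ℝ) ^ (-((j : ℝ) * s)) * min 1 ((2 ^ j / 2 ^ l) ^ S) ≤
        (2 : ℝ) ^ (-((l : ℝ) * s)) := by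
      rcases le_total l j with h | h
      · refine (mul_le_of_le_one_right (Real.rpow_pos_of_pos two_pos _).le (min_le_left _ _)).trans ?_
        refine Real.rpow_le_rpow_of_exponent_le one_le_two ?_
        have : (l : ℝ) ≤ j := by exact_mod_cast h
        nlinarith
      · refine (mul_le_mul_of_nonneg_left (min_le_right _ _)
          (Real.rpow_pos_of_pos two_pos _).le).trans ?_
        have e : (((2 : ℝ) ^ j / 2 ^ l) ^ S) = (2 : ℝ) ^ (((j : ℝ) - l) * S) := by
          rw [Real.rpow_mul two_pos.le, Real.rpow_sub two_pos, Real.rpow_natCast, Real.rpow_natCast,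
            Real.rpow_natCast]
        rw [e, ← Real.rpow_add two_pos]
        refine Real.rpow_le_rpow_of_exponent_le one_le_two ?_
        have : (j : ℝ) ≤ l := by exact_mod_cast h
        nlinarith
    have hscale : ∀ l : ℕ, (2 : ℝ) ^ ((l : ℝ) * (s + (d : ℝ) / 2)) *
        ((2 : ℝ) ^ (-((l : ℝ) * s)) * ((2 : ℝ) ^ (-((l : ℝ) / 2))) ^ d) = 1 := fun l => by
      rw [← Real.rpow_natCast, ← Real.rpow_mul two_pos.le, ← Real.rpow_add two_pos,
        ← Real.rpow_add two_pos]
      convert Real.rpow_zero (2 : ℝ) using 2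
      ring
    have h2s : ∀ l : ℕ, 0 < (2 : ℝ) ^ ((l : ℝ) * (s + (d : ℝ) / 2)) := fun l =>
      Real.rpow_pos_of_pos two_pos _
    have hjs : 0 < (2 : ℝ) ^ (-((j : ℝ) * s)) := Real.rpow_pos_of_pos two_pos _
    simp only [mul_assoc, integral_const_mul, abs_mul, abs_of_pos hjs]
    have hA : (2 : ℝ) ^ ((W.J0 : ℝ) * (s + (d : ℝ) / 2)) * ((2 : ℝ) ^ (-((j : ℝ) * s)) *
        |∫ x in cube d, G x * W.Phi d W.J0 m₀ x|) ≤ W.cosConst ^ d := by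
      have hJ : (2 : ℝ) ^ (-((j : ℝ) * s)) ≤ (2 : ℝ) ^ (-((W.J0 : ℝ) * s)) := by
        refine Real.rpow_le_rpow_of_exponent_le one_le_two ?_
        have : (W.J0 : ℝ) ≤ j := by exact_mod_cast hj
        nlinarith
      calc _ ≤ (2 : ℝ) ^ ((W.J0 : ℝ) * (s + (d : ℝ) / 2)) * ((2 : ℝ) ^ (-((W.J0 : ℝ) * s)) *
            (W.cosConst * (2 : ℝ) ^ (-((W.J0 : ℝ) / 2))) ^ d) :=
            mul_le_mul_of_nonneg_left (mul_le_mul hJ hPhi (abs_nonneg _)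
              (Real.rpow_pos_of_pos two_pos _).le) (h2s _).le
        _ = W.cosConst ^ d * ((2 : ℝ) ^ ((W.J0 : ℝ) * (s + (d : ℝ) / 2)) *
            ((2 : ℝ) ^ (-((W.J0 : ℝ) * s)) * ((2 : ℝ) ^ (-((W.J0 : ℝ) / 2))) ^ d)) := by
            rw [mul_pow]; ring
        _ = _ := by rw [hscale, mul_one]
    have hB : (2 : ℝ) ^ ((l : ℝ) * (s + (d : ℝ) / 2)) * ((2 : ℝ) ^ (-((j : ℝ) * s)) *
        |∫ x in cube d, G x * W.Psi d l ι m x|) ≤ W.cosConst ^ d := by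
      calc _ ≤ (2 : ℝ) ^ ((l : ℝ) * (s + (d : ℝ) / 2)) * ((2 : ℝ) ^ (-((j : ℝ) * s)) *
            ((W.cosConst * (2 : ℝ) ^ (-((l : ℝ) / 2))) ^ d * min 1 ((2 ^ j / 2 ^ l) ^ S))) :=
            mul_le_mul_of_nonneg_left (mul_le_mul_of_nonneg_left hPsi hjs.le) (h2s _).le
        _ = (2 : ℝ) ^ ((l : ℝ) * (s + (d : ℝ) / 2)) *
              (W.cosConst * (2 : ℝ) ^ (-((l : ℝ) / 2))) ^ d *
              ((2 : ℝ) ^ (-((j : ℝ) * s)) * min 1 ((2 ^ j / 2 ^ l) ^ S)) := by ring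
        _ ≤ (2 : ℝ) ^ ((l : ℝ) * (s + (d : ℝ) / 2)) *
              (W.cosConst * (2 : ℝ) ^ (-((l : ℝ) / 2))) ^ d * (2 : ℝ) ^ (-((l : ℝ) * s)) :=
            mul_le_mul_of_nonneg_left hgain (mul_nonneg (h2s _).le (pow_nonneg
              (mul_nonneg hE.le (Real.rpow_pos_of_pos two_pos _).le) _))
        _ = W.cosConst ^ d * ((2 : ℝ) ^ ((l : ℝ) * (s + (d : ℝ) / 2)) *
            ((2 : ℝ) ^ (-((l : ℝ) * s)) * ((2 : ℝ) ^ (-((l : ℝ) / 2))) ^ d)) := by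
            rw [mul_pow]; ring
        _ = _ := by rw [hscale, mul_one]
    have : (0 : ℝ) ≤ 2 ^ d := by positivity
    linarith
  · have h1 : ∫ x in cube d, G x * G x = 1 := by
      simp only [hG, ← Finset.prod_mul_distrib]
      rw [integral_cube_prod (fun _ t => cosFn q t * cosFn q t)]
      simp [integral_cosFn_mul_cosFn hq1]
    have h2 : W.projForm d j G G =
        (∑ m, (∫ t in Set.Icc (0 : ℝ) 1, cosFn q t * W.phi.fn W.N j m t) ^ 2) ^ d := by
      have hc : ∀ m, W.coef d j G m =
          ∏ a, ∫ t in Set.Icc (0 : ℝ) 1, cosFn q t * W.phi.fn W.N j (m a) t := fun m => by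
        simp only [hG, coef, Phi, ← Finset.prod_mul_distrib]
        rw [integral_cube_prod (fun a t => cosFn q t * W.phi.fn W.N j (m a) t)]
      simp only [projForm, hc, ← sq, ← Finset.prod_pow]
      rw [← prod_sum_eq_sum_prod (fun (_ : Fin d) m =>
        (∫ t in Set.Icc (0 : ℝ) 1, cosFn q t * W.phi.fn W.N j m t) ^ 2)]
      simp
    have h0 : 0 ≤ ∑ m, (∫ t in Set.Icc (0 : ℝ) 1, cosFn q t * W.phi.fn W.N j m t) ^ 2 :=
      Finset.sum_nonneg fun _ _ => sq_nonneg _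
    have h3 : (∑ m, (∫ t in Set.Icc (0 : ℝ) 1, cosFn q t * W.phi.fn W.N j m t) ^ 2) ^ d ≤ 1 / 2 :=
      (pow_le_of_le_one h0 (hfar.trans (by norm_num)) (by omega)).trans hfar
    rw [errForm, h1, h2]
    linarith

/-- Perturbing the interior point `(p₀, b₀)` of the model by `± ε 2^{-jα} G`, `± ε 2^{-jβ} G` and
choosing the best of the four signs gives a bias of order `2^{-j(α+β)}`. -/
lemma exists_errForm_ge (hd : 1 ≤ d) (hS : 1 ≤ S) {α β M C₁ C₂ : ℝ} (hα : 0 < α) (hβ : 0 < β)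
    (hαS : α < S) (hβS : β < S)
    (hp : ∃ M' < M, ∃ p₀ ∈ W.Holder d α M', ∀ x ∈ cube d, C₁ < p₀ x ∧ p₀ x < C₂)
    (hb : ∃ M' < M, ∃ b₀ ∈ W.Holder d β M', ∀ x ∈ cube d, C₁ < b₀ x ∧ b₀ x < C₂) :
    ∃ c δ : ℝ, 0 < c ∧ 0 < δ ∧ ∀ j, W.J0 ≤ j → ∃ p ∈ W.Holder d α M, ∃ b ∈ W.Holder d β M,
      BddMeasurable p ∧ BddMeasurable b ∧
      (∀ x ∈ cube d, C₁ + δ ≤ p x ∧ p x ≤ C₂ - δ) ∧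
      (∀ x ∈ cube d, C₁ + δ ≤ b x ∧ b x ≤ C₂ - δ) ∧
      c * (2 : ℝ) ^ (-((j : ℝ) * (α + β))) ≤ |W.errForm d j p b| := by
  obtain ⟨D, hD, hrough⟩ := W.exists_rough hd hS
  -- an interior point of the model, with a margin in the values and in the Hölder norm
  have hmargin : ∀ s : ℝ,
      (∃ M' < M, ∃ p₀ ∈ W.Holder d s M', ∀ x ∈ cube d, C₁ < p₀ x ∧ p₀ x < C₂) →
      ∃ p₀ : (Fin d → ℝ) → ℝ, BddMeasurable p₀ ∧ ∃ η > 0, p₀ ∈ W.Holder d s (M - η) ∧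
        ∀ x ∈ cube d, C₁ + η ≤ p₀ x ∧ p₀ x ≤ C₂ - η := by
    rintro s ⟨M', hM', p₀, hp₀, hval⟩
    have hne : (cube d).Nonempty := ⟨0, by simp [cube]⟩
    obtain ⟨x₁, hx₁, hmin⟩ := isCompact_Icc.exists_isMinOn hne hp₀.1
    obtain ⟨x₂, hx₂, hmax⟩ := isCompact_Icc.exists_isMaxOn hne hp₀.1
    refine ⟨(cube d).indicator p₀, bddMeasurable_indicator_cube hp₀.1,
      min (M - M') (min (p₀ x₁ - C₁) (C₂ - p₀ x₂)), lt_min (by linarith)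
        (lt_min (by linarith [(hval x₁ hx₁).1]) (by linarith [(hval x₂ hx₂).2])),
      W.Holder_mono (by linarith [min_le_left (M - M') (min (p₀ x₁ - C₁) (C₂ - p₀ x₂))])
        (W.indicator_mem_Holder hp₀), fun x hx => ?_⟩
    rw [Set.indicator_of_mem hx]
    have h1 : p₀ x₁ ≤ p₀ x := hmin hx
    have h2 : p₀ x ≤ p₀ x₂ := hmax hx
    have h3 := (min_le_right (M - M') _).trans (min_le_left (p₀ x₁ - C₁) (C₂ - p₀ x₂))
    have h4 := (min_le_right (M - M') _).trans (min_le_right (p₀ x₁ - C₁) (C₂ - p₀ x₂))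
    constructor <;> linarith
  obtain ⟨p₀, hp₀b, η₁, hη₁, hp₀H, hp₀v⟩ := hmargin α hp
  obtain ⟨b₀, hb₀b, η₂, hη₂, hb₀H, hb₀v⟩ := hmargin β hb
  set η := min η₁ η₂ with hη
  have hη0 : 0 < η := lt_min hη₁ hη₂
  set ε := η / (2 * D) with hε
  have hε0 : 0 < ε := by positivity
  have hεD : ε * D = η / 2 := by rw [hε]; field_simp
  refine ⟨ε ^ 2 / 2, η / 2, by positivity, by positivity, fun j hj => ?_⟩
  obtain ⟨G, hGb, hGD, hGH, hGerr⟩ := hrough j hj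
  have hpow : ∀ s : ℝ, 0 < s → 0 < (2 : ℝ) ^ (-((j : ℝ) * s)) ∧ (2 : ℝ) ^ (-((j : ℝ) * s)) ≤ 1 :=
    fun s hs => ⟨Real.rpow_pos_of_pos two_pos _,
      Real.rpow_le_one_of_one_le_of_nonpos one_le_two (by
        have : 0 ≤ (j : ℝ) * s := by positivity
        linarith)⟩
  have hpert : ∀ (s : ℝ) (h₀ : (Fin d → ℝ) → ℝ) (η' : ℝ), 0 < s → s < S → BddMeasurable h₀ →
      η ≤ η' → h₀ ∈ W.Holder d s (M - η') →
      (∀ x ∈ cube d, C₁ + η' ≤ h₀ x ∧ h₀ x ≤ C₂ - η') → ∀ σ : ℝ, |σ| = ε →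
      (fun x => h₀ x + (σ * (2 : ℝ) ^ (-((j : ℝ) * s))) * G x) ∈ W.Holder d s M ∧
      BddMeasurable (fun x => h₀ x + (σ * (2 : ℝ) ^ (-((j : ℝ) * s))) * G x) ∧
      ∀ x ∈ cube d, C₁ + η / 2 ≤ h₀ x + (σ * (2 : ℝ) ^ (-((j : ℝ) * s))) * G x ∧
        h₀ x + (σ * (2 : ℝ) ^ (-((j : ℝ) * s))) * G x ≤ C₂ - η / 2 := by
    intro s h₀ η' hs hsS hb₀ hη' hH hv σ hσ
    refine ⟨?_, hb₀.add (hGb.const_mul _), fun x hx => ?_⟩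
    · have h1 := W.Holder_const_mul (hGH s hs hsS.le) σ
      have h2 := W.Holder_add hH h1 hb₀ ((hGb.const_mul _).const_mul _)
      simp only [mul_assoc] at h2 ⊢
      refine W.Holder_mono ?_ h2
      rw [hσ, hεD]; linarith
    · have h1 : |(σ * (2 : ℝ) ^ (-((j : ℝ) * s))) * G x| ≤ η / 2 := by
        rw [abs_mul, abs_mul, hσ, abs_of_pos (hpow s hs).1, ← hεD]
        refine mul_le_mul ?_ (hGD x) (abs_nonneg _) hε0.le
        exact mul_le_of_le_one_right hε0.le (hpow s hs).2
      have h2 := hv x hx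
      rw [abs_le] at h1
      constructor <;> linarith [h1.1, h1.2, h2.1, h2.2]
  set u := (2 : ℝ) ^ (-((j : ℝ) * α)) with hu
  set v := (2 : ℝ) ^ (-((j : ℝ) * β)) with hv
  have huv : (2 : ℝ) ^ (-((j : ℝ) * (α + β))) = u * v := by
    rw [hu, hv, ← Real.rpow_add two_pos]; ring_nf
  have hexp : ∀ σ τ : ℝ, W.errForm d j (fun x => p₀ x + (σ * u) * G x)
      (fun x => b₀ x + (τ * v) * G x) = W.errForm d j p₀ b₀ + τ * v * W.errForm d j p₀ G +
        σ * u * W.errForm d j G b₀ + σ * u * (τ * v) * W.errForm d j G G := by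
    intro σ τ
    have hbb : BddMeasurable fun x => b₀ x + (τ * v) * G x := hb₀b.add (hGb.const_mul _)
    rw [W.errForm_add_const_mul j hp₀b hGb hbb, W.errForm_comm j p₀, W.errForm_comm j G,
      W.errForm_add_const_mul j hb₀b hGb hp₀b, W.errForm_add_const_mul j hb₀b hGb hGb,
      W.errForm_comm j b₀ p₀, W.errForm_comm j G p₀, W.errForm_comm j b₀ G]
    ring
  have hu0 := (hpow α hα).1
  have hv0 := (hpow β hβ).1
  -- one of the four sign choices works, since the four error forms add up to four times the
  -- error form of the perturbations
  have hsign : ∃ σ τ : ℝ, |σ| = ε ∧ |τ| = ε ∧ ε ^ 2 / 2 * (u * v) ≤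
      |W.errForm d j (fun x => p₀ x + (σ * u) * G x) (fun x => b₀ x + (τ * v) * G x)| := by
    by_contra hcon
    push Not at hcon
    have hn : |(-ε)| = ε := by rw [abs_neg, abs_of_pos hε0]
    have hn' : |ε| = ε := abs_of_pos hε0
    have k1 := (abs_lt.1 (hcon ε ε hn' hn')).2
    have k2 := (abs_lt.1 (hcon (-ε) (-ε) hn hn)).2
    have k3 := (abs_lt.1 (hcon ε (-ε) hn' hn)).1
    have k4 := (abs_lt.1 (hcon (-ε) ε hn hn')).1
    rw [hexp] at k1 k2 k3 k4
    have hpos : 0 < ε ^ 2 * (u * v) := by positivity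
    nlinarith [mul_le_mul_of_nonneg_left hGerr hpos.le]
  obtain ⟨σ, τ, hσ, hτ, hst⟩ := hsign
  obtain ⟨a1, a2, a3⟩ := hpert α p₀ η₁ hα hαS hp₀b (min_le_left _ _) hp₀H hp₀v σ hσ
  obtain ⟨b1, b2, b3⟩ := hpert β b₀ η₂ hβ hβS hb₀b (min_le_right _ _) hb₀H hb₀v τ hτ
  exact ⟨_, a1, _, b1, a2, b2, a3, b3, by rw [huv]; exact hst⟩

end CDVBasis

/-! ### Empirical means and sample splitting -/

/-- The empirical mean of `h` over the sample `D`. -/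
noncomputable def avg {Ω : Type*} {n : ℕ} (h : Ω → ℝ) (D : Fin n → Ω) : ℝ :=
  (1 / (n : ℝ)) * ∑ i, h (D i)

section avg

variable {Ω : Type*} [MeasurableSpace Ω] {P : Measure Ω} [IsProbabilityMeasure P] {n : ℕ}
  {h : Ω → ℝ}

/-- Second moment of a shifted empirical mean: squared expectation plus variance. -/
lemma lintegral_sq_add_avg (hn : 1 ≤ n) (hh : MemLp h 2 P) (c : ℝ) :
    ∫⁻ D, ENNReal.ofReal ((c + avg h D) ^ 2) ∂(Measure.pi fun _ : Fin n => P) =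
      ENNReal.ofReal ((c + ∫ x, h x ∂P) ^ 2 +
        1 / (n : ℝ) * (∫ x, h x ^ 2 ∂P - (∫ x, h x ∂P) ^ 2)) := by
  have hn0 : (n : ℝ) ≠ 0 := by positivity
  have hi : ∀ i : Fin n, MemLp (fun D : Fin n → Ω => h (D i)) 2 (Measure.pi fun _ : Fin n => P) :=
    fun i => hh.comp_measurePreserving (measurePreserving_eval _ i)
  have hmean : ∀ i : Fin n, ∫ D, h (D i) ∂(Measure.pi fun _ : Fin n => P) = ∫ x, h x ∂P :=
    fun i => by
      have h0 := (measurePreserving_eval (fun _ : Fin n => P) i).map_eq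
      conv_rhs => rw [← h0]
      rw [integral_map (measurable_pi_apply i).aemeasurable (by rw [h0]; exact hh.1)]
  have hS : MemLp (fun D : Fin n → Ω => ∑ i, h (D i)) 2 (Measure.pi fun _ : Fin n => P) :=
    memLp_finsetSum _ fun i _ => hi i
  have hA : MemLp (fun D : Fin n → Ω => avg h D) 2 (Measure.pi fun _ : Fin n => P) :=
    hS.const_mul _
  have hE : ∫ D, avg h D ∂(Measure.pi fun _ : Fin n => P) = ∫ x, h x ∂P := by
    simp only [avg]
    rw [integral_const_mul, integral_finsetSum _ fun i _ => (hi i).integrable one_le_two]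
    simp only [hmean, Finset.sum_const, Finset.card_univ, Fintype.card_fin, nsmul_eq_mul]
    field_simp
  have hV : Var[fun D => avg h D; Measure.pi fun _ : Fin n => P] = 1 / (n : ℝ) *
      (∫ x, h x ^ 2 ∂P - (∫ x, h x ∂P) ^ 2) := by
    have h1 := variance_sum_pi (μ := fun _ : Fin n => P) (X := fun _ => h) fun _ => hh
    have h2 : (fun D : Fin n → Ω => avg h D) =
        fun D => (1 / (n : ℝ)) * (∑ i, fun D : Fin n → Ω => h (D i)) D := by
      funext D; simp [avg]
    have h3 := variance_eq_sub hh
    rw [h2, variance_const_mul, h1, h3]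
    simp only [Finset.sum_const, Finset.card_univ, Fintype.card_fin, nsmul_eq_mul, Pi.pow_apply]
    field_simp
  have hc : MemLp (fun D : Fin n → Ω => c + avg h D) 2 (Measure.pi fun _ : Fin n => P) :=
    (memLp_const c).add hA
  rw [← ofReal_integral_eq_lintegral_ofReal hc.integrable_sq
    (Eventually.of_forall fun _ => sq_nonneg _)]
  congr 1
  have h4 : ∫ D, (c + avg h D) ^ 2 ∂(Measure.pi fun _ : Fin n => P) =
      ∫ D, c ^ 2 + 2 * c * avg h D + avg h D ^ 2 ∂(Measure.pi fun _ : Fin n => P) :=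
    integral_congr_ae (Eventually.of_forall fun D => by ring)
  have h5 := variance_eq_sub hA
  have hAi := hA.integrable one_le_two
  rw [hV] at h5
  simp only [Pi.pow_apply] at h5
  have hi2 : Integrable (fun D : Fin n → Ω => c ^ 2 + 2 * c * avg h D)
    (Measure.pi fun _ : Fin n => P) := (integrable_const _).add (hAi.const_mul _)
  rw [h4, integral_add hi2 hA.integrable_sq, integral_add (integrable_const _) (hAi.const_mul _), integral_const_mul, hE]
  rw [hE] at h5
  simp only [integral_const, probReal_univ, one_smul]
  linarith

lemma sq_integral_le (hh : MemLp h 2 P) : (∫ x, h x ∂P) ^ 2 ≤ ∫ x, h x ^ 2 ∂P := by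
  have := variance_nonneg h P
  rw [variance_eq_sub hh] at this
  simpa using this

lemma lintegral_sq_add_avg_le (hn : 1 ≤ n) (hh : MemLp h 2 P) (c : ℝ) :
    ∫⁻ D, ENNReal.ofReal ((c + avg h D) ^ 2) ∂(Measure.pi fun _ : Fin n => P) ≤
      ENNReal.ofReal ((c + ∫ x, h x ∂P) ^ 2 + 1 / (n : ℝ) * ∫ x, h x ^ 2 ∂P) := by
  rw [lintegral_sq_add_avg hn hh]
  refine ENNReal.ofReal_le_ofReal (add_le_add le_rfl (mul_le_mul_of_nonneg_left ?_ (by positivity)))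
  linarith [sq_nonneg (∫ x, h x ∂P)]

lemma sq_add_integral_le_lintegral (hn : 1 ≤ n) (hh : MemLp h 2 P) (c : ℝ) :
    ENNReal.ofReal ((c + ∫ x, h x ∂P) ^ 2) ≤
      ∫⁻ D, ENNReal.ofReal ((c + avg h D) ^ 2) ∂(Measure.pi fun _ : Fin n => P) := by
  rw [lintegral_sq_add_avg hn hh]
  refine ENNReal.ofReal_le_ofReal (le_add_of_nonneg_right (mul_nonneg (by positivity) ?_))
  linarith [sq_integral_le hh]

lemma variance_le_lintegral_sq_add_avg (hn : 1 ≤ n) (hh : MemLp h 2 P) (c : ℝ) :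
    ENNReal.ofReal (1 / (n : ℝ) * (∫ x, h x ^ 2 ∂P - (∫ x, h x ∂P) ^ 2)) ≤
      ∫⁻ D, ENNReal.ofReal ((c + avg h D) ^ 2) ∂(Measure.pi fun _ : Fin n => P) := by
  rw [lintegral_sq_add_avg hn hh]
  exact ENNReal.ofReal_le_ofReal (le_add_of_nonneg_left (sq_nonneg _))

lemma integral_sq_le_lintegral_sq_avg (hn : 1 ≤ n) (hh : MemLp h 2 P) :
    ENNReal.ofReal (1 / (n : ℝ) * ∫ x, h x ^ 2 ∂P) ≤
      ∫⁻ D, ENNReal.ofReal (avg h D ^ 2) ∂(Measure.pi fun _ : Fin n => P) := by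
  have h1 := lintegral_sq_add_avg hn hh 0
  simp only [zero_add] at h1
  rw [h1]
  refine ENNReal.ofReal_le_ofReal ?_
  have hn1 : 1 / (n : ℝ) ≤ 1 := by
    rw [div_le_one (by positivity)]; exact_mod_cast hn
  nlinarith [mul_le_mul_of_nonneg_right hn1 (sq_nonneg (∫ x, h x ∂P))]

end avg

lemma measurable_avg {Ω Ω' : Type*} [MeasurableSpace Ω] [MeasurableSpace Ω'] {n : ℕ}
    {F : Ω' → Ω → ℝ} (hF : Measurable fun z : Ω' × Ω => F z.1 z.2) {u : Ω' → Fin n → Ω}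
    (hu : Measurable u) : Measurable fun z => avg (F z) (u z) := by
  unfold avg
  refine Measurable.const_mul (Finset.measurable_fun_sum _ fun i _ => ?_) _
  exact hF.comp (measurable_id.prodMk ((measurable_pi_apply i).comp hu))

/-- Resampling one coordinate of a product law leaves the law unchanged. -/
lemma map_update_pi {ι Ω : Type*} [Fintype ι] [DecidableEq ι] [MeasurableSpace Ω]
    (ν : Measure Ω) [IsProbabilityMeasure ν] (i : ι) :
    ((Measure.pi fun _ : ι => ν).prod ν).map (fun z => Function.update z.1 i z.2) =
      Measure.pi fun _ : ι => ν := by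
  have hm : Measurable fun z : (ι → Ω) × Ω => Function.update z.1 i z.2 := by
    refine measurable_pi_iff.2 fun k => ?_
    by_cases hk : k = i
    · subst hk; simpa using measurable_snd
    · simp only [Function.update_of_ne hk]; fun_prop
  symm
  refine Measure.pi_eq fun s hs => ?_
  rw [Measure.map_apply hm (MeasurableSet.univ_pi hs)]
  have : (fun z : (ι → Ω) × Ω => Function.update z.1 i z.2) ⁻¹' (Set.univ.pi s) =
      (Set.univ.pi (Function.update s i Set.univ)) ×ˢ s i := by
    ext ⟨D, E⟩
    simp only [Set.mem_preimage, Set.mem_univ_pi, Set.mem_prod]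
    constructor
    · intro h
      refine ⟨fun k => ?_, by simpa using h i⟩
      by_cases hk : k = i
      · subst hk; simp
      · simpa [Function.update_of_ne hk] using h k
    · rintro ⟨h1, h2⟩ k
      by_cases hk : k = i
      · subst hk; simpa using h2
      · simpa [Function.update_of_ne hk] using h1 k
  rw [this, Measure.prod_prod, Measure.pi_pi]
  rw [← Finset.mul_prod_erase _ _ (Finset.mem_univ i),
    ← Finset.mul_prod_erase _ (fun k => ν (s k)) (Finset.mem_univ i)]
  simp only [Function.update_self, measure_univ, one_mul]
  rw [mul_comm]
  congr 1
  refine Finset.prod_congr rfl fun k hk => ?_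
  rw [Function.update_of_ne (Finset.ne_of_mem_erase hk)]

section sampleLaw

variable {d n : ℕ} {P : Measure (Obs d)} [IsProbabilityMeasure P]

instance : IsProbabilityMeasure (sampleLaw P n) := by unfold sampleLaw; infer_instance

lemma measurable_update_sample (i : Fin 4) :
    Measurable fun z : Sample d n × (Fin n → Obs d) => Function.update z.1 i z.2 := by
  refine measurable_pi_iff.2 fun k => ?_
  by_cases hk : k = i
  · subst hk; simpa using measurable_snd
  · simp only [Function.update_of_ne hk]; fun_prop

/-- Integrating out the subsample `i` first. -/
lemma lintegral_sampleLaw_update (i : Fin 4) {F : Sample d n → ℝ≥0∞} (hF : Measurable F) :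
    ∫⁻ D, F D ∂(sampleLaw P n) =
      ∫⁻ D, ∫⁻ E, F (Function.update D i E) ∂(Measure.pi fun _ : Fin n => P) ∂(sampleLaw P n) := by
  have h := map_update_pi (Measure.pi fun _ : Fin n => P) i
  have hm := measurable_update_sample (d := d) (n := n) i
  conv_lhs => rw [sampleLaw, ← h]
  rw [lintegral_map hF hm]
  exact lintegral_prod _ (hF.comp hm).aemeasurable

lemma lintegral_sampleLaw_eval (i : Fin 4) {F : (Fin n → Obs d) → ℝ≥0∞} (hF : Measurable F) :
    ∫⁻ D, F (D i) ∂(sampleLaw P n) = ∫⁻ E, F E ∂(Measure.pi fun _ : Fin n => P) :=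
  (measurePreserving_eval (fun _ : Fin 4 => Measure.pi fun _ : Fin n => P) i).lintegral_comp hF

end sampleLaw

/-! ### Regression functions -/

/-- The consequences of membership in the model on which the moment computations rest: `X` is
uniform, `A` and `Y` are bounded by `C`, and `p`, `b` are bounded versions of the regression
functions of `A` and `Y` on `X`. -/
structure IsRegression {d : ℕ} (P : Measure (Obs d)) (p b : (Fin d → ℝ) → ℝ) (C : ℝ) : Prop where
  prob : IsProbabilityMeasure P
  map_fst : P.map (fun o : Obs d => o.1) = volume.restrict (cube d)
  abs_A : ∀ᵐ o ∂P, |o.2.1| ≤ C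
  abs_Y : ∀ᵐ o ∂P, |o.2.2| ≤ C
  bdd_p : BddMeasurable p
  bdd_b : BddMeasurable b
  abs_p : ∀ᵐ x ∂(volume.restrict (cube d)), |p x| ≤ C
  abs_b : ∀ᵐ x ∂(volume.restrict (cube d)), |b x| ≤ C
  integral_A : ∀ w, BddMeasurable w → ∫ o, o.2.1 * w o.1 ∂P = ∫ x in cube d, p x * w x
  integral_Y : ∀ w, BddMeasurable w → ∫ o, o.2.2 * w o.1 ∂P = ∫ x in cube d, b x * w x
  psi_eq : psiFunctional P = ∫ o, o.2.1 * o.2.2 ∂P - ∫ x in cube d, p x * b x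

lemma integral_comp_fst {d : ℕ} {P : Measure (Obs d)}
    (hP : P.map (fun o : Obs d => o.1) = volume.restrict (cube d)) {w : (Fin d → ℝ) → ℝ}
    (hw : Measurable w) : ∫ o, w o.1 ∂P = ∫ x in cube d, w x := by
  rw [← hP, integral_map measurable_fst.aemeasurable hw.aestronglyMeasurable]

lemma memLp_two_of_ae_bound {Ω : Type*} [MeasurableSpace Ω] {P : Measure Ω} [IsFiniteMeasure P]
    {f : Ω → ℝ} (hf : Measurable f) {C : ℝ} (hC : ∀ᵐ x ∂P, |f x| ≤ C) : MemLp f 2 P :=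
  MemLp.of_bound hf.aestronglyMeasurable C hC

lemma sigmaX_le (d : ℕ) : sigmaX d ≤ (inferInstance : MeasurableSpace (Obs d)) :=
  measurable_fst.comap_le

/-- Testing a conditional expectation given `X` against functions of `X`. -/
lemma integral_mul_comp_fst_of_condExp {d : ℕ} {P : Measure (Obs d)} [IsProbabilityMeasure P]
    (hP : P.map (fun o : Obs d => o.1) = volume.restrict (cube d)) {Z : Obs d → ℝ}
    (hZ : Measurable Z) {C : ℝ} (hC : ∀ᵐ o ∂P, |Z o| ≤ C) {p : (Fin d → ℝ) → ℝ}
    (hp : BddMeasurable p) (hcond : P[Z | sigmaX d] =ᵐ[P] fun o => p o.1)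
    {w : (Fin d → ℝ) → ℝ} (hw : BddMeasurable w) :
    ∫ o, Z o * w o.1 ∂P = ∫ x in cube d, p x * w x := by
  have hZi : Integrable Z P := Integrable.of_bound hZ.aestronglyMeasurable C hC
  have hwm : StronglyMeasurable[sigmaX d] fun o : Obs d => w o.1 :=
    (hw.measurable.comp (comap_measurable _)).stronglyMeasurable
  have hZw : Integrable (fun o => Z o * w o.1) P := by
    obtain ⟨B, hB⟩ := hw.2
    exact hZi.mul_bdd (hw.measurable.comp measurable_fst).aestronglyMeasurable
      (Eventually.of_forall fun o => hB o.1)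
  have h1 : P[fun o => Z o * w o.1 | sigmaX d] =ᵐ[P] fun o => (P[Z | sigmaX d]) o * w o.1 :=
    condExp_mul_of_stronglyMeasurable_right hwm hZw hZi
  rw [← integral_condExp (sigmaX_le d), integral_congr_ae h1]
  have h2 : ∫ o, (P[Z | sigmaX d]) o * w o.1 ∂P = ∫ o, p o.1 * w o.1 ∂P :=
    integral_congr_ae (hcond.mono fun o ho => by simp only [ho])
  rw [h2, integral_comp_fst hP (w := fun x => p x * w x) (hp.mul hw).measurable]

lemma isRegression_of_condExp {d : ℕ} {P : Measure (Obs d)} [IsProbabilityMeasure P]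
    (hP : P.map (fun o : Obs d => o.1) = volume.restrict (cube d)) {C : ℝ}
    (hA : ∀ᵐ o ∂P, |o.2.1| ≤ C) (hY : ∀ᵐ o ∂P, |o.2.2| ≤ C) {p b : (Fin d → ℝ) → ℝ}
    (hp : BddMeasurable p) (hb : BddMeasurable b) (hcp : condA P =ᵐ[P] fun o => p o.1)
    (hcb : condY P =ᵐ[P] fun o => b o.1) : IsRegression P p b C := by
  have hmA : Measurable fun o : Obs d => o.2.1 := by fun_prop
  have hmY : Measurable fun o : Obs d => o.2.2 := by fun_prop
  have hiA := fun (w : (Fin d → ℝ) → ℝ) (hw : BddMeasurable w) =>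
    integral_mul_comp_fst_of_condExp hP hmA hA hp hcp hw
  have hiY := fun (w : (Fin d → ℝ) → ℝ) (hw : BddMeasurable w) =>
    integral_mul_comp_fst_of_condExp hP hmY hY hb hcb hw
  have hbound : ∀ (Z : Obs d → ℝ) (r : (Fin d → ℝ) → ℝ), BddMeasurable r →
      (∀ᵐ o ∂P, |Z o| ≤ C) → P[Z | sigmaX d] =ᵐ[P] (fun o => r o.1) →
      ∀ᵐ x ∂(volume.restrict (cube d)), |r x| ≤ C := by
    intro Z r hr hZ hZr
    have h1 : ∀ᵐ o ∂P, |(P[Z | sigmaX d]) o| ≤ C := ae_bdd_abs_condExp_of_ae_bdd_abs hZ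
    rw [← hP, ae_map_iff measurable_fst.aemeasurable
      (measurableSet_le hr.measurable.abs measurable_const)]
    filter_upwards [h1, hZr] with o h2 h3
    rwa [h3] at h2
  refine ⟨inferInstance, hP, hA, hY, hp, hb, hbound _ p hp hA hcp, hbound _ b hb hY hcb, hiA, hiY,
    ?_⟩
  have hX : ∀ {f : Obs d → ℝ} {B : ℝ}, Measurable f → (∀ᵐ o ∂P, |f o| ≤ B) → Integrable f P :=
    fun hf hB => Integrable.of_bound hf.aestronglyMeasurable _ hB
  obtain ⟨-, Bp, hBp⟩ := id hp
  obtain ⟨-, Bb, hBb⟩ := id hb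
  have hpX : BddMeasurable fun o : Obs d => p o.1 := hp.comp measurable_fst
  have hbX : BddMeasurable fun o : Obs d => b o.1 := hb.comp measurable_fst
  have iA : Integrable (fun o : Obs d => o.2.1) P := hX hmA hA
  have iY : Integrable (fun o : Obs d => o.2.2) P := hX hmY hY
  have iAY : Integrable (fun o : Obs d => o.2.1 * o.2.2) P :=
    iA.mul_bdd hmY.aestronglyMeasurable hY
  have iAb : Integrable (fun o : Obs d => o.2.1 * b o.1) P :=
    iA.mul_bdd hbX.measurable.aestronglyMeasurable (Eventually.of_forall fun o => hBb o.1)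
  have iYp : Integrable (fun o : Obs d => o.2.2 * p o.1) P :=
    iY.mul_bdd hpX.measurable.aestronglyMeasurable (Eventually.of_forall fun o => hBp o.1)
  rw [psiFunctional, condCovAY, integral_condExp (sigmaX_le d)]
  have h1 : ∫ o : Obs d, (o.2.1 - condA P o) * (o.2.2 - condY P o) ∂P =
      ∫ o : Obs d, o.2.1 * o.2.2 - o.2.1 * b o.1 - o.2.2 * p o.1 + p o.1 * b o.1 ∂P := by
    refine integral_congr_ae ?_
    filter_upwards [hcp, hcb] with o h2 h3
    rw [h2, h3]; ring
  have i1 : Integrable (fun o : Obs d => o.2.1 * o.2.2 - o.2.1 * b o.1) P := iAY.sub iAb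
  have i2 : Integrable (fun o : Obs d => o.2.1 * o.2.2 - o.2.1 * b o.1 - o.2.2 * p o.1) P :=
    i1.sub iYp
  rw [h1, integral_add i2 ((hpX.mul hbX).integrable _), integral_sub i1 iYp, integral_sub iAY iAb, hiA b hb, hiY p hp,
    integral_comp_fst hP (w := fun x => p x * b x) (hp.mul hb).measurable]
  simp only [mul_comm (b _) (p _)]
  ring

/-- Every law of the model has regression functions with decaying wavelet coefficients. -/
lemma exists_isRegression_of_mem_Model {S : ℕ} {W : CDVBasis S} {d : ℕ} {α β M C₁ C₂ : ℝ}
    {P : Measure (Obs d)} (hP : P ∈ Model W d α β M C₁ C₂) :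
    ∃ p b, p ∈ W.Holder d α M ∧ b ∈ W.Holder d β M ∧ IsRegression P p b (max |C₁| |C₂|) := by
  obtain ⟨hprob, hX, hAY, ⟨p, hp, hcp⟩, ⟨b, hb, hcb⟩⟩ := hP
  have hcube : ∀ᵐ o ∂P, o.1 ∈ cube d := by
    have h1 : ∀ᵐ x ∂(P.map fun o : Obs d => o.1), x ∈ cube d := by
      rw [hX]; exact ae_restrict_mem (measurableSet_cube d)
    exact ae_of_ae_map measurable_fst.aemeasurable h1
  have hind : ∀ {f : Obs d → ℝ} {r : (Fin d → ℝ) → ℝ}, (f =ᵐ[P] fun o => r o.1) →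
      f =ᵐ[P] fun o => (cube d).indicator r o.1 := fun h => by
    filter_upwards [h, hcube] with o h1 h2
    rw [h1, Set.indicator_of_mem h2]
  exact ⟨_, _, W.indicator_mem_Holder hp, W.indicator_mem_Holder hb,
    isRegression_of_condExp hX (hAY.mono fun o ho => abs_le_max_abs_abs ho.1.1 ho.1.2)
      (hAY.mono fun o ho => abs_le_max_abs_abs ho.2.1 ho.2.2)
      (bddMeasurable_indicator_cube hp.1) (bddMeasurable_indicator_cube hb.1) (hind hcp) (hind hcb)⟩

/-! ### Kernel averages and integrated products of errors -/

/-- `r` is the regression function on `X` of the bounded variable `Z`. -/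
structure HasRegression {d : ℕ} (P : Measure (Obs d)) (Z : Obs d → ℝ) (r : (Fin d → ℝ) → ℝ)
    (C : ℝ) : Prop where
  measurable : Measurable Z
  map_fst : P.map (fun o : Obs d => o.1) = volume.restrict (cube d)
  abs_le : ∀ᵐ o ∂P, |Z o| ≤ C
  integral_mul : ∀ w, BddMeasurable w → ∫ o, Z o * w o.1 ∂P = ∫ x in cube d, r x * w x

namespace IsRegression

variable {d : ℕ} {P : Measure (Obs d)} {p b : (Fin d → ℝ) → ℝ} {C : ℝ}

lemma hasA (h : IsRegression P p b C) : HasRegression P (fun o => o.2.1) p C :=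
  ⟨by fun_prop, h.map_fst, h.abs_A, h.integral_A⟩

lemma hasY (h : IsRegression P p b C) : HasRegression P (fun o => o.2.2) b C :=
  ⟨by fun_prop, h.map_fst, h.abs_Y, h.integral_Y⟩

lemma bound_nonneg (h : IsRegression P p b C) : 0 ≤ C := by
  have := h.prob
  obtain ⟨o, ho⟩ := h.abs_A.exists
  exact (abs_nonneg _).trans ho

end IsRegression

namespace HasRegression

variable {d n : ℕ} {P : Measure (Obs d)} [IsProbabilityMeasure P] {Z : Obs d → ℝ}
  {r w : (Fin d → ℝ) → ℝ} {C : ℝ}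

lemma memLp (h : HasRegression P Z r C) (hw : BddMeasurable w) :
    MemLp (fun o => -(Z o * w o.1)) 2 P := by
  obtain ⟨hwm, B, hB⟩ := hw
  refine memLp_two_of_ae_bound (C := C * B)
    ((h.measurable.mul (hwm.comp measurable_fst)).neg) (h.abs_le.mono fun o ho => ?_)
  rw [abs_neg, abs_mul]
  exact mul_le_mul ho (hB _) (abs_nonneg _) ((abs_nonneg _).trans ho)

lemma integral_sq_le (h : HasRegression P Z r C) (hw : BddMeasurable w) :
    ∫ o, (-(Z o * w o.1)) ^ 2 ∂P ≤ C ^ 2 * ∫ x in cube d, w x ^ 2 := by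
  have hwX : BddMeasurable fun o : Obs d => w o.1 := hw.comp measurable_fst
  rw [← integral_comp_fst h.map_fst (w := fun x => w x ^ 2) (hw.pow 2).measurable,
    ← integral_const_mul]
  refine integral_mono_ae (h.memLp hw).integrable_sq (((hwX.pow 2).integrable _).const_mul _)
    (h.abs_le.mono fun o ho => ?_)
  simp only [neg_sq, mul_pow]
  refine mul_le_mul_of_nonneg_right ?_ (sq_nonneg _)
  rw [← sq_abs]
  exact pow_le_pow_left₀ (abs_nonneg _) ho 2

lemma sub_avg_eq (c : ℝ) (D : Fin n → Obs d) :
    c - avg (fun o => Z o * w o.1) D = c + avg (fun o => -(Z o * w o.1)) D := by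
  simp [avg, sub_eq_add_neg]

lemma lintegral_sq_sub_avg_le (h : HasRegression P Z r C) (hn : 1 ≤ n) (hw : BddMeasurable w)
    (c : ℝ) :
    ∫⁻ D, ENNReal.ofReal ((c - avg (fun o => Z o * w o.1) D) ^ 2) ∂(Measure.pi fun _ : Fin n => P) ≤
      ENNReal.ofReal ((c - ∫ x in cube d, r x * w x) ^ 2 +
        C ^ 2 / n * ∫ x in cube d, w x ^ 2) := by
  simp only [sub_avg_eq]
  refine (lintegral_sq_add_avg_le hn (h.memLp hw) c).trans (ENNReal.ofReal_le_ofReal ?_)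
  rw [integral_neg, h.integral_mul w hw, ← sub_eq_add_neg]
  refine add_le_add le_rfl ?_
  calc 1 / (n : ℝ) * ∫ o, (-(Z o * w o.1)) ^ 2 ∂P
      ≤ 1 / (n : ℝ) * (C ^ 2 * ∫ x in cube d, w x ^ 2) :=
        mul_le_mul_of_nonneg_left (h.integral_sq_le hw) (by positivity)
    _ = _ := by ring

lemma sq_sub_le_lintegral (h : HasRegression P Z r C) (hn : 1 ≤ n) (hw : BddMeasurable w)
    (c : ℝ) : ENNReal.ofReal ((c - ∫ x in cube d, r x * w x) ^ 2) ≤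
      ∫⁻ D, ENNReal.ofReal ((c - avg (fun o => Z o * w o.1) D) ^ 2)
        ∂(Measure.pi fun _ : Fin n => P) := by
  have := sq_add_integral_le_lintegral hn (h.memLp hw) c
  rw [integral_neg, h.integral_mul w hw, ← sub_eq_add_neg] at this
  simpa only [sub_avg_eq] using this

end HasRegression

namespace CDVBasis

variable {S : ℕ} (W : CDVBasis S) {d n : ℕ}

lemma pHat_eq_avg (j : ℕ) (D : Fin n → Obs d) (x : Fin d → ℝ) :
    W.pHat j D x = avg (fun o => o.2.1 * W.kernel d j o.1 x) D := rfl

lemma bHat_eq_avg (j : ℕ) (D : Fin n → Obs d) (x : Fin d → ℝ) :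
    W.bHat j D x = avg (fun o => o.2.2 * W.kernel d j o.1 x) D := rfl

lemma measurable_pHat (j : ℕ) :
    Measurable fun z : (Fin n → Obs d) × (Fin d → ℝ) => W.pHat j z.1 z.2 := by
  simp only [pHat_eq_avg]
  refine measurable_avg (F := fun (z : (Fin n → Obs d) × (Fin d → ℝ)) (o : Obs d) =>
    o.2.1 * W.kernel d j o.1 z.2) ?_ measurable_fst
  exact Measurable.mul (by fun_prop) ((W.bddMeasurable_kernel d j).measurable.comp
    (g := fun z : (Fin d → ℝ) × (Fin d → ℝ) => W.kernel d j z.1 z.2)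
    (f := fun z : ((Fin n → Obs d) × (Fin d → ℝ)) × Obs d => (z.2.1, z.1.2)) (by fun_prop))

lemma measurable_bHat (j : ℕ) :
    Measurable fun z : (Fin n → Obs d) × (Fin d → ℝ) => W.bHat j z.1 z.2 := by
  simp only [bHat_eq_avg]
  refine measurable_avg (F := fun (z : (Fin n → Obs d) × (Fin d → ℝ)) (o : Obs d) =>
    o.2.2 * W.kernel d j o.1 z.2) ?_ measurable_fst
  exact Measurable.mul (by fun_prop) ((W.bddMeasurable_kernel d j).measurable.comp
    (g := fun z : (Fin d → ℝ) × (Fin d → ℝ) => W.kernel d j z.1 z.2)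
    (f := fun z : ((Fin n → Obs d) × (Fin d → ℝ)) × Obs d => (z.2.1, z.1.2)) (by fun_prop))

lemma bddMeasurable_kernelAvg (j : ℕ) (Z : Obs d → ℝ) (D : Fin n → Obs d) :
    BddMeasurable fun x => avg (fun o => Z o * W.kernel d j o.1 x) D :=
  (BddMeasurable.sum fun i _ =>
    ((W.bddMeasurable_kernel d j).section_left (D i).1).const_mul (Z (D i))).const_mul _

lemma bddMeasurable_pHat (j : ℕ) (D : Fin n → Obs d) : BddMeasurable (W.pHat j D) :=
  W.bddMeasurable_kernelAvg j (fun o => o.2.1) D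

lemma bddMeasurable_bHat (j : ℕ) (D : Fin n → Obs d) : BddMeasurable (W.bHat j D) :=
  W.bddMeasurable_kernelAvg j (fun o => o.2.2) D

lemma integral_mul_kernelAvg (j : ℕ) (Z : Obs d → ℝ) (D : Fin n → Obs d) {u : (Fin d → ℝ) → ℝ}
    (hu : BddMeasurable u) :
    ∫ x in cube d, u x * avg (fun o => Z o * W.kernel d j o.1 x) D =
      avg (fun o => Z o * W.proj d j u o.1) D := by
  simp only [avg, Finset.mul_sum]
  rw [integral_finsetSum _ fun i _ => (hu.mul
    ((((W.bddMeasurable_kernel d j).section_left (D i).1).const_mul _).const_mul _)).integrable _]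
  refine Finset.sum_congr rfl fun i _ => ?_
  rw [proj, ← integral_const_mul, ← integral_const_mul]
  exact integral_congr_ae (Eventually.of_forall fun x => by ring)

lemma integral_mul_pHat (j : ℕ) (D : Fin n → Obs d) {u : (Fin d → ℝ) → ℝ} (hu : BddMeasurable u) :
    ∫ x in cube d, u x * W.pHat j D x = avg (fun o => o.2.1 * W.proj d j u o.1) D :=
  W.integral_mul_kernelAvg j (fun o => o.2.1) D hu

lemma integral_mul_bHat (j : ℕ) (D : Fin n → Obs d) {u : (Fin d → ℝ) → ℝ} (hu : BddMeasurable u) :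
    ∫ x in cube d, u x * W.bHat j D x = avg (fun o => o.2.2 * W.proj d j u o.1) D :=
  W.integral_mul_kernelAvg j (fun o => o.2.2) D hu

lemma proj_pHat (j₁ j₂ : ℕ) (D : Fin n → Obs d) (x : Fin d → ℝ) :
    W.proj d j₂ (W.pHat j₁ D) x = avg (fun o => o.2.1 * W.kernelComp d j₂ j₁ x o.1) D := by
  rw [proj, W.integral_mul_pHat j₁ D ((W.bddMeasurable_kernel d j₂).section_left x)]
  simp only [W.kernelComp_comm j₂ j₁ x]
  rfl

lemma proj_sub (j : ℕ) {f g : (Fin d → ℝ) → ℝ} (hf : BddMeasurable f) (hg : BddMeasurable g)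
    (x : Fin d → ℝ) : W.proj d j (fun y => f y - g y) x = W.proj d j f x - W.proj d j g x := by
  have hk := (W.bddMeasurable_kernel d j).section_left x
  simp only [proj, mul_sub]
  exact integral_sub ((hk.mul hf).integrable _) ((hk.mul hg).integrable _)

lemma integral_mul_kernelComp (j₁ j₂ : ℕ) {p : (Fin d → ℝ) → ℝ} (hp : BddMeasurable p)
    (x : Fin d → ℝ) :
    ∫ y in cube d, p y * W.kernelComp d j₂ j₁ x y = W.proj d j₂ (W.proj d j₁ p) x := by
  simp only [W.kernelComp_comm j₂ j₁ x]
  have := W.integral_mul_proj_comm j₁ hp ((W.bddMeasurable_kernel d j₂).section_left x)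
  refine Eq.trans ?_ (this.trans ?_)
  · rfl
  · simp only [proj, mul_comm]

/-- The integrated product of the errors of the two estimators as approximations of `u` and `v`;
`u = v = 0` gives the plug-in integral and `(u, v) = (p, b)` the conditional bias of the
first-order estimator. -/
noncomputable def prodErr (j₁ j₂ : ℕ) (u v : (Fin d → ℝ) → ℝ) (D₀ D₁ : Fin n → Obs d) : ℝ :=
  ∫ x in cube d, (u x - W.pHat j₁ D₀ x) * (v x - W.bHat j₂ D₁ x)

lemma measurable_prodErr (j₁ j₂ : ℕ) {u v : (Fin d → ℝ) → ℝ} (hu : BddMeasurable u)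
    (hv : BddMeasurable v) :
    Measurable fun z : (Fin n → Obs d) × (Fin n → Obs d) => W.prodErr j₁ j₂ u v z.1 z.2 := by
  have h : Measurable fun z : ((Fin n → Obs d) × (Fin n → Obs d)) × (Fin d → ℝ) =>
      (u z.2 - W.pHat j₁ z.1.1 z.2) * (v z.2 - W.bHat j₂ z.1.2 z.2) := by
    refine ((hu.measurable.comp measurable_snd).sub ?_).mul
      ((hv.measurable.comp measurable_snd).sub ?_)
    · exact (W.measurable_pHat j₁).comp
        (f := fun z : ((Fin n → Obs d) × (Fin n → Obs d)) × (Fin d → ℝ) => (z.1.1, z.2))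
        (by fun_prop)
    · exact (W.measurable_bHat j₂).comp
        (f := fun z : ((Fin n → Obs d) × (Fin n → Obs d)) × (Fin d → ℝ) => (z.1.2, z.2))
        (by fun_prop)
  exact (h.stronglyMeasurable.integral_prod_right' (ν := volume.restrict (cube d))).measurable

lemma prodErr_eq (j₁ j₂ : ℕ) {u v : (Fin d → ℝ) → ℝ} (hu : BddMeasurable u)
    (hv : BddMeasurable v) (D₀ D₁ : Fin n → Obs d) :
    W.prodErr j₁ j₂ u v D₀ D₁ = (∫ x in cube d, (u x - W.pHat j₁ D₀ x) * v x) -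
      avg (fun o => o.2.2 * W.proj d j₂ (fun x => u x - W.pHat j₁ D₀ x) o.1) D₁ := by
  have hw : BddMeasurable fun x => u x - W.pHat j₁ D₀ x := hu.sub (W.bddMeasurable_pHat j₁ D₀)
  rw [← W.integral_mul_bHat j₂ D₁ hw, prodErr, ← integral_sub ((hw.mul hv).integrable _)
    ((hw.mul (W.bddMeasurable_bHat j₂ D₁)).integrable _)]
  simp only [mul_sub]

/-- The conditional expectation of `prodErr` given the first subsample, as an affine function of
that subsample. -/
lemma integral_sub_pHat_mul (j₁ : ℕ) {u v : (Fin d → ℝ) → ℝ} (hu : BddMeasurable u)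
    (hv : BddMeasurable v) (D₀ : Fin n → Obs d) :
    ∫ x in cube d, (u x - W.pHat j₁ D₀ x) * v x = (∫ x in cube d, u x * v x) -
      avg (fun o => o.2.1 * W.proj d j₁ v o.1) D₀ := by
  rw [← W.integral_mul_pHat j₁ D₀ hv, ← integral_sub ((hu.mul hv).integrable _)
    ((hv.mul (W.bddMeasurable_pHat j₁ D₀)).integrable _)]
  exact integral_congr_ae (Eventually.of_forall fun x => by ring)

lemma integral_sub_integral_proj (j₁ : ℕ) {p u r : (Fin d → ℝ) → ℝ} (hp : BddMeasurable p)
    (hu : BddMeasurable u) (hr : BddMeasurable r) :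
    (∫ x in cube d, u x * r x) - ∫ x in cube d, p x * W.proj d j₁ r x =
      ∫ x in cube d, (u x - W.proj d j₁ p x) * r x := by
  rw [W.integral_mul_proj_comm j₁ hp hr, ← integral_sub ((hu.mul hr).integrable _)
    (((W.bddMeasurable_proj j₁ hp).mul hr).integrable _)]
  simp only [sub_mul]

section moments

variable {P : Measure (Obs d)} {p b u v : (Fin d → ℝ) → ℝ} {C : ℝ}

/-- The conditional expectation of `prodErr - q` given the first subsample. -/
lemma sub_sub_eq (hP : IsRegression P p b C) (j₁ j₂ : ℕ) (hu : BddMeasurable u)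
    (hv : BddMeasurable v) (q : ℝ) (D₀ : Fin n → Obs d) :
    (∫ x in cube d, (u x - W.pHat j₁ D₀ x) * v x) - q -
        ∫ x in cube d, b x * W.proj d j₂ (fun x => u x - W.pHat j₁ D₀ x) x =
      (∫ x in cube d, u x * (v x - W.proj d j₂ b x)) - q -
        avg (fun o => o.2.1 * W.proj d j₁ (fun x => v x - W.proj d j₂ b x) o.1) D₀ := by
  have hw : BddMeasurable fun x => u x - W.pHat j₁ D₀ x := hu.sub (W.bddMeasurable_pHat j₁ D₀)
  have hb := W.bddMeasurable_proj j₂ hP.bdd_b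
  have h1 := W.integral_sub_pHat_mul j₁ hu (hv.sub hb) D₀
  have h2 : ∫ x in cube d, (u x - W.pHat j₁ D₀ x) * (v x - W.proj d j₂ b x) =
      (∫ x in cube d, (u x - W.pHat j₁ D₀ x) * v x) -
        ∫ x in cube d, b x * W.proj d j₂ (fun x => u x - W.pHat j₁ D₀ x) x := by
    rw [W.integral_mul_proj_comm j₂ hP.bdd_b hw, ← integral_sub ((hw.mul hv).integrable _)
      ((hb.mul hw).integrable _)]
    exact integral_congr_ae (Eventually.of_forall fun x => by ring)
  rw [h2] at h1
  linarith

/-- Second moment of `prodErr - q`: squared mean, plus terms of order `1/n` and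
`min(k₁, k₂)/n²`. -/
lemma lintegral_prodErr_le (hP : IsRegression P p b C) (hn : 1 ≤ n) {j₁ j₂ : ℕ}
    (hj₁ : W.J0 ≤ j₁) (hj₂ : W.J0 ≤ j₂) (hu : BddMeasurable u) (hv : BddMeasurable v)
    (hu' : ∀ᵐ x ∂(volume.restrict (cube d)), |u x| ≤ C)
    (hv' : ∀ᵐ x ∂(volume.restrict (cube d)), |v x| ≤ C) (q : ℝ) :
    ∫⁻ D, ENNReal.ofReal ((W.prodErr j₁ j₂ u v (D 0) (D 1) - q) ^ 2) ∂(sampleLaw P n) ≤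
      ENNReal.ofReal
        (((∫ x in cube d, (u x - W.proj d j₁ p x) * (v x - W.proj d j₂ b x)) - q) ^ 2) +
      ENNReal.ofReal (2 * (C ^ 2 * (W.kernelConst d * (C + W.kernelConst d * C)) ^ 2) / n +
        C ^ 4 * min (resolution d j₁) (resolution d j₂) / n ^ 2) := by
  have := hP.prob
  have hC := hP.bound_nonneg
  have hK := W.kernelConst_pos d
  set K := W.kernelConst d with hKdef
  set B := C + K * C with hB
  have hB0 : 0 ≤ B := by positivity
  have hpp := W.bddMeasurable_proj j₁ hP.bdd_p
  have hpb := W.bddMeasurable_proj j₂ hP.bdd_b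
  set r : (Fin d → ℝ) → ℝ := fun x => v x - W.proj d j₂ b x with hr
  have hrb : BddMeasurable r := hv.sub hpb
  have hrB : ∀ᵐ x ∂(volume.restrict (cube d)), |r x| ≤ B := hv'.mono fun x hx =>
    (abs_sub _ _).trans (add_le_add hx (W.abs_proj_le j₂ hC hP.abs_b x))
  have huB : ∀ᵐ x ∂(volume.restrict (cube d)), |u x - W.proj d j₁ p x| ≤ B := hu'.mono fun x hx =>
    (abs_sub _ _).trans (add_le_add hx (W.abs_proj_le j₁ hC hP.abs_p x))
  set m : ℝ := (∫ x in cube d, (u x - W.proj d j₁ p x) * r x) - q with hm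
  set c : ℝ := (∫ x in cube d, u x * r x) - q with hc
  have hF : Measurable fun D : Sample d n =>
      ENNReal.ofReal ((W.prodErr j₁ j₂ u v (D 0) (D 1) - q) ^ 2) :=
    ((((W.measurable_prodErr j₁ j₂ hu hv).comp (f := fun D : Sample d n => (D 0, D 1))
      (by fun_prop)).sub_const q).pow_const 2).ennreal_ofReal
  have hT₁ : Measurable fun E : Fin n → Obs d =>
      ENNReal.ofReal ((c - avg (fun o => o.2.1 * W.proj d j₁ r o.1) E) ^ 2) := by
    refine ((Measurable.const_sub ?_ c).pow_const 2).ennreal_ofReal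
    exact measurable_avg (F := fun (_ : Fin n → Obs d) (o : Obs d) => o.2.1 * W.proj d j₁ r o.1)
      (Measurable.mul (by fun_prop)
        ((W.bddMeasurable_proj j₁ hrb).measurable.comp (by fun_prop))) measurable_id
  have hT₂ : Measurable fun z : (Fin n → Obs d) × (Fin d → ℝ) => ENNReal.ofReal
      ((W.proj d j₂ u z.2 - avg (fun o => o.2.1 * W.kernelComp d j₂ j₁ z.2 o.1) z.1) ^ 2) := by
    refine ((((W.bddMeasurable_proj j₂ hu).measurable.comp measurable_snd).sub ?_).pow_const
      2).ennreal_ofReal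
    refine measurable_avg (F := fun (z : (Fin n → Obs d) × (Fin d → ℝ)) (o : Obs d) =>
      o.2.1 * W.kernelComp d j₂ j₁ z.2 o.1) (Measurable.mul (by fun_prop) ?_) measurable_fst
    exact (W.bddMeasurable_kernelComp j₂ j₁).measurable.comp
      (f := fun z : ((Fin n → Obs d) × (Fin d → ℝ)) × Obs d => (z.1.2, z.2.1)) (by fun_prop)
  rw [lintegral_sampleLaw_update 1 hF]
  simp only [Function.update_self, Function.update_of_ne (show (0 : Fin 4) ≠ 1 by decide)]
  have hstage : ∀ D₀ : Fin n → Obs d,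
      ∫⁻ E, ENNReal.ofReal ((W.prodErr j₁ j₂ u v D₀ E - q) ^ 2) ∂(Measure.pi fun _ : Fin n => P) ≤
      ENNReal.ofReal ((c - avg (fun o => o.2.1 * W.proj d j₁ r o.1) D₀) ^ 2) +
      ENNReal.ofReal (C ^ 2 / n) * ∫⁻ x in cube d, ENNReal.ofReal
        ((W.proj d j₂ u x - avg (fun o => o.2.1 * W.kernelComp d j₂ j₁ x o.1) D₀) ^ 2) := by
    intro D₀
    have hw : BddMeasurable fun x => u x - W.pHat j₁ D₀ x := hu.sub (W.bddMeasurable_pHat j₁ D₀)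
    have hpw := W.bddMeasurable_proj j₂ hw
    have e1 : ∀ E, W.prodErr j₁ j₂ u v D₀ E - q =
        ((∫ x in cube d, (u x - W.pHat j₁ D₀ x) * v x) - q) -
          avg (fun o => o.2.2 * W.proj d j₂ (fun x => u x - W.pHat j₁ D₀ x) o.1) E := fun E => by
      rw [W.prodErr_eq j₁ j₂ hu hv]; ring
    have e2 : ∀ x, W.proj d j₂ u x - avg (fun o => o.2.1 * W.kernelComp d j₂ j₁ x o.1) D₀ =
        W.proj d j₂ (fun x => u x - W.pHat j₁ D₀ x) x := fun x => by
      rw [W.proj_sub j₂ hu (W.bddMeasurable_pHat j₁ D₀), W.proj_pHat]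
    simp only [e1, e2]
    refine (hP.hasY.lintegral_sq_sub_avg_le hn hpw _).trans_eq ?_
    rw [W.sub_sub_eq hP j₁ j₂ hu hv q D₀, ENNReal.ofReal_add (sq_nonneg _)
      (mul_nonneg (by positivity) (integral_nonneg fun _ => sq_nonneg _)),
      ENNReal.ofReal_mul (by positivity), ofReal_integral_eq_lintegral_ofReal
        ((hpw.pow 2).integrable _) (Eventually.of_forall fun _ => sq_nonneg _)]
  have hT₃ : Measurable fun E : Fin n → Obs d => ∫⁻ x in cube d, ENNReal.ofReal
      ((W.proj d j₂ u x - avg (fun o => o.2.1 * W.kernelComp d j₂ j₁ x o.1) E) ^ 2) :=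
    hT₂.lintegral_prod_right'
  refine le_trans (lintegral_mono fun D => hstage (D 0)) ?_
  have hev := lintegral_sampleLaw_eval (P := P) 0 (hT₁.add (hT₃.const_mul
    (ENNReal.ofReal (C ^ 2 / n))))
  simp only [Pi.add_apply] at hev
  rw [hev, lintegral_add_left hT₁, lintegral_const_mul _ hT₃]
  have hswap := lintegral_lintegral_swap (μ := Measure.pi fun _ : Fin n => P)
    (ν := volume.restrict (cube d)) (f := fun E x => ENNReal.ofReal
      ((W.proj d j₂ u x - avg (fun o => o.2.1 * W.kernelComp d j₂ j₁ x o.1) E) ^ 2))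
    hT₂.aemeasurable
  rw [hswap]
  have hsq : ∀ {f : (Fin d → ℝ) → ℝ} {R : ℝ}, BddMeasurable f → (∀ x, |f x| ≤ R) →
      ∫ x in cube d, f x ^ 2 ≤ R ^ 2 := fun {f R} hf hR => by
    refine (le_abs_self _).trans (BddMeasurable.abs_integral_le (fun x => ?_) _)
    rw [abs_pow]
    exact pow_le_pow_left₀ (abs_nonneg _) (hR x) 2
  have hfirst : ∫⁻ E, ENNReal.ofReal ((c - avg (fun o => o.2.1 * W.proj d j₁ r o.1) E) ^ 2)
      ∂(Measure.pi fun _ : Fin n => P) ≤ ENNReal.ofReal (m ^ 2 + C ^ 2 / n * (K * B) ^ 2) := by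
    refine (hP.hasA.lintegral_sq_sub_avg_le hn (W.bddMeasurable_proj j₁ hrb) c).trans
      (ENNReal.ofReal_le_ofReal (add_le_add (le_of_eq ?_) (mul_le_mul_of_nonneg_left
        (hsq (W.bddMeasurable_proj j₁ hrb) (W.abs_proj_le j₁ hB0 hrB)) (by positivity))))
    rw [hc, hm, ← W.integral_sub_integral_proj j₁ hP.bdd_p hu hrb]
    ring
  have hsecond : ∀ x, ∫⁻ E, ENNReal.ofReal ((W.proj d j₂ u x -
      avg (fun o => o.2.1 * W.kernelComp d j₂ j₁ x o.1) E) ^ 2) ∂(Measure.pi fun _ : Fin n => P) ≤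
      ENNReal.ofReal ((K * B) ^ 2 + C ^ 2 / n * ∫ y in cube d, W.kernelComp d j₂ j₁ x y ^ 2) := by
    intro x
    refine (hP.hasA.lintegral_sq_sub_avg_le hn
      ((W.bddMeasurable_kernelComp j₂ j₁).section_left x) _).trans
      (ENNReal.ofReal_le_ofReal (add_le_add ?_ le_rfl))
    rw [W.integral_mul_kernelComp j₁ j₂ hP.bdd_p, ← W.proj_sub j₂ hu hpp, ← sq_abs]
    exact pow_le_pow_left₀ (abs_nonneg _) (W.abs_proj_le j₂ hB0 huB x) 2
  have hκ : BddMeasurable fun x => ∫ y in cube d, W.kernelComp d j₂ j₁ x y ^ 2 :=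
    ((W.bddMeasurable_kernelComp j₂ j₁).pow 2).integral_right
      (F := fun x y => W.kernelComp d j₂ j₁ x y ^ 2) _
  have hsecond' : ∫⁻ x in cube d, ∫⁻ E, ENNReal.ofReal ((W.proj d j₂ u x -
      avg (fun o => o.2.1 * W.kernelComp d j₂ j₁ x o.1) E) ^ 2) ∂(Measure.pi fun _ : Fin n => P) ≤
      ENNReal.ofReal ((K * B) ^ 2 + C ^ 2 / n * min (resolution d j₁) (resolution d j₂)) := by
    refine (lintegral_mono hsecond).trans_eq ?_
    rw [← ofReal_integral_eq_lintegral_ofReal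
      (((BddMeasurable.const _).add (hκ.const_mul _)).integrable _)
      (Eventually.of_forall fun x => add_nonneg (sq_nonneg _) (mul_nonneg (by positivity)
        (integral_nonneg fun _ => sq_nonneg _))), integral_add (integrable_const _)
      ((hκ.const_mul _).integrable _), integral_const_mul, W.integral_kernelComp_sq hj₂ hj₁,
      min_comm]
    simp
  have hk0 : 0 ≤ min (resolution d j₁) (resolution d j₂) :=
    le_min (by unfold resolution; positivity) (by unfold resolution; positivity)
  refine (add_le_add hfirst (mul_le_mul_right hsecond' _)).trans_eq ?_
  rw [← ENNReal.ofReal_mul (by positivity), ← ENNReal.ofReal_add (by positivity) (by positivity),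
    ← ENNReal.ofReal_add (by positivity) (by positivity)]
  congr 1
  have hn0 : (n : ℝ) ≠ 0 := by positivity
  field_simp
  ring

lemma le_lintegral_prodErr (hP : IsRegression P p b C) (hn : 1 ≤ n) (j₁ j₂ : ℕ)
    (hu : BddMeasurable u) (hv : BddMeasurable v) (q : ℝ) :
    ENNReal.ofReal
        (((∫ x in cube d, (u x - W.proj d j₁ p x) * (v x - W.proj d j₂ b x)) - q) ^ 2) ≤
      ∫⁻ D, ENNReal.ofReal ((W.prodErr j₁ j₂ u v (D 0) (D 1) - q) ^ 2) ∂(sampleLaw P n) := by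
  have := hP.prob
  have hrb : BddMeasurable fun x => v x - W.proj d j₂ b x :=
    hv.sub (W.bddMeasurable_proj j₂ hP.bdd_b)
  have hF : Measurable fun D : Sample d n =>
      ENNReal.ofReal ((W.prodErr j₁ j₂ u v (D 0) (D 1) - q) ^ 2) :=
    ((((W.measurable_prodErr j₁ j₂ hu hv).comp (f := fun D : Sample d n => (D 0, D 1))
      (by fun_prop)).sub_const q).pow_const 2).ennreal_ofReal
  rw [lintegral_sampleLaw_update 1 hF]
  simp only [Function.update_self, Function.update_of_ne (show (0 : Fin 4) ≠ 1 by decide)]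
  have hstage : ∀ D₀ : Fin n → Obs d, ENNReal.ofReal (((∫ x in cube d, u x *
      (v x - W.proj d j₂ b x)) - q -
        avg (fun o => o.2.1 * W.proj d j₁ (fun x => v x - W.proj d j₂ b x) o.1) D₀) ^ 2) ≤
      ∫⁻ E, ENNReal.ofReal ((W.prodErr j₁ j₂ u v D₀ E - q) ^ 2)
        ∂(Measure.pi fun _ : Fin n => P) := by
    intro D₀
    have hw : BddMeasurable fun x => u x - W.pHat j₁ D₀ x := hu.sub (W.bddMeasurable_pHat j₁ D₀)
    have e1 : ∀ E, W.prodErr j₁ j₂ u v D₀ E - q =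
        ((∫ x in cube d, (u x - W.pHat j₁ D₀ x) * v x) - q) -
          avg (fun o => o.2.2 * W.proj d j₂ (fun x => u x - W.pHat j₁ D₀ x) o.1) E := fun E => by
      rw [W.prodErr_eq j₁ j₂ hu hv]; ring
    simp only [e1]
    rw [← W.sub_sub_eq hP j₁ j₂ hu hv q D₀]
    exact hP.hasY.sq_sub_le_lintegral hn (W.bddMeasurable_proj j₂ hw) _
  have hT₁ : Measurable fun E : Fin n → Obs d =>
      ENNReal.ofReal (((∫ x in cube d, u x * (v x - W.proj d j₂ b x)) - q -
        avg (fun o => o.2.1 * W.proj d j₁ (fun x => v x - W.proj d j₂ b x) o.1) E) ^ 2) := by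
    refine ((Measurable.const_sub ?_ _).pow_const 2).ennreal_ofReal
    exact measurable_avg (F := fun (_ : Fin n → Obs d) (o : Obs d) =>
      o.2.1 * W.proj d j₁ (fun x => v x - W.proj d j₂ b x) o.1)
      (Measurable.mul (by fun_prop)
        ((W.bddMeasurable_proj j₁ hrb).measurable.comp (by fun_prop))) measurable_id
  refine le_trans ?_ (lintegral_mono fun D => hstage (D 0))
  rw [lintegral_sampleLaw_eval 0 hT₁]
  refine le_trans (le_of_eq ?_)
    (hP.hasA.sq_sub_le_lintegral hn (W.bddMeasurable_proj j₁ hrb) _)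
  rw [← W.integral_sub_integral_proj j₁ hP.bdd_p hu hrb]
  ring_nf

end moments

end CDVBasis

/-! ### Mean squared errors of the three estimators -/

namespace CDVBasis

variable {S : ℕ} (W : CDVBasis S) {d n : ℕ}

/-- Mean squared error under the law `P`. -/
noncomputable def _root_.mse (P : Measure (Obs d)) (T : Sample d n → ℝ) : ℝ≥0∞ :=
  ∫⁻ D, ENNReal.ofReal ((T D - psiFunctional P) ^ 2) ∂(sampleLaw P n)

lemma estINT_eq (j₁ j₂ : ℕ) (D : Sample d n) : W.estINT d n j₁ j₂ D =
    avg (fun o : Obs d => o.2.1 * o.2.2) (D 2) -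
      W.prodErr j₁ j₂ (fun _ => 0) (fun _ => 0) (D 0) (D 1) := by
  simp only [estINT, avg, prodErr, zero_sub, neg_mul_neg]

lemma estMC_eq (j₁ j₂ : ℕ) (D : Sample d n) : W.estMC d n j₁ j₂ D =
    avg (fun o : Obs d => o.2.1 * o.2.2) (D 2) -
      avg (fun o : Obs d => W.pHat j₁ (D 0) o.1 * W.bHat j₂ (D 1) o.1) (D 3) := rfl

lemma estIF_eq (j₁ j₂ : ℕ) (D : Sample d n) : W.estIF d n j₁ j₂ D =
    avg (fun o : Obs d => (o.2.1 - W.pHat j₁ (D 0) o.1) * (o.2.2 - W.bHat j₂ (D 1) o.1)) (D 2) :=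
  rfl

lemma measurable_pHat_comp {Ω : Type*} [MeasurableSpace Ω] (j : ℕ) {u : Ω → Fin n → Obs d}
    {x : Ω → Fin d → ℝ} (hu : Measurable u) (hx : Measurable x) :
    Measurable fun z => W.pHat j (u z) (x z) := (W.measurable_pHat j).comp (hu.prodMk hx)

lemma measurable_bHat_comp {Ω : Type*} [MeasurableSpace Ω] (j : ℕ) {u : Ω → Fin n → Obs d}
    {x : Ω → Fin d → ℝ} (hu : Measurable u) (hx : Measurable x) :
    Measurable fun z => W.bHat j (u z) (x z) := (W.measurable_bHat j).comp (hu.prodMk hx)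

lemma measurable_avg_mul (n : ℕ) :
    Measurable fun E : Fin n → Obs d => avg (fun o : Obs d => o.2.1 * o.2.2) E :=
  measurable_avg (F := fun (_ : Fin n → Obs d) (o : Obs d) => o.2.1 * o.2.2) (by fun_prop)
    measurable_id

lemma measurable_prodErr_sample (j₁ j₂ : ℕ) {u v : (Fin d → ℝ) → ℝ} (hu : BddMeasurable u)
    (hv : BddMeasurable v) :
    Measurable fun D : Sample d n => W.prodErr j₁ j₂ u v (D 0) (D 1) :=
  (W.measurable_prodErr j₁ j₂ hu hv).comp (f := fun D : Sample d n => (D 0, D 1)) (by fun_prop)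

lemma measurable_estINT (j₁ j₂ : ℕ) : Measurable (W.estINT d n j₁ j₂) := by
  have h : W.estINT d n j₁ j₂ = _ := funext fun D => W.estINT_eq j₁ j₂ D
  rw [h]
  exact ((measurable_avg_mul n).comp (measurable_pi_apply 2)).sub
    (W.measurable_prodErr_sample j₁ j₂ (BddMeasurable.const 0) (BddMeasurable.const 0))

lemma measurable_estMC (j₁ j₂ : ℕ) : Measurable (W.estMC d n j₁ j₂) := by
  have h : W.estMC d n j₁ j₂ = _ := funext fun D => W.estMC_eq j₁ j₂ D
  rw [h]
  refine ((measurable_avg_mul n).comp (measurable_pi_apply 2)).sub ?_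
  refine measurable_avg (F := fun (D : Sample d n) (o : Obs d) =>
    W.pHat j₁ (D 0) o.1 * W.bHat j₂ (D 1) o.1) ?_ (measurable_pi_apply 3)
  exact (W.measurable_pHat_comp j₁ (by fun_prop) (by fun_prop)).mul
    (W.measurable_bHat_comp j₂ (by fun_prop) (by fun_prop))

lemma measurable_estIF (j₁ j₂ : ℕ) : Measurable (W.estIF d n j₁ j₂) := by
  have h : W.estIF d n j₁ j₂ = _ := funext fun D => W.estIF_eq j₁ j₂ D
  rw [h]
  refine measurable_avg (F := fun (D : Sample d n) (o : Obs d) =>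
    (o.2.1 - W.pHat j₁ (D 0) o.1) * (o.2.2 - W.bHat j₂ (D 1) o.1)) ?_ (measurable_pi_apply 2)
  exact (Measurable.sub (by fun_prop) (W.measurable_pHat_comp j₁ (by fun_prop) (by fun_prop))).mul
    (Measurable.sub (by fun_prop) (W.measurable_bHat_comp j₂ (by fun_prop) (by fun_prop)))

lemma measurable_sq_sub {T : Sample d n → ℝ} (hT : Measurable T) (c : ℝ) :
    Measurable fun D => ENNReal.ofReal ((T D - c) ^ 2) :=
  ((hT.sub_const c).pow_const 2).ennreal_ofReal

section risk

variable {P : Measure (Obs d)} {p b : (Fin d → ℝ) → ℝ} {C : ℝ}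

lemma memLp_mul (hP : IsRegression P p b C) : MemLp (fun o : Obs d => o.2.1 * o.2.2) 2 P := by
  have := hP.prob
  refine memLp_two_of_ae_bound (C := C * C) (by fun_prop) ?_
  filter_upwards [hP.abs_A, hP.abs_Y] with o h1 h2
  rw [abs_mul]
  exact mul_le_mul h1 h2 (abs_nonneg _) hP.bound_nonneg

lemma integral_mul_sq_le (hP : IsRegression P p b C) :
    ∫ o : Obs d, (o.2.1 * o.2.2) ^ 2 ∂P ≤ C ^ 4 := by
  have := hP.prob
  have h : ∫ o : Obs d, (o.2.1 * o.2.2) ^ 2 ∂P ≤ ∫ _ : Obs d, C ^ 4 ∂P := by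
    refine integral_mono_ae (memLp_mul hP).integrable_sq (integrable_const _) ?_
    filter_upwards [hP.abs_A, hP.abs_Y] with o h1 h2
    have h3 : |o.2.1 * o.2.2| ≤ C ^ 2 := by
      rw [abs_mul, sq]
      exact mul_le_mul h1 h2 (abs_nonneg _) hP.bound_nonneg
    have h4 := pow_le_pow_left₀ (abs_nonneg _) h3 2
    rw [sq_abs] at h4
    calc _ ≤ _ := h4
      _ = C ^ 4 := by ring
  simpa using h

/-- Up to sign, the bias of the plug-in estimators is the error form at the coarser level. -/
lemma integral_sub_eq_errForm_min (hP : IsRegression P p b C) {j₁ j₂ : ℕ} (hj₁ : W.J0 ≤ j₁)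
    (hj₂ : W.J0 ≤ j₂) :
    (∫ x in cube d, (0 - W.proj d j₁ p x) * (0 - W.proj d j₂ b x)) - ∫ x in cube d, p x * b x =
      -W.errForm d (min j₁ j₂) p b := by
  simp only [zero_sub, neg_mul_neg]
  rw [W.integral_proj_mul_proj hj₁ hj₂ hP.bdd_p hP.bdd_b, errForm]
  ring

/-- The bias of the first-order estimator is the error form at the finer level. -/
lemma integral_sub_eq_errForm_max (hP : IsRegression P p b C) {j₁ j₂ : ℕ} (hj₁ : W.J0 ≤ j₁)
    (hj₂ : W.J0 ≤ j₂) :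
    (∫ x in cube d, (p x - W.proj d j₁ p x) * (b x - W.proj d j₂ b x)) =
      W.errForm d (max j₁ j₂) p b := by
  have hp := hP.bdd_p
  have hb := hP.bdd_b
  have hpp := W.bddMeasurable_proj j₁ hp
  have hpb := W.bddMeasurable_proj j₂ hb
  have h1 : (∫ x in cube d, (p x - W.proj d j₁ p x) * (b x - W.proj d j₂ b x)) =
      ∫ x in cube d, p x * b x - p x * W.proj d j₂ b x - W.proj d j₁ p x * b x +
        W.proj d j₁ p x * W.proj d j₂ b x :=
    integral_congr_ae (Eventually.of_forall fun x => by ring)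
  rw [h1, integral_add ((((hp.mul hb).sub (hp.mul hpb)).sub (hpp.mul hb)).integrable _)
    ((hpp.mul hpb).integrable _), integral_sub (((hp.mul hb).sub (hp.mul hpb)).integrable _)
    ((hpp.mul hb).integrable _), integral_sub ((hp.mul hb).integrable _)
    ((hp.mul hpb).integrable _), W.integral_proj_mul_proj hj₁ hj₂ hp hb,
    W.integral_mul_proj j₂ hp hb, ← W.integral_mul_proj_comm j₁ hp hb,
    W.integral_mul_proj j₁ hp hb, errForm]
  rcases le_total j₁ j₂ with h | h
  · rw [min_eq_left h, max_eq_right h]; ring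
  · rw [min_eq_right h, max_eq_left h]; ring

lemma ofReal_sq_sub_le (x y : ℝ) : ENNReal.ofReal ((x - y) ^ 2) ≤
    2 * ENNReal.ofReal (x ^ 2) + 2 * ENNReal.ofReal (y ^ 2) := by
  rw [← ENNReal.ofReal_ofNat 2, ← ENNReal.ofReal_mul (by norm_num),
    ← ENNReal.ofReal_mul (by norm_num), ← ENNReal.ofReal_add (by positivity) (by positivity)]
  exact ENNReal.ofReal_le_ofReal (by nlinarith [sq_nonneg (x + y)])

lemma mse_estINT_le (hP : IsRegression P p b C) (hn : 1 ≤ n) {j₁ j₂ : ℕ} (hj₁ : W.J0 ≤ j₁)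
    (hj₂ : W.J0 ≤ j₂) :
    mse P (W.estINT d n j₁ j₂) ≤ ENNReal.ofReal (2 * (W.errForm d (min j₁ j₂) p b ^ 2 +
      (2 * (C ^ 2 * (W.kernelConst d * (C + W.kernelConst d * C)) ^ 2) + C ^ 4) / n +
        C ^ 4 * min (resolution d j₁) (resolution d j₂) / n ^ 2)) := by
  have := hP.prob
  have hC := hP.bound_nonneg
  have hK := W.kernelConst_pos d
  set θ := ∫ o : Obs d, o.2.1 * o.2.2 ∂P with hθ
  set q := ∫ x in cube d, p x * b x with hq
  have h0 : BddMeasurable fun _ : Fin d → ℝ => (0 : ℝ) := BddMeasurable.const 0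
  have h00 : ∀ᵐ x ∂(volume.restrict (cube d)), |(fun _ : Fin d → ℝ => (0 : ℝ)) x| ≤ C :=
    Eventually.of_forall fun x => by simpa using hC
  have hA : ∫⁻ D, ENNReal.ofReal ((-θ + avg (fun o : Obs d => o.2.1 * o.2.2) (D 2)) ^ 2)
      ∂(sampleLaw P n) ≤ ENNReal.ofReal (C ^ 4 / n) := by
    rw [lintegral_sampleLaw_eval 2 (F := fun E => ENNReal.ofReal
      ((-θ + avg (fun o : Obs d => o.2.1 * o.2.2) E) ^ 2))
      (((measurable_avg_mul n).const_add _).pow_const 2).ennreal_ofReal]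
    refine (lintegral_sq_add_avg_le hn (memLp_mul hP) _).trans (ENNReal.ofReal_le_ofReal ?_)
    rw [← hθ, neg_add_cancel, zero_pow two_ne_zero, zero_add]
    exact (mul_le_mul_of_nonneg_left (integral_mul_sq_le hP) (by positivity)).trans_eq
      (one_div_mul_eq_div _ _)
  have hB := W.lintegral_prodErr_le hP hn hj₁ hj₂ h0 h0 h00 h00 q
  rw [W.integral_sub_eq_errForm_min hP hj₁ hj₂, neg_sq] at hB
  have hmA : Measurable fun D : Sample d n =>
      ENNReal.ofReal ((-θ + avg (fun o : Obs d => o.2.1 * o.2.2) (D 2)) ^ 2) :=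
    ((((measurable_avg_mul n).comp (measurable_pi_apply 2)).const_add _).pow_const
      2).ennreal_ofReal
  have hmB := measurable_sq_sub (W.measurable_prodErr_sample (n := n) j₁ j₂ h0 h0) q
  calc mse P (W.estINT d n j₁ j₂)
      ≤ ∫⁻ D, (2 * ENNReal.ofReal ((-θ + avg (fun o : Obs d => o.2.1 * o.2.2) (D 2)) ^ 2) +
        2 * ENNReal.ofReal ((W.prodErr j₁ j₂ (fun _ => 0) (fun _ => 0) (D 0) (D 1) - q) ^ 2))
          ∂(sampleLaw P n) := by
        refine lintegral_mono fun D => ?_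
        have e : W.estINT d n j₁ j₂ D - psiFunctional P =
            (-θ + avg (fun o : Obs d => o.2.1 * o.2.2) (D 2)) -
              (W.prodErr j₁ j₂ (fun _ => 0) (fun _ => 0) (D 0) (D 1) - q) := by
          rw [hP.psi_eq, W.estINT_eq]; ring
        simp only [e]
        exact ofReal_sq_sub_le _ _
    _ ≤ 2 * ENNReal.ofReal (C ^ 4 / n) + 2 * (ENNReal.ofReal (W.errForm d (min j₁ j₂) p b ^ 2) +
        ENNReal.ofReal (2 * (C ^ 2 * (W.kernelConst d * (C + W.kernelConst d * C)) ^ 2) / n +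
          C ^ 4 * min (resolution d j₁) (resolution d j₂) / n ^ 2)) := by
        rw [lintegral_add_left (hmA.const_mul _), lintegral_const_mul _ hmA,
          lintegral_const_mul _ hmB]
        exact add_le_add (mul_le_mul_right hA _) (mul_le_mul_right hB _)
    _ = _ := by
        have hk0 : 0 ≤ min (resolution d j₁) (resolution d j₂) :=
          le_min (by unfold resolution; positivity) (by unfold resolution; positivity)
        rw [← ENNReal.ofReal_ofNat 2, ← ENNReal.ofReal_add (by positivity) (by positivity),
          ← ENNReal.ofReal_mul (by norm_num), ← ENNReal.ofReal_mul (by norm_num),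
          ← ENNReal.ofReal_add (by positivity) (by positivity)]
        congr 1
        ring

lemma errForm_sq_le_mse_estINT (hP : IsRegression P p b C) (hn : 1 ≤ n) {j₁ j₂ : ℕ}
    (hj₁ : W.J0 ≤ j₁) (hj₂ : W.J0 ≤ j₂) :
    ENNReal.ofReal (W.errForm d (min j₁ j₂) p b ^ 2) ≤ mse P (W.estINT d n j₁ j₂) := by
  have := hP.prob
  have h0 : BddMeasurable fun _ : Fin d → ℝ => (0 : ℝ) := BddMeasurable.const 0
  have hB := W.le_lintegral_prodErr hP hn j₁ j₂ h0 h0 (∫ x in cube d, p x * b x)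
  rw [W.integral_sub_eq_errForm_min hP hj₁ hj₂, neg_sq] at hB
  refine hB.trans ?_
  rw [mse, lintegral_sampleLaw_update 2 (measurable_sq_sub (W.measurable_estINT j₁ j₂) _)]
  refine lintegral_mono fun D => ?_
  have e : ∀ E, W.estINT d n j₁ j₂ (Function.update D 2 E) - psiFunctional P =
      (-(∫ o : Obs d, o.2.1 * o.2.2 ∂P) -
        (W.prodErr j₁ j₂ (fun _ => 0) (fun _ => 0) (D 0) (D 1) - ∫ x in cube d, p x * b x)) +
        avg (fun o : Obs d => o.2.1 * o.2.2) E := fun E => by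
    rw [hP.psi_eq, W.estINT_eq]
    simp only [Function.update_self, Function.update_of_ne (show (0 : Fin 4) ≠ 2 by decide),
      Function.update_of_ne (show (1 : Fin 4) ≠ 2 by decide)]
    ring
  simp only [e]
  refine le_trans (le_of_eq ?_) (sq_add_integral_le_lintegral hn (memLp_mul hP) _)
  ring_nf

/-- The average of `p̂ b̂` over the fourth subsample has the integral of `p̂ b̂` as conditional
mean. -/
lemma estMC_update (hP : IsRegression P p b C) (j₁ j₂ : ℕ) (D : Sample d n)
    (E : Fin n → Obs d) :
    W.estMC d n j₁ j₂ (Function.update D 3 E) - psiFunctional P =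
      (avg (fun o : Obs d => o.2.1 * o.2.2) (D 2) - psiFunctional P) +
        avg (fun o : Obs d => -(W.pHat j₁ (D 0) o.1 * W.bHat j₂ (D 1) o.1)) E ∧
    avg (fun o : Obs d => o.2.1 * o.2.2) (D 2) - psiFunctional P +
        ∫ o : Obs d, -(W.pHat j₁ (D 0) o.1 * W.bHat j₂ (D 1) o.1) ∂P =
      W.estINT d n j₁ j₂ D - psiFunctional P := by
  constructor
  · rw [W.estMC_eq]
    simp only [Function.update_self, Function.update_of_ne (show (0 : Fin 4) ≠ 3 by decide),
      Function.update_of_ne (show (1 : Fin 4) ≠ 3 by decide),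
      Function.update_of_ne (show (2 : Fin 4) ≠ 3 by decide)]
    simp only [avg, Finset.sum_neg_distrib]
    ring
  · rw [integral_neg, integral_comp_fst hP.map_fst
      (w := fun x => W.pHat j₁ (D 0) x * W.bHat j₂ (D 1) x)
      ((W.bddMeasurable_pHat j₁ _).mul (W.bddMeasurable_bHat j₂ _)).measurable, estINT]
    simp only [avg]
    ring

lemma memLp_pHat_mul_bHat [IsProbabilityMeasure P] (j₁ j₂ : ℕ) (D₀ D₁ : Fin n → Obs d) :
    MemLp (fun o : Obs d => -(W.pHat j₁ D₀ o.1 * W.bHat j₂ D₁ o.1)) 2 P := by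
  have h : BddMeasurable fun o : Obs d => -(W.pHat j₁ D₀ o.1 * W.bHat j₂ D₁ o.1) :=
    (((W.bddMeasurable_pHat j₁ D₀).mul (W.bddMeasurable_bHat j₂ D₁)).neg).comp measurable_fst
  exact memLp_two_of_ae_bound h.measurable (Eventually.of_forall h.2.choose_spec)

/-- By the conditional Jensen inequality, Monte Carlo integration does not improve the risk. -/
lemma mse_estINT_le_mse_estMC (hP : IsRegression P p b C) (hn : 1 ≤ n) (j₁ j₂ : ℕ) :
    mse P (W.estINT d n j₁ j₂) ≤ mse P (W.estMC d n j₁ j₂) := by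
  have := hP.prob
  rw [mse, mse, lintegral_sampleLaw_update 3 (measurable_sq_sub (W.measurable_estMC j₁ j₂) _)]
  refine lintegral_mono fun D => ?_
  simp only [(W.estMC_update hP j₁ j₂ D _).1]
  rw [← (W.estMC_update hP j₁ j₂ D (D 3)).2]
  exact sq_add_integral_le_lintegral hn (W.memLp_pHat_mul_bHat j₁ j₂ _ _) _

/-- A bound on `E[(2C² + 2p̂(x)²)]`, uniformly in `x`. -/
noncomputable def fitConst (W : CDVBasis S) (d : ℕ) (C : ℝ) : ℝ :=
  2 * C ^ 2 + 2 * (W.kernelConst d * C) ^ 2 + 2 * C ^ 2 * W.kernelConst d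

lemma lintegral_kernelAvg_sq_le [IsProbabilityMeasure P] {Z : Obs d → ℝ} {r : (Fin d → ℝ) → ℝ}
    (hZ : HasRegression P Z r C) (hC : 0 ≤ C)
    (hrC : ∀ᵐ x ∂(volume.restrict (cube d)), |r x| ≤ C) (hn : 1 ≤ n) {j : ℕ} (hj : W.J0 ≤ j)
    (x : Fin d → ℝ) :
    ∫⁻ E, ENNReal.ofReal (2 * C ^ 2 + 2 * avg (fun o => Z o * W.kernel d j o.1 x) E ^ 2)
      ∂(Measure.pi fun _ : Fin n => P) ≤
      ENNReal.ofReal (W.fitConst d C * (1 + resolution d j / n)) := by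
  have hK := W.kernelConst_pos d
  have hk : 0 ≤ resolution d j := by unfold resolution; positivity
  have hkb : BddMeasurable fun y => W.kernel d j y x := (W.bddMeasurable_kernel d j).section_right x
  have h1 := hZ.lintegral_sq_sub_avg_le hn hkb 0
  have h2 : ∫⁻ E, ENNReal.ofReal ((0 - avg (fun o => Z o * W.kernel d j o.1 x) E) ^ 2)
      ∂(Measure.pi fun _ : Fin n => P) ≤ ENNReal.ofReal ((W.kernelConst d * C) ^ 2 +
        C ^ 2 * W.kernelConst d * (resolution d j / n)) := by
    refine h1.trans (ENNReal.ofReal_le_ofReal (add_le_add ?_ ?_))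
    · rw [zero_sub, neg_sq, ← sq_abs]
      refine pow_le_pow_left₀ (abs_nonneg _) ?_ 2
      have e : ∫ y in cube d, r y * W.kernel d j y x = W.proj d j r x := by
        simp only [proj, W.kernel_comm j x, mul_comm]
      rw [e]
      exact W.abs_proj_le j hC hrC x
    · simp only [W.kernel_comm j _ x]
      rw [W.integral_kernel_sq hj]
      calc C ^ 2 / n * W.kernel d j x x ≤ C ^ 2 / n * (W.kernelConst d * resolution d j) :=
            mul_le_mul_of_nonneg_left (W.kernel_self_le j x) (by positivity)
        _ = _ := by ring
  simp only [zero_sub, neg_sq] at h2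
  have hm : Measurable fun E : Fin n → Obs d =>
      ENNReal.ofReal (avg (fun o => Z o * W.kernel d j o.1 x) E ^ 2) := by
    refine (Measurable.pow_const ?_ 2).ennreal_ofReal
    exact measurable_avg (F := fun (_ : Fin n → Obs d) (o : Obs d) => Z o * W.kernel d j o.1 x)
      ((hZ.measurable.comp measurable_snd).mul (hkb.measurable.comp (by fun_prop))) measurable_id
  calc ∫⁻ E, ENNReal.ofReal (2 * C ^ 2 + 2 * avg (fun o => Z o * W.kernel d j o.1 x) E ^ 2)
      ∂(Measure.pi fun _ : Fin n => P)
      = ∫⁻ E, (ENNReal.ofReal (2 * C ^ 2) + ENNReal.ofReal 2 *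
          ENNReal.ofReal (avg (fun o => Z o * W.kernel d j o.1 x) E ^ 2))
          ∂(Measure.pi fun _ : Fin n => P) := by
        refine lintegral_congr fun E => ?_
        rw [ENNReal.ofReal_add (by positivity) (by positivity), ENNReal.ofReal_mul (p := 2)
          (q := avg (fun o => Z o * W.kernel d j o.1 x) E ^ 2) zero_le_two]
    _ = ENNReal.ofReal (2 * C ^ 2) + ENNReal.ofReal 2 * ∫⁻ E,
          ENNReal.ofReal (avg (fun o => Z o * W.kernel d j o.1 x) E ^ 2)
          ∂(Measure.pi fun _ : Fin n => P) := by
        rw [lintegral_add_left measurable_const, lintegral_const_mul _ hm]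
        simp
    _ ≤ ENNReal.ofReal (2 * C ^ 2) + ENNReal.ofReal 2 * ENNReal.ofReal
          ((W.kernelConst d * C) ^ 2 + C ^ 2 * W.kernelConst d * (resolution d j / n)) :=
        add_le_add le_rfl (mul_le_mul_right h2 _)
    _ ≤ _ := by
        rw [← ENNReal.ofReal_mul (by norm_num), ← ENNReal.ofReal_add (by positivity)
          (by positivity)]
        refine ENNReal.ofReal_le_ofReal ?_
        have hkn : 0 ≤ resolution d j / n := by positivity
        have a1 : 0 ≤ C ^ 2 * (resolution d j / n) := by positivity
        have a2 : 0 ≤ (W.kernelConst d * C) ^ 2 * (resolution d j / n) := by positivity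
        have a3 : 0 ≤ C ^ 2 * W.kernelConst d := by positivity
        unfold fitConst
        linarith

/-- The fits from two independent subsamples are independent, so that the second moments of the
integrated product factorize pointwise in `x`. -/
lemma lintegral_fit_mul_fit_le (hP : IsRegression P p b C) (hn : 1 ≤ n) {j₁ j₂ : ℕ}
    (hj₁ : W.J0 ≤ j₁) (hj₂ : W.J0 ≤ j₂) :
    ∫⁻ D, (∫⁻ x in cube d, ENNReal.ofReal (2 * C ^ 2 + 2 * W.pHat j₁ (D 0) x ^ 2) *
      ENNReal.ofReal (2 * C ^ 2 + 2 * W.bHat j₂ (D 1) x ^ 2)) ∂(sampleLaw P n) ≤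
      ENNReal.ofReal (W.fitConst d C ^ 2 * ((1 + resolution d j₁ / n) *
        (1 + resolution d j₂ / n))) := by
  have := hP.prob
  have hC := hP.bound_nonneg
  have hK := W.kernelConst_pos d
  have hm₁ : ∀ {Ω : Type} [MeasurableSpace Ω] {u : Ω → Fin n → Obs d} {x : Ω → Fin d → ℝ},
      Measurable u → Measurable x →
      Measurable fun z => ENNReal.ofReal (2 * C ^ 2 + 2 * W.pHat j₁ (u z) (x z) ^ 2) :=
    fun hu hx => ((((W.measurable_pHat_comp j₁ hu hx).pow_const 2).const_mul 2).const_add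
      _).ennreal_ofReal
  have hm₂ : ∀ {Ω : Type} [MeasurableSpace Ω] {u : Ω → Fin n → Obs d} {x : Ω → Fin d → ℝ},
      Measurable u → Measurable x →
      Measurable fun z => ENNReal.ofReal (2 * C ^ 2 + 2 * W.bHat j₂ (u z) (x z) ^ 2) :=
    fun hu hx => ((((W.measurable_bHat_comp j₂ hu hx).pow_const 2).const_mul 2).const_add
      _).ennreal_ofReal
  rw [lintegral_lintegral_swap]
  swap
  · exact ((hm₁ (by fun_prop) (by fun_prop)).mul (hm₂ (by fun_prop) (by fun_prop))).aemeasurable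
  refine (lintegral_mono (g := fun _ => ENNReal.ofReal (W.fitConst d C ^ 2 *
    ((1 + resolution d j₁ / n) * (1 + resolution d j₂ / n)))) fun x => ?_).trans_eq (by simp)
  have hF : Measurable fun D : Sample d n =>
      ENNReal.ofReal (2 * C ^ 2 + 2 * W.pHat j₁ (D 0) x ^ 2) *
      ENNReal.ofReal (2 * C ^ 2 + 2 * W.bHat j₂ (D 1) x ^ 2) :=
    (hm₁ (by fun_prop) measurable_const).mul (hm₂ (by fun_prop) measurable_const)
  have hE₁ : Measurable fun E : Fin n → Obs d =>
      ENNReal.ofReal (2 * C ^ 2 + 2 * W.pHat j₁ E x ^ 2) := hm₁ measurable_id measurable_const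
  have hE₂ : Measurable fun E : Fin n → Obs d =>
      ENNReal.ofReal (2 * C ^ 2 + 2 * W.bHat j₂ E x ^ 2) := hm₂ measurable_id measurable_const
  rw [lintegral_sampleLaw_update 1 hF]
  simp only [Function.update_self, Function.update_of_ne (show (0 : Fin 4) ≠ 1 by decide)]
  simp only [lintegral_const_mul _ hE₂]
  have hE₀ : Measurable fun D : Sample d n =>
      ENNReal.ofReal (2 * C ^ 2 + 2 * W.pHat j₁ (D 0) x ^ 2) :=
    hE₁.comp (measurable_pi_apply 0)
  rw [lintegral_mul_const _ hE₀, lintegral_sampleLaw_eval 0 hE₁]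
  have k1 := W.lintegral_kernelAvg_sq_le hP.hasA hC hP.abs_p hn hj₁ x
  have k2 := W.lintegral_kernelAvg_sq_le hP.hasY hC hP.abs_b hn hj₂ x
  refine (mul_le_mul' k1 k2).trans_eq ?_
  have hk₁ : 0 ≤ resolution d j₁ := by unfold resolution; positivity
  have hf : 0 ≤ W.fitConst d C := by unfold fitConst; positivity
  rw [← ENNReal.ofReal_mul (by positivity)]
  congr 1
  ring

lemma lintegral_ofReal_le_fit (hP : IsRegression P p b C) (hn : 1 ≤ n) {j₁ j₂ : ℕ}
    (hj₁ : W.J0 ≤ j₁) (hj₂ : W.J0 ≤ j₂) {g : Sample d n → ℝ}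
    (hg : ∀ D, g D ≤ ∫ x in cube d, (2 * C ^ 2 + 2 * W.pHat j₁ (D 0) x ^ 2) *
      (2 * C ^ 2 + 2 * W.bHat j₂ (D 1) x ^ 2)) :
    ∫⁻ D, ENNReal.ofReal (1 / (n : ℝ) * g D) ∂(sampleLaw P n) ≤
      ENNReal.ofReal (W.fitConst d C ^ 2 * (1 / n * ((1 + resolution d j₁ / n) *
        (1 + resolution d j₂ / n)))) := by
  have := hP.prob
  have h1 : ∀ D : Sample d n, ENNReal.ofReal (1 / (n : ℝ) * g D) ≤ ENNReal.ofReal (1 / (n : ℝ)) *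
      ∫⁻ x in cube d, ENNReal.ofReal (2 * C ^ 2 + 2 * W.pHat j₁ (D 0) x ^ 2) *
      ENNReal.ofReal (2 * C ^ 2 + 2 * W.bHat j₂ (D 1) x ^ 2) := by
    intro D
    rw [ENNReal.ofReal_mul (by positivity)]
    refine mul_le_mul_right ((ENNReal.ofReal_le_ofReal (hg D)).trans_eq ?_) _
    have hb1 : BddMeasurable fun x => 2 * C ^ 2 + 2 * W.pHat j₁ (D 0) x ^ 2 :=
      (BddMeasurable.const _).add (((W.bddMeasurable_pHat j₁ (D 0)).pow 2).const_mul 2)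
    have hb2 : BddMeasurable fun x => 2 * C ^ 2 + 2 * W.bHat j₂ (D 1) x ^ 2 :=
      (BddMeasurable.const _).add (((W.bddMeasurable_bHat j₂ (D 1)).pow 2).const_mul 2)
    rw [ofReal_integral_eq_lintegral_ofReal ((hb1.mul hb2).integrable _)
      (Eventually.of_forall fun x => by positivity)]
    refine lintegral_congr fun x => ?_
    rw [ENNReal.ofReal_mul (by positivity)]
  refine (lintegral_mono h1).trans ?_
  rw [lintegral_const_mul' _ _ ENNReal.ofReal_ne_top]
  refine (mul_le_mul_right (W.lintegral_fit_mul_fit_le hP hn hj₁ hj₂) _).trans_eq ?_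
  rw [← ENNReal.ofReal_mul (by positivity)]
  congr 1
  ring

lemma mse_estMC_le (hP : IsRegression P p b C) (hn : 1 ≤ n) {j₁ j₂ : ℕ} (hj₁ : W.J0 ≤ j₁)
    (hj₂ : W.J0 ≤ j₂) :
    mse P (W.estMC d n j₁ j₂) ≤ mse P (W.estINT d n j₁ j₂) +
      ENNReal.ofReal (W.fitConst d C ^ 2 * (1 / n * ((1 + resolution d j₁ / n) *
        (1 + resolution d j₂ / n)))) := by
  have := hP.prob
  rw [mse, lintegral_sampleLaw_update 3 (measurable_sq_sub (W.measurable_estMC j₁ j₂) _)]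
  have h1 : ∀ D : Sample d n, ∫⁻ E, ENNReal.ofReal ((W.estMC d n j₁ j₂ (Function.update D 3 E) -
      psiFunctional P) ^ 2) ∂(Measure.pi fun _ : Fin n => P) ≤
      ENNReal.ofReal ((W.estINT d n j₁ j₂ D - psiFunctional P) ^ 2) + ENNReal.ofReal (1 / (n : ℝ) *
        ∫ o : Obs d, (-(W.pHat j₁ (D 0) o.1 * W.bHat j₂ (D 1) o.1)) ^ 2 ∂P) := by
    intro D
    simp only [(W.estMC_update hP j₁ j₂ D _).1]
    refine (lintegral_sq_add_avg_le hn (W.memLp_pHat_mul_bHat j₁ j₂ _ _) _).trans_eq ?_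
    rw [(W.estMC_update hP j₁ j₂ D (D 3)).2, ENNReal.ofReal_add (sq_nonneg _)
      (mul_nonneg (by positivity) (integral_nonneg fun _ => sq_nonneg _))]
  refine le_trans (lintegral_mono h1) ?_
  rw [lintegral_add_left (measurable_sq_sub (W.measurable_estINT j₁ j₂) _)]
  refine add_le_add le_rfl (W.lintegral_ofReal_le_fit hP hn hj₁ hj₂ fun D => ?_)
  have hbp := W.bddMeasurable_pHat j₁ (D 0)
  have hbb := W.bddMeasurable_bHat j₂ (D 1)
  rw [integral_comp_fst hP.map_fst (w := fun x => (-(W.pHat j₁ (D 0) x * W.bHat j₂ (D 1) x)) ^ 2)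
    ((hbp.mul hbb).neg.pow 2).measurable]
  refine integral_mono (((hbp.mul hbb).neg.pow 2).integrable _)
    ((((BddMeasurable.const _).add ((hbp.pow 2).const_mul 2)).mul
      ((BddMeasurable.const _).add ((hbb.pow 2).const_mul 2))).integrable _) fun x => ?_
  have a1 := sq_nonneg (W.pHat j₁ (D 0) x)
  have a2 := sq_nonneg (W.bHat j₂ (D 1) x)
  have a3 := sq_nonneg C
  calc (-(W.pHat j₁ (D 0) x * W.bHat j₂ (D 1) x)) ^ 2
      = W.pHat j₁ (D 0) x ^ 2 * W.bHat j₂ (D 1) x ^ 2 := by ring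
    _ ≤ _ := mul_le_mul (by linarith) (by linarith) a2 (by linarith)

lemma memLp_resid (hP : IsRegression P p b C) (j₁ j₂ : ℕ) (D₀ D₁ : Fin n → Obs d) :
    MemLp (fun o : Obs d => (o.2.1 - W.pHat j₁ D₀ o.1) * (o.2.2 - W.bHat j₂ D₁ o.1)) 2 P := by
  have := hP.prob
  have hbp := W.bddMeasurable_pHat j₁ D₀
  have hbb := W.bddMeasurable_bHat j₂ D₁
  obtain ⟨-, B₁, hB₁⟩ := id hbp
  obtain ⟨-, B₂, hB₂⟩ := id hbb
  refine memLp_two_of_ae_bound (C := (C + B₁) * (C + B₂)) (Measurable.mul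
    (Measurable.sub (by fun_prop) (hbp.measurable.comp (by fun_prop)))
    (Measurable.sub (by fun_prop) (hbb.measurable.comp (by fun_prop)))) ?_
  filter_upwards [hP.abs_A, hP.abs_Y] with o h1 h2
  rw [abs_mul]
  have h3 := (abs_sub o.2.1 (W.pHat j₁ D₀ o.1)).trans (add_le_add h1 (hB₁ _))
  exact mul_le_mul h3 ((abs_sub _ _).trans (add_le_add h2 (hB₂ _))) (abs_nonneg _)
    ((abs_nonneg _).trans h3)

lemma integral_resid (hP : IsRegression P p b C) (j₁ j₂ : ℕ) (D₀ D₁ : Fin n → Obs d) :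
    ∫ o : Obs d, (o.2.1 - W.pHat j₁ D₀ o.1) * (o.2.2 - W.bHat j₂ D₁ o.1) ∂P =
      psiFunctional P + W.prodErr j₁ j₂ p b D₀ D₁ := by
  have := hP.prob
  have hbp := W.bddMeasurable_pHat j₁ D₀
  have hbb := W.bddMeasurable_bHat j₂ D₁
  have i1 : Integrable (fun o : Obs d => o.2.1 * o.2.2) P := (memLp_mul hP).integrable one_le_two
  have i2 : Integrable (fun o : Obs d => o.2.1 * W.bHat j₂ D₁ o.1) P := by
    simpa using ((hP.hasA.memLp hbb).integrable one_le_two).neg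
  have i3 : Integrable (fun o : Obs d => o.2.2 * W.pHat j₁ D₀ o.1) P := by
    simpa using ((hP.hasY.memLp hbp).integrable one_le_two).neg
  have i4 : Integrable (fun o : Obs d => W.pHat j₁ D₀ o.1 * W.bHat j₂ D₁ o.1) P :=
    ((hbp.mul hbb).comp measurable_fst).integrable _
  have i5 : Integrable (fun o : Obs d => o.2.1 * o.2.2 - o.2.1 * W.bHat j₂ D₁ o.1) P := i1.sub i2
  have i6 : Integrable (fun o : Obs d => o.2.1 * o.2.2 - o.2.1 * W.bHat j₂ D₁ o.1 -
    o.2.2 * W.pHat j₁ D₀ o.1) P := i5.sub i3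
  have e : ∫ o : Obs d, (o.2.1 - W.pHat j₁ D₀ o.1) * (o.2.2 - W.bHat j₂ D₁ o.1) ∂P =
      ∫ o : Obs d, o.2.1 * o.2.2 - o.2.1 * W.bHat j₂ D₁ o.1 - o.2.2 * W.pHat j₁ D₀ o.1 +
        W.pHat j₁ D₀ o.1 * W.bHat j₂ D₁ o.1 ∂P :=
    integral_congr_ae (Eventually.of_forall fun o => by ring)
  have e2 : W.prodErr j₁ j₂ p b D₀ D₁ = ∫ x in cube d, p x * b x - p x * W.bHat j₂ D₁ x -
      b x * W.pHat j₁ D₀ x + W.pHat j₁ D₀ x * W.bHat j₂ D₁ x :=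
    integral_congr_ae (Eventually.of_forall fun x => by ring)
  have hp := hP.bdd_p
  have hb := hP.bdd_b
  rw [e, integral_add i6 i4, integral_sub i5 i3, integral_sub i1 i2, hP.integral_A _ hbb,
    hP.integral_Y _ hbp, integral_comp_fst hP.map_fst
      (w := fun x => W.pHat j₁ D₀ x * W.bHat j₂ D₁ x) (hbp.mul hbb).measurable, e2,
    integral_add ((((hp.mul hb).sub (hp.mul hbb)).sub (hb.mul hbp)).integrable _)
      ((hbp.mul hbb).integrable _), integral_sub (((hp.mul hb).sub (hp.mul hbb)).integrable _)
      ((hb.mul hbp).integrable _), integral_sub ((hp.mul hb).integrable _)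
      ((hp.mul hbb).integrable _), hP.psi_eq]
  ring

lemma estIF_update (j₁ j₂ : ℕ) (D : Sample d n) (E : Fin n → Obs d) :
    W.estIF d n j₁ j₂ (Function.update D 2 E) - psiFunctional P = -psiFunctional P +
      avg (fun o : Obs d => (o.2.1 - W.pHat j₁ (D 0) o.1) * (o.2.2 - W.bHat j₂ (D 1) o.1)) E := by
  rw [W.estIF_eq]
  simp only [Function.update_self, Function.update_of_ne (show (0 : Fin 4) ≠ 2 by decide),
      Function.update_of_ne (show (1 : Fin 4) ≠ 2 by decide)]
  ring

lemma errForm_sq_le_mse_estIF (hP : IsRegression P p b C) (hn : 1 ≤ n) {j₁ j₂ : ℕ}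
    (hj₁ : W.J0 ≤ j₁) (hj₂ : W.J0 ≤ j₂) :
    ENNReal.ofReal (W.errForm d (max j₁ j₂) p b ^ 2) ≤ mse P (W.estIF d n j₁ j₂) := by
  have := hP.prob
  have hB := W.le_lintegral_prodErr hP hn j₁ j₂ hP.bdd_p hP.bdd_b 0
  rw [sub_zero, W.integral_sub_eq_errForm_max hP hj₁ hj₂] at hB
  refine hB.trans ?_
  rw [mse, lintegral_sampleLaw_update 2 (measurable_sq_sub (W.measurable_estIF j₁ j₂) _)]
  refine lintegral_mono fun D => ?_
  simp only [W.estIF_update]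
  refine le_trans (le_of_eq ?_) (sq_add_integral_le_lintegral hn (W.memLp_resid hP j₁ j₂ _ _) _)
  rw [W.integral_resid hP, neg_add_cancel_left, sub_zero]

lemma mse_estIF_le (hP : IsRegression P p b C) (hn : 1 ≤ n) {j₁ j₂ : ℕ} (hj₁ : W.J0 ≤ j₁)
    (hj₂ : W.J0 ≤ j₂) :
    mse P (W.estIF d n j₁ j₂) ≤ ENNReal.ofReal (W.errForm d (max j₁ j₂) p b ^ 2 +
      2 * (C ^ 2 * (W.kernelConst d * (C + W.kernelConst d * C)) ^ 2) / n +
        C ^ 4 * min (resolution d j₁) (resolution d j₂) / n ^ 2 +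
        W.fitConst d C ^ 2 * (1 / n * ((1 + resolution d j₁ / n) *
        (1 + resolution d j₂ / n)))) := by
  have := hP.prob
  have hC := hP.bound_nonneg
  have hK := W.kernelConst_pos d
  have hk₁ : 0 ≤ resolution d j₁ := by unfold resolution; positivity
  have hk₂ : 0 ≤ resolution d j₂ := by unfold resolution; positivity
  have hk0 : 0 ≤ min (resolution d j₁) (resolution d j₂) := le_min hk₁ hk₂
  have hB := W.lintegral_prodErr_le hP hn hj₁ hj₂ hP.bdd_p hP.bdd_b hP.abs_p hP.abs_b 0
  rw [sub_zero, W.integral_sub_eq_errForm_max hP hj₁ hj₂] at hB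
  rw [mse, lintegral_sampleLaw_update 2 (measurable_sq_sub (W.measurable_estIF j₁ j₂) _)]
  have h1 : ∀ D : Sample d n, ∫⁻ E, ENNReal.ofReal ((W.estIF d n j₁ j₂ (Function.update D 2 E) -
      psiFunctional P) ^ 2) ∂(Measure.pi fun _ : Fin n => P) ≤
      ENNReal.ofReal ((W.prodErr j₁ j₂ p b (D 0) (D 1) - 0) ^ 2) + ENNReal.ofReal (1 / (n : ℝ) *
        ∫ o : Obs d, ((o.2.1 - W.pHat j₁ (D 0) o.1) * (o.2.2 - W.bHat j₂ (D 1) o.1)) ^ 2 ∂P) := by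
    intro D
    simp only [W.estIF_update]
    refine (lintegral_sq_add_avg_le hn (W.memLp_resid hP j₁ j₂ _ _) _).trans_eq ?_
    rw [W.integral_resid hP, neg_add_cancel_left, sub_zero, ENNReal.ofReal_add (sq_nonneg _)
      (mul_nonneg (by positivity) (integral_nonneg fun _ => sq_nonneg _))]
  refine le_trans (lintegral_mono h1) ?_
  rw [lintegral_add_left
    (measurable_sq_sub (W.measurable_prodErr_sample j₁ j₂ hP.bdd_p hP.bdd_b) 0)]
  refine (add_le_add hB (W.lintegral_ofReal_le_fit hP hn hj₁ hj₂ fun D => ?_)).trans_eq ?_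
  · have hbp := W.bddMeasurable_pHat j₁ (D 0)
    have hbb := W.bddMeasurable_bHat j₂ (D 1)
    have hb : BddMeasurable fun x => (2 * C ^ 2 + 2 * W.pHat j₁ (D 0) x ^ 2) *
      (2 * C ^ 2 + 2 * W.bHat j₂ (D 1) x ^ 2) :=
      ((BddMeasurable.const _).add ((hbp.pow 2).const_mul 2)).mul
        ((BddMeasurable.const _).add ((hbb.pow 2).const_mul 2))
    rw [← integral_comp_fst hP.map_fst hb.measurable]
    refine integral_mono_ae (W.memLp_resid hP j₁ j₂ _ _).integrable_sq
      ((hb.comp measurable_fst).integrable _) ?_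
    filter_upwards [hP.abs_A, hP.abs_Y] with o h2 h3
    have h4 : ∀ a s : ℝ, |a| ≤ C → (a - s) ^ 2 ≤ 2 * C ^ 2 + 2 * s ^ 2 := fun a s ha => by
      have := pow_le_pow_left₀ (abs_nonneg _) ha 2
      rw [sq_abs] at this
      nlinarith [sq_nonneg (a + s)]
    rw [mul_pow]
    exact mul_le_mul (h4 _ _ h2) (h4 _ _ h3) (sq_nonneg _) (by positivity)
  · rw [← ENNReal.ofReal_add (by positivity) (by positivity),
      ← ENNReal.ofReal_add (by positivity) (by positivity)]
    congr 1
    ring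

end risk

end CDVBasis

/-! ### A law with prescribed regression functions and non-degenerate noise -/

section signLaw

variable {d : ℕ} {p b w s t : (Fin d → ℝ) → ℝ} {δ : ℝ}

/-- The law of two independent fair coins. -/
noncomputable def coinLaw : Measure (Bool × Bool) :=
  (PMF.uniformOfFintype (Bool × Bool)).toMeasure

instance : IsProbabilityMeasure coinLaw := by unfold coinLaw; infer_instance

lemma integral_coinLaw (f : Bool × Bool → ℝ) :
    ∫ ε, f ε ∂coinLaw = (f (true, true) + f (true, false) + f (false, true) +
      f (false, false)) / 4 := by
  have h : ∀ ε, coinLaw.real {ε} = 1 / 4 := fun ε => by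
    rw [measureReal_def, coinLaw, PMF.toMeasure_apply_singleton _ _ (measurableSet_singleton _)]
    norm_num [PMF.uniformOfFintype_apply]
  rw [integral_fintype Integrable.of_finite]
  simp only [h, smul_eq_mul, Fintype.sum_prod_type, Fintype.sum_bool]
  ring

/-- `δ` with the sign shown by a coin. -/
def coinSign (δ : ℝ) (ε : Bool) : ℝ := cond ε δ (-δ)

lemma coinSign_eq_or (δ : ℝ) (ε : Bool) : coinSign δ ε = δ ∨ coinSign δ ε = -δ := by
  cases ε <;> simp [coinSign]

/-- The observation `(x, p(x) ± δ, b(x) ± δ)`. -/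
def signObs (p b : (Fin d → ℝ) → ℝ) (δ : ℝ) (z : (Fin d → ℝ) × (Bool × Bool)) : Obs d :=
  (z.1, p z.1 + coinSign δ z.2.1, b z.1 + coinSign δ z.2.2)

/-- The law of `(X, p(X) ± δ, b(X) ± δ)` with `X` uniform and independent random signs. -/
noncomputable def signLaw (p b : (Fin d → ℝ) → ℝ) (δ : ℝ) : Measure (Obs d) :=
  ((volume.restrict (cube d)).prod coinLaw).map (signObs p b δ)

lemma bddMeasurable_coinSign (i : Bool × Bool → Bool) :
    BddMeasurable fun z : (Fin d → ℝ) × (Bool × Bool) => coinSign δ (i z.2) := by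
  refine ⟨(measurable_of_finite fun ε => coinSign δ (i ε)).comp measurable_snd, |δ|, fun z => ?_⟩
  rcases coinSign_eq_or δ (i z.2) with h | h <;> simp [h]

lemma bddMeasurable_signObs_A (hp : BddMeasurable p) :
    BddMeasurable fun z => (signObs p b δ z).2.1 :=
  (hp.comp measurable_fst).add (bddMeasurable_coinSign _)

lemma bddMeasurable_signObs_Y (hb : BddMeasurable b) :
    BddMeasurable fun z => (signObs p b δ z).2.2 :=
  (hb.comp measurable_fst).add (bddMeasurable_coinSign _)

lemma measurable_signObs (hp : BddMeasurable p) (hb : BddMeasurable b) :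
    Measurable (signObs p b δ) :=
  measurable_fst.prodMk
    ((bddMeasurable_signObs_A (b := b) hp).measurable.prodMk
      (bddMeasurable_signObs_Y (p := p) hb).measurable)

lemma isProbabilityMeasure_signLaw (hp : BddMeasurable p) (hb : BddMeasurable b) :
    IsProbabilityMeasure (signLaw p b δ) :=
  Measure.isProbabilityMeasure_map (measurable_signObs hp hb).aemeasurable

lemma map_fst_signLaw (hp : BddMeasurable p) (hb : BddMeasurable b) :
    (signLaw p b δ).map (fun o : Obs d => o.1) = volume.restrict (cube d) := by
  rw [signLaw, Measure.map_map measurable_fst (measurable_signObs hp hb)]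
  refine Measure.map_fst_prod.trans ?_
  rw [measure_univ, one_smul]

lemma integral_signLaw (hp : BddMeasurable p) (hb : BddMeasurable b) {F : Obs d → ℝ}
    (hF : Measurable F) (hFb : BddMeasurable fun z => F (signObs p b δ z)) :
    ∫ o, F o ∂(signLaw p b δ) = ∫ x in cube d,
      (F (x, p x + δ, b x + δ) + F (x, p x + δ, b x - δ) + F (x, p x - δ, b x + δ) +
        F (x, p x - δ, b x - δ)) / 4 := by
  rw [signLaw, integral_map (measurable_signObs hp hb).aemeasurable hF.aestronglyMeasurable,
    integral_prod _ (hFb.integrable _)]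
  simp only [integral_coinLaw]
  rfl

/-- The second moments of a law under which, given `X`, the variables `A` and `Y` are independent
with means `p`, `b` and variance `δ²`. -/
structure HasNoise (P : Measure (Obs d)) (p b : (Fin d → ℝ) → ℝ) (δ : ℝ) : Prop where
  integral_mul : ∫ o : Obs d, o.2.1 * o.2.2 ∂P = ∫ x in cube d, p x * b x
  integral_sq_A : ∀ w, BddMeasurable w →
    ∫ o : Obs d, (o.2.1 * w o.1) ^ 2 ∂P = ∫ x in cube d, (p x ^ 2 + δ ^ 2) * w x ^ 2
  integral_sq_Y : ∀ w, BddMeasurable w →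
    ∫ o : Obs d, (o.2.2 * w o.1) ^ 2 ∂P = ∫ x in cube d, (b x ^ 2 + δ ^ 2) * w x ^ 2
  integral_sq_resid : ∀ s t, BddMeasurable s → BddMeasurable t →
    ∫ o : Obs d, ((o.2.1 - s o.1) * (o.2.2 - t o.1)) ^ 2 ∂P =
      ∫ x in cube d, ((p x - s x) ^ 2 + δ ^ 2) * ((b x - t x) ^ 2 + δ ^ 2)

lemma hasNoise_signLaw (hp : BddMeasurable p) (hb : BddMeasurable b) :
    HasNoise (signLaw p b δ) p b δ := by
  refine ⟨?_, fun w hw => ?_, fun w hw => ?_, fun s t hs ht => ?_⟩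
  · rw [integral_signLaw hp hb (by fun_prop)
      ((bddMeasurable_signObs_A hp).mul (bddMeasurable_signObs_Y hb))]
    exact integral_congr_ae (Eventually.of_forall fun x => by ring)
  · have hm := hw.measurable
    rw [integral_signLaw hp hb (by fun_prop)
      (((bddMeasurable_signObs_A hp).mul (hw.comp measurable_fst)).pow 2)]
    exact integral_congr_ae (Eventually.of_forall fun x => by ring)
  · have hm := hw.measurable
    rw [integral_signLaw hp hb (by fun_prop)
      (((bddMeasurable_signObs_Y hb).mul (hw.comp measurable_fst)).pow 2)]
    exact integral_congr_ae (Eventually.of_forall fun x => by ring)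
  · have hm := hs.measurable
    have hm' := ht.measurable
    rw [integral_signLaw hp hb (by fun_prop)
      ((((bddMeasurable_signObs_A hp).sub (hs.comp measurable_fst)).mul
        ((bddMeasurable_signObs_Y hb).sub (ht.comp measurable_fst))).pow 2)]
    exact integral_congr_ae (Eventually.of_forall fun x => by ring)

/-- To identify a conditional expectation given `X`, it is enough to test against indicators of
events in `X`. -/
lemma condExp_signLaw (hp : BddMeasurable p) (hb : BddMeasurable b) {Z : Obs d → ℝ}
    (hZ : Measurable Z) (hZb : BddMeasurable fun z => Z (signObs p b δ z))
    {r : (Fin d → ℝ) → ℝ} (hr : BddMeasurable r)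
    (hZr : ∀ x, (Z (x, p x + δ, b x + δ) + Z (x, p x + δ, b x - δ) + Z (x, p x - δ, b x + δ) +
        Z (x, p x - δ, b x - δ)) / 4 = r x) :
    (signLaw p b δ)[Z | sigmaX d] =ᵐ[signLaw p b δ] fun o => r o.1 := by
  have := isProbabilityMeasure_signLaw (δ := δ) hp hb
  have hZi : Integrable Z (signLaw p b δ) := by
    rw [signLaw, integrable_map_measure hZ.aestronglyMeasurable
      (measurable_signObs hp hb).aemeasurable]
    exact hZb.integrable _
  have hri : Integrable (fun o : Obs d => r o.1) (signLaw p b δ) :=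
    (hr.comp measurable_fst).integrable _
  refine (ae_eq_condExp_of_forall_setIntegral_eq (sigmaX_le d) hZi (fun s _ _ => hri.integrableOn)
    ?_ ?_).symm
  · rintro _ ⟨t, ht, rfl⟩ -
    have hmt : MeasurableSet ((fun o : Obs d => o.1) ⁻¹' t) := measurable_fst ht
    have hi : BddMeasurable (t.indicator fun _ => (1 : ℝ)) :=
      ⟨measurable_const.indicator ht, 1, fun x => by
        by_cases hx : x ∈ t <;> simp [hx]⟩
    have hmul : ∀ f : Obs d → ℝ, ((fun o : Obs d => o.1) ⁻¹' t).indicator f =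
        fun o => f o * t.indicator (fun _ => (1 : ℝ)) o.1 := fun f => by
      funext o
      by_cases ho : o.1 ∈ t <;> simp [ho]
    rw [← integral_indicator hmt, ← integral_indicator hmt, hmul, hmul]
    have hm := hi.measurable
    rw [integral_signLaw hp hb (F := fun o => Z o * t.indicator (fun _ => (1 : ℝ)) o.1)
      (hZ.mul (hm.comp measurable_fst)) (hZb.mul (hi.comp measurable_fst)), integral_comp_fst (map_fst_signLaw hp hb)
        (w := fun x => r x * t.indicator (fun _ => (1 : ℝ)) x) (hr.measurable.mul hm)]
    refine integral_congr_ae (Eventually.of_forall fun x => ?_)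
    simp only [← hZr x]
    ring
  · exact (hr.measurable.comp (comap_measurable _)).aestronglyMeasurable

lemma condA_signLaw (hp : BddMeasurable p) (hb : BddMeasurable b) :
    condA (signLaw p b δ) =ᵐ[signLaw p b δ] fun o => p o.1 :=
  condExp_signLaw hp hb (by fun_prop) (bddMeasurable_signObs_A hp) hp fun x => by ring

lemma condY_signLaw (hp : BddMeasurable p) (hb : BddMeasurable b) :
    condY (signLaw p b δ) =ᵐ[signLaw p b δ] fun o => b o.1 :=
  condExp_signLaw hp hb (by fun_prop) (bddMeasurable_signObs_Y hb) hb fun x => by ring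

variable {S : ℕ} {W : CDVBasis S} {α β M C₁ C₂ : ℝ}

lemma ae_mem_Icc_signLaw (hδ : 0 ≤ δ) (hpm : BddMeasurable p) (hbm : BddMeasurable b)
    (hp : ∀ x ∈ cube d, C₁ + δ ≤ p x ∧ p x ≤ C₂ - δ)
    (hb : ∀ x ∈ cube d, C₁ + δ ≤ b x ∧ b x ≤ C₂ - δ) :
    ∀ᵐ o ∂(signLaw p b δ), o.2.1 ∈ Set.Icc C₁ C₂ ∧ o.2.2 ∈ Set.Icc C₁ C₂ := by
  have hm : MeasurableSet {o : Obs d | o.2.1 ∈ Set.Icc C₁ C₂ ∧ o.2.2 ∈ Set.Icc C₁ C₂} :=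
    (measurableSet_Icc.preimage (by fun_prop : Measurable fun o : Obs d => o.2.1)).inter
      (measurableSet_Icc.preimage (by fun_prop : Measurable fun o : Obs d => o.2.2))
  rw [signLaw, ae_map_iff (measurable_signObs hpm hbm).aemeasurable hm]
  have h1 : ∀ᵐ z ∂((volume.restrict (cube d)).prod coinLaw), z.1 ∈ cube d :=
    Measure.quasiMeasurePreserving_fst.ae (ae_restrict_mem (measurableSet_cube d))
  filter_upwards [h1] with z hz
  have hp' := hp _ hz
  have hb' := hb _ hz
  simp only [signObs, Set.mem_Icc]
  rcases coinSign_eq_or δ z.2.1 with h2 | h2 <;> rcases coinSign_eq_or δ z.2.2 with h3 | h3 <;>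
    rw [h2, h3] <;> refine ⟨⟨?_, ?_⟩, ?_, ?_⟩ <;> linarith

lemma signLaw_mem_Model (hδ : 0 ≤ δ) (hpm : BddMeasurable p) (hbm : BddMeasurable b)
    (hpH : p ∈ W.Holder d α M) (hbH : b ∈ W.Holder d β M)
    (hp : ∀ x ∈ cube d, C₁ + δ ≤ p x ∧ p x ≤ C₂ - δ)
    (hb : ∀ x ∈ cube d, C₁ + δ ≤ b x ∧ b x ≤ C₂ - δ) :
    signLaw p b δ ∈ Model W d α β M C₁ C₂ :=
  ⟨isProbabilityMeasure_signLaw hpm hbm, map_fst_signLaw hpm hbm,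
    ae_mem_Icc_signLaw hδ hpm hbm hp hb, ⟨p, hpH, condA_signLaw hpm hbm⟩,
    ⟨b, hbH, condY_signLaw hpm hbm⟩⟩

lemma isRegression_signLaw (hδ : 0 ≤ δ) (hpm : BddMeasurable p) (hbm : BddMeasurable b)
    (hp : ∀ x ∈ cube d, C₁ + δ ≤ p x ∧ p x ≤ C₂ - δ)
    (hb : ∀ x ∈ cube d, C₁ + δ ≤ b x ∧ b x ≤ C₂ - δ) :
    IsRegression (signLaw p b δ) p b (max |C₁| |C₂|) := by
  have := isProbabilityMeasure_signLaw (δ := δ) hpm hbm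
  have h := ae_mem_Icc_signLaw hδ hpm hbm hp hb
  exact isRegression_of_condExp (map_fst_signLaw hpm hbm)
    (h.mono fun o ho => abs_le_max_abs_abs ho.1.1 ho.1.2)
    (h.mono fun o ho => abs_le_max_abs_abs ho.2.1 ho.2.2) hpm hbm (condA_signLaw hpm hbm)
    (condY_signLaw hpm hbm)

end signLaw

/-! ### Lower bounds on the mean squared errors -/

/-- Jensen's inequality on the cube. -/
lemma sq_integral_cube_le {d : ℕ} {f : (Fin d → ℝ) → ℝ} (hf : BddMeasurable f) :
    (∫ x in cube d, f x) ^ 2 ≤ ∫ x in cube d, f x ^ 2 := by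
  obtain ⟨B, hB⟩ := hf.2
  exact sq_integral_le (memLp_two_of_ae_bound hf.measurable (Eventually.of_forall hB))

/-- If `Z` has conditional variance `δ²` given `X`, weighted averages of `Z` fluctuate at least as
much as their conditional variance given the design. -/
lemma HasRegression.le_lintegral_sq_add_avg {d n : ℕ} {P : Measure (Obs d)}
    [IsProbabilityMeasure P] {Z : Obs d → ℝ} {r w : (Fin d → ℝ) → ℝ} {C δ : ℝ}
    (h : HasRegression P Z r C) (hr : BddMeasurable r)
    (hsq : ∀ w, BddMeasurable w →
      ∫ o, (Z o * w o.1) ^ 2 ∂P = ∫ x in cube d, (r x ^ 2 + δ ^ 2) * w x ^ 2)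
    (hn : 1 ≤ n) (hw : BddMeasurable w) (c : ℝ) :
    ENNReal.ofReal (δ ^ 2 / n * ∫ x in cube d, w x ^ 2) ≤
      ∫⁻ D, ENNReal.ofReal ((c - avg (fun o => Z o * w o.1) D) ^ 2)
        ∂(Measure.pi fun _ : Fin n => P) := by
  simp only [sub_avg_eq]
  refine le_trans (ENNReal.ofReal_le_ofReal ?_)
    (variance_le_lintegral_sq_add_avg hn (h.memLp hw) c)
  have h1 := sq_integral_cube_le (hr.mul hw)
  have h2 : ∫ x in cube d, (r x ^ 2 + δ ^ 2) * w x ^ 2 =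
      (∫ x in cube d, (r x * w x) ^ 2) + δ ^ 2 * ∫ x in cube d, w x ^ 2 := by
    rw [← integral_const_mul, ← integral_add (((hr.mul hw).pow 2).integrable _)
      (((hw.pow 2).const_mul _).integrable _)]
    exact integral_congr_ae (Eventually.of_forall fun x => by ring)
  simp only [neg_sq]
  rw [integral_neg, neg_sq, h.integral_mul w hw, hsq w hw, h2, one_div_mul_eq_div,
    div_mul_eq_mul_div]
  exact div_le_div_of_nonneg_right (by linarith) (by positivity)

namespace CDVBasis

variable {S : ℕ} (W : CDVBasis S) {d n : ℕ} {P : Measure (Obs d)} {p b : (Fin d → ℝ) → ℝ}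
  {C δ : ℝ}

lemma ofReal_mul_integral_sq {c : ℝ} (hc : 0 ≤ c) {f : (Fin d → ℝ) → ℝ} (hf : BddMeasurable f) :
    ENNReal.ofReal (c * ∫ x in cube d, f x ^ 2) =
      ENNReal.ofReal c * ∫⁻ x in cube d, ENNReal.ofReal (f x ^ 2) := by
  rw [ENNReal.ofReal_mul hc, ofReal_integral_eq_lintegral_ofReal ((hf.pow 2).integrable _)
    (Eventually.of_forall fun x => sq_nonneg _)]

lemma _root_.IsRegression.psi_eq_zero (hP : IsRegression P p b C) (hN : HasNoise P p b δ) :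
    psiFunctional P = 0 := by
  rw [hP.psi_eq, hN.integral_mul, sub_self]

/-- The variance of a residual product is at least the integrated squared errors of the fits times
the noise level, plus the product of the noise levels. -/
lemma le_variance_resid (hP : IsRegression P p b C) (hN : HasNoise P p b δ) (j₁ j₂ : ℕ)
    (D₀ D₁ : Fin n → Obs d) :
    δ ^ 2 * (∫ x in cube d, (p x - W.pHat j₁ D₀ x) ^ 2) +
      δ ^ 2 * (∫ x in cube d, (b x - W.bHat j₂ D₁ x) ^ 2) + δ ^ 4 ≤
    ∫ o : Obs d, ((o.2.1 - W.pHat j₁ D₀ o.1) * (o.2.2 - W.bHat j₂ D₁ o.1)) ^ 2 ∂P -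
      (∫ o : Obs d, (o.2.1 - W.pHat j₁ D₀ o.1) * (o.2.2 - W.bHat j₂ D₁ o.1) ∂P) ^ 2 := by
  have hs := hP.bdd_p.sub (W.bddMeasurable_pHat j₁ D₀)
  have ht := hP.bdd_b.sub (W.bddMeasurable_bHat j₂ D₁)
  rw [W.integral_resid hP, hP.psi_eq_zero hN, zero_add, prodErr,
    hN.integral_sq_resid _ _ (W.bddMeasurable_pHat j₁ D₀) (W.bddMeasurable_bHat j₂ D₁)]
  have h1 := sq_integral_cube_le (hs.mul ht)
  have h2 : ∫ x in cube d, ((p x - W.pHat j₁ D₀ x) ^ 2 + δ ^ 2) *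
      ((b x - W.bHat j₂ D₁ x) ^ 2 + δ ^ 2) =
      ∫ x in cube d, (((p x - W.pHat j₁ D₀ x) * (b x - W.bHat j₂ D₁ x)) ^ 2 +
        δ ^ 2 * (p x - W.pHat j₁ D₀ x) ^ 2 + δ ^ 2 * (b x - W.bHat j₂ D₁ x) ^ 2 + δ ^ 4) :=
    integral_congr_ae (Eventually.of_forall fun x => by ring)
  have i1 := (hs.mul ht).pow 2
  have i2 := (hs.pow 2).const_mul (δ ^ 2)
  have i3 := (ht.pow 2).const_mul (δ ^ 2)
  rw [h2, integral_add (((i1.add i2).add i3).integrable _) (integrable_const _),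
    integral_add ((i1.add i2).integrable _) (i3.integrable _),
    integral_add (i1.integrable _) (i2.integrable _), integral_const_mul, integral_const_mul]
  simp only [integral_const, smul_eq_mul, probReal_univ, one_mul]
  linarith

/-- The integrated squared error of a kernel average is at least of order `k/n`. -/
lemma resolution_le_lintegral_kernelAvg [IsProbabilityMeasure P] {Z : Obs d → ℝ}
    {r : (Fin d → ℝ) → ℝ} (h : HasRegression P Z r C) (hr : BddMeasurable r)
    (hsq : ∀ w, BddMeasurable w →
      ∫ o, (Z o * w o.1) ^ 2 ∂P = ∫ x in cube d, (r x ^ 2 + δ ^ 2) * w x ^ 2)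
    (hn : 1 ≤ n) {j : ℕ} (hj : W.J0 ≤ j) :
    ENNReal.ofReal (δ ^ 2 / n * resolution d j) ≤
      ∫⁻ E, (∫⁻ x in cube d, ENNReal.ofReal
        ((r x - avg (fun o => Z o * W.kernel d j o.1 x) E) ^ 2))
          ∂(Measure.pi fun _ : Fin n => P) := by
  have hk := W.bddMeasurable_kernel d j
  rw [lintegral_lintegral_swap]
  swap
  · refine Measurable.aemeasurable (Measurable.ennreal_ofReal (Measurable.pow_const ?_ 2))
    refine (hr.measurable.comp measurable_snd).sub ?_
    exact measurable_avg (F := fun (z : (Fin n → Obs d) × (Fin d → ℝ)) (o : Obs d) =>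
      Z o * W.kernel d j o.1 z.2)
      ((h.measurable.comp measurable_snd).mul (hk.measurable.comp
        (f := fun z : ((Fin n → Obs d) × (Fin d → ℝ)) × Obs d => (z.2.1, z.1.2)) (by fun_prop)))
      measurable_fst
  refine le_trans (le_of_eq ?_) (lintegral_mono fun x =>
    h.le_lintegral_sq_add_avg hr hsq hn (hk.section_right x) (r x))
  simp only [W.kernel_comm j _ _, W.integral_kernel_sq hj]
  have hd : BddMeasurable fun x => W.kernel d j x x :=
    hk.comp (u := fun x => (x, x)) (by fun_prop)
  rw [← ofReal_integral_eq_lintegral_ofReal ((hd.const_mul _).integrable _)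
    (Eventually.of_forall fun x => mul_nonneg (by positivity) (W.kernel_self_nonneg j x)),
    integral_const_mul, W.integral_kernel_self hj]

lemma variance_le_mse_estIF (hP : IsRegression P p b C) (hN : HasNoise P p b δ) (hn : 1 ≤ n)
    (j₁ j₂ : ℕ) :
    ∫⁻ D : Sample d n, ENNReal.ofReal (1 / (n : ℝ) *
      (δ ^ 2 * (∫ x in cube d, (p x - W.pHat j₁ (D 0) x) ^ 2) +
      δ ^ 2 * (∫ x in cube d, (b x - W.bHat j₂ (D 1) x) ^ 2) + δ ^ 4)) ∂(sampleLaw P n) ≤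
      mse P (W.estIF d n j₁ j₂) := by
  have := hP.prob
  rw [mse, lintegral_sampleLaw_update 2 (measurable_sq_sub (W.measurable_estIF j₁ j₂) _)]
  refine lintegral_mono fun D => ?_
  simp only [W.estIF_update]
  refine le_trans (ENNReal.ofReal_le_ofReal ?_)
    (variance_le_lintegral_sq_add_avg hn (W.memLp_resid hP j₁ j₂ _ _) _)
  exact mul_le_mul_of_nonneg_left (W.le_variance_resid hP hN j₁ j₂ _ _) (by positivity)

lemma inv_le_mse_estIF (hP : IsRegression P p b C) (hN : HasNoise P p b δ) (hn : 1 ≤ n)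
    (j₁ j₂ : ℕ) : ENNReal.ofReal (δ ^ 4 * (1 / n)) ≤ mse P (W.estIF d n j₁ j₂) := by
  have := hP.prob
  refine le_trans ?_ (W.variance_le_mse_estIF hP hN hn j₁ j₂)
  refine le_trans (b := ∫⁻ _ : Sample d n, ENNReal.ofReal (δ ^ 4 * (1 / n)) ∂(sampleLaw P n))
    (by simp) (lintegral_mono fun D => ENNReal.ofReal_le_ofReal ?_)
  rw [mul_comm]
  refine mul_le_mul_of_nonneg_left ?_ (by positivity)
  have h1 : 0 ≤ δ ^ 2 * ∫ x in cube d, (p x - W.pHat j₁ (D 0) x) ^ 2 :=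
    mul_nonneg (by positivity) (integral_nonneg fun _ => sq_nonneg _)
  have h2 : 0 ≤ δ ^ 2 * ∫ x in cube d, (b x - W.bHat j₂ (D 1) x) ^ 2 :=
    mul_nonneg (by positivity) (integral_nonneg fun _ => sq_nonneg _)
  linarith

/-- The error of the fit `p̂` is multiplied by the noise of `Y`. -/
lemma resolution_left_le_mse_estIF (hP : IsRegression P p b C) (hN : HasNoise P p b δ)
    (hn : 1 ≤ n) {j₁ : ℕ} (j₂ : ℕ) (hj₁ : W.J0 ≤ j₁) :
    ENNReal.ofReal (δ ^ 4 * (resolution d j₁ / n ^ 2)) ≤ mse P (W.estIF d n j₁ j₂) := by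
  have := hP.prob
  refine le_trans ?_ (W.variance_le_mse_estIF hP hN hn j₁ j₂)
  have h1 : ∀ D : Sample d n, ENNReal.ofReal (1 / (n : ℝ) * δ ^ 2) *
      (∫⁻ x in cube d, ENNReal.ofReal ((p x - W.pHat j₁ (D 0) x) ^ 2)) ≤
      ENNReal.ofReal (1 / (n : ℝ) * (δ ^ 2 * (∫ x in cube d, (p x - W.pHat j₁ (D 0) x) ^ 2) +
        δ ^ 2 * (∫ x in cube d, (b x - W.bHat j₂ (D 1) x) ^ 2) + δ ^ 4)) := fun D => by
    rw [← ofReal_mul_integral_sq (by positivity)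
      (hP.bdd_p.sub (W.bddMeasurable_pHat j₁ (D 0))), mul_assoc]
    refine ENNReal.ofReal_le_ofReal (mul_le_mul_of_nonneg_left ?_ (by positivity))
    have h2 : 0 ≤ δ ^ 2 * ∫ x in cube d, (b x - W.bHat j₂ (D 1) x) ^ 2 :=
      mul_nonneg (by positivity) (integral_nonneg fun _ => sq_nonneg _)
    have h3 : 0 ≤ δ ^ 4 := by positivity
    linarith
  refine le_trans ?_ (lintegral_mono h1)
  have hm : Measurable fun E : Fin n → Obs d =>
      ∫⁻ x in cube d, ENNReal.ofReal ((p x - W.pHat j₁ E x) ^ 2) :=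
    Measurable.lintegral_prod_right' (f := fun z : (Fin n → Obs d) × (Fin d → ℝ) =>
      ENNReal.ofReal ((p z.2 - W.pHat j₁ z.1 z.2) ^ 2))
      (((hP.bdd_p.measurable.comp measurable_snd).sub
        (W.measurable_pHat j₁)).pow_const 2).ennreal_ofReal
  rw [lintegral_const_mul' _ _ ENNReal.ofReal_ne_top, lintegral_sampleLaw_eval 0 hm]
  refine le_trans (le_of_eq ?_) (mul_le_mul_right
    (W.resolution_le_lintegral_kernelAvg hP.hasA hP.bdd_p hN.integral_sq_A hn hj₁) _)
  rw [← ENNReal.ofReal_mul (by positivity)]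
  congr 1
  ring

/-- The error of the fit `b̂` is multiplied by the noise of `A`. -/
lemma resolution_right_le_mse_estIF (hP : IsRegression P p b C) (hN : HasNoise P p b δ)
    (hn : 1 ≤ n) (j₁ : ℕ) {j₂ : ℕ} (hj₂ : W.J0 ≤ j₂) :
    ENNReal.ofReal (δ ^ 4 * (resolution d j₂ / n ^ 2)) ≤ mse P (W.estIF d n j₁ j₂) := by
  have := hP.prob
  refine le_trans ?_ (W.variance_le_mse_estIF hP hN hn j₁ j₂)
  have h1 : ∀ D : Sample d n, ENNReal.ofReal (1 / (n : ℝ) * δ ^ 2) *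
      (∫⁻ x in cube d, ENNReal.ofReal ((b x - W.bHat j₂ (D 1) x) ^ 2)) ≤
      ENNReal.ofReal (1 / (n : ℝ) * (δ ^ 2 * (∫ x in cube d, (p x - W.pHat j₁ (D 0) x) ^ 2) +
        δ ^ 2 * (∫ x in cube d, (b x - W.bHat j₂ (D 1) x) ^ 2) + δ ^ 4)) := fun D => by
    rw [← ofReal_mul_integral_sq (by positivity)
      (hP.bdd_b.sub (W.bddMeasurable_bHat j₂ (D 1))), mul_assoc]
    refine ENNReal.ofReal_le_ofReal (mul_le_mul_of_nonneg_left ?_ (by positivity))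
    have h2 : 0 ≤ δ ^ 2 * ∫ x in cube d, (p x - W.pHat j₁ (D 0) x) ^ 2 :=
      mul_nonneg (by positivity) (integral_nonneg fun _ => sq_nonneg _)
    have h3 : 0 ≤ δ ^ 4 := by positivity
    linarith
  refine le_trans ?_ (lintegral_mono h1)
  have hm : Measurable fun E : Fin n → Obs d =>
      ∫⁻ x in cube d, ENNReal.ofReal ((b x - W.bHat j₂ E x) ^ 2) :=
    Measurable.lintegral_prod_right' (f := fun z : (Fin n → Obs d) × (Fin d → ℝ) =>
      ENNReal.ofReal ((b z.2 - W.bHat j₂ z.1 z.2) ^ 2))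
      (((hP.bdd_b.measurable.comp measurable_snd).sub
        (W.measurable_bHat j₂)).pow_const 2).ennreal_ofReal
  rw [lintegral_const_mul' _ _ ENNReal.ofReal_ne_top, lintegral_sampleLaw_eval 1 hm]
  refine le_trans (le_of_eq ?_) (mul_le_mul_right
    (W.resolution_le_lintegral_kernelAvg hP.hasY hP.bdd_b hN.integral_sq_Y hn hj₂) _)
  rw [← ENNReal.ofReal_mul (by positivity)]
  congr 1
  ring

lemma inv_le_mse_estINT (hP : IsRegression P p b C) (hN : HasNoise P p b δ) (hn : 1 ≤ n)
    (j₁ j₂ : ℕ) : ENNReal.ofReal (δ ^ 4 * (1 / n)) ≤ mse P (W.estINT d n j₁ j₂) := by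
  have := hP.prob
  rw [mse, lintegral_sampleLaw_update 2 (measurable_sq_sub (W.measurable_estINT j₁ j₂) _)]
  refine le_trans (b := ∫⁻ _ : Sample d n, ENNReal.ofReal (δ ^ 4 * (1 / n)) ∂(sampleLaw P n))
    (by simp) (lintegral_mono fun D => ?_)
  have e : ∀ E, W.estINT d n j₁ j₂ (Function.update D 2 E) - psiFunctional P =
      (-psiFunctional P - W.prodErr j₁ j₂ (fun _ => 0) (fun _ => 0) (D 0) (D 1)) +
        avg (fun o : Obs d => o.2.1 * o.2.2) E := fun E => by
    rw [W.estINT_eq]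
    simp only [Function.update_self, Function.update_of_ne (show (0 : Fin 4) ≠ 2 by decide),
      Function.update_of_ne (show (1 : Fin 4) ≠ 2 by decide)]
    ring
  simp only [e]
  refine le_trans (ENNReal.ofReal_le_ofReal ?_)
    (variance_le_lintegral_sq_add_avg hn (memLp_mul hP) _)
  rw [mul_comm]
  refine mul_le_mul_of_nonneg_left ?_ (by positivity)
  have h1 := sq_integral_cube_le (hP.bdd_p.mul hP.bdd_b)
  have h2 : ∫ o : Obs d, (o.2.1 * o.2.2) ^ 2 ∂P =
      ∫ x in cube d, (p x ^ 2 + δ ^ 2) * (b x ^ 2 + δ ^ 2) := by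
    simpa only [sub_zero] using hN.integral_sq_resid (fun _ => 0) (fun _ => 0)
      (BddMeasurable.const 0) (BddMeasurable.const 0)
  have i1 := (hP.bdd_p.mul hP.bdd_b).pow 2
  have h3 : ∫ x in cube d, ((p x * b x) ^ 2 + δ ^ 4) ≤
      ∫ x in cube d, (p x ^ 2 + δ ^ 2) * (b x ^ 2 + δ ^ 2) := by
    refine integral_mono ((i1.add (BddMeasurable.const _)).integrable _)
      ((((hP.bdd_p.pow 2).add (BddMeasurable.const _)).mul
        ((hP.bdd_b.pow 2).add (BddMeasurable.const _))).integrable _) fun x => ?_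
    simp only
    nlinarith [sq_nonneg (p x * δ), sq_nonneg (b x * δ)]
  rw [integral_add (i1.integrable _) (integrable_const _)] at h3
  simp only [integral_const, smul_eq_mul, probReal_univ, one_mul] at h3
  rw [h2, hN.integral_mul]
  linarith

/-- The variance of the quadratic part `∫ p̂ b̂` of the plug-in estimator. -/
lemma min_resolution_le_mse_estINT (hP : IsRegression P p b C) (hN : HasNoise P p b δ)
    (hn : 1 ≤ n) {j₁ j₂ : ℕ} (hj₁ : W.J0 ≤ j₁) (hj₂ : W.J0 ≤ j₂) :
    ENNReal.ofReal (δ ^ 4 * (min (resolution d j₁) (resolution d j₂) / n ^ 2)) ≤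
      mse P (W.estINT d n j₁ j₂) := by
  have := hP.prob
  have hkc := W.bddMeasurable_kernelComp (d := d) j₂ j₁
  rw [mse, lintegral_sampleLaw_update 1 (measurable_sq_sub (W.measurable_estINT j₁ j₂) _)]
  have h1 : ∀ D : Sample d n, ENNReal.ofReal (δ ^ 2 / n) * (∫⁻ x in cube d, ENNReal.ofReal
      ((0 - avg (fun o => o.2.1 * W.kernelComp d j₂ j₁ x o.1) (D 0)) ^ 2)) ≤
      ∫⁻ E, ENNReal.ofReal ((W.estINT d n j₁ j₂ (Function.update D 1 E) - psiFunctional P) ^ 2)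
        ∂(Measure.pi fun _ : Fin n => P) := fun D => by
    have hw := W.bddMeasurable_proj j₂ (W.bddMeasurable_pHat j₁ (D 0))
    have e : ∀ E, W.estINT d n j₁ j₂ (Function.update D 1 E) - psiFunctional P =
        (avg (fun o : Obs d => o.2.1 * o.2.2) (D 2) - psiFunctional P) -
          avg (fun o => o.2.2 * W.proj d j₂ (W.pHat j₁ (D 0)) o.1) E := fun E => by
      rw [← W.integral_mul_bHat j₂ E (W.bddMeasurable_pHat j₁ (D 0)), estINT]
      simp only [Function.update_self, Function.update_of_ne (show (0 : Fin 4) ≠ 1 by decide),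
        Function.update_of_ne (show (2 : Fin 4) ≠ 1 by decide), avg]
      ring
    simp only [e, zero_sub, neg_sq, ← W.proj_pHat]
    rw [← ofReal_mul_integral_sq (by positivity) hw]
    exact hP.hasY.le_lintegral_sq_add_avg hP.bdd_b hN.integral_sq_Y hn hw _
  refine le_trans ?_ (lintegral_mono h1)
  have hm : Measurable fun z : (Fin n → Obs d) × (Fin d → ℝ) => ENNReal.ofReal
      ((0 - avg (fun o => o.2.1 * W.kernelComp d j₂ j₁ z.2 o.1) z.1) ^ 2) := by
    refine ((Measurable.const_sub ?_ _).pow_const 2).ennreal_ofReal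
    exact measurable_avg (F := fun (z : (Fin n → Obs d) × (Fin d → ℝ)) (o : Obs d) =>
      o.2.1 * W.kernelComp d j₂ j₁ z.2 o.1)
      (Measurable.mul (by fun_prop) (hkc.measurable.comp
        (f := fun z : ((Fin n → Obs d) × (Fin d → ℝ)) × Obs d => (z.1.2, z.2.1)) (by fun_prop)))
      measurable_fst
  rw [lintegral_const_mul' _ _ ENNReal.ofReal_ne_top,
    lintegral_sampleLaw_eval 0 hm.lintegral_prod_right', lintegral_lintegral_swap hm.aemeasurable]
  refine le_trans (le_of_eq ?_) (mul_le_mul_right (lintegral_mono fun x =>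
    hP.hasA.le_lintegral_sq_add_avg hP.bdd_p hN.integral_sq_A hn (hkc.section_left x) 0) _)
  rw [← ofReal_integral_eq_lintegral_ofReal
    (((BddMeasurable.integral_right (hkc.pow 2) _).const_mul _).integrable _)
    (Eventually.of_forall fun x => mul_nonneg (by positivity)
      (integral_nonneg fun _ => sq_nonneg _)), integral_const_mul,
    W.integral_kernelComp_sq hj₂ hj₁, ← ENNReal.ofReal_mul (by positivity), min_comm]
  congr 1
  ring

/-- The integral of `K₁(x,z)² K₂(y,z)²` is at least of order `k₁ k₂`, since the diagonal of each
kernel is bounded below. -/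
lemma resolution_mul_le_lintegral_kernel_sq (hS : 1 ≤ S) {j₁ j₂ : ℕ} (hj₁ : W.J0 ≤ j₁)
    (hj₂ : W.J0 ≤ j₂) :
    ENNReal.ofReal (resolution d j₁ * resolution d j₂ / W.kernelConst d ^ 2) ≤
      ∫⁻ x in cube d, ∫⁻ y in cube d, ∫⁻ z in cube d,
        ENNReal.ofReal (W.kernel d j₁ x z ^ 2) * ENNReal.ofReal (W.kernel d j₂ y z ^ 2) := by
  have hm : ∀ {Ω : Type} [MeasurableSpace Ω] (j : ℕ) {u v : Ω → Fin d → ℝ}, Measurable u →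
      Measurable v → Measurable fun ω => ENNReal.ofReal (W.kernel d j (u ω) (v ω) ^ 2) :=
    fun j u v hu hv => ((((W.bddMeasurable_kernel d j).measurable.comp
      (hu.prodMk hv)).pow_const 2)).ennreal_ofReal
  have hd : ∀ {j : ℕ}, W.J0 ≤ j → ∀ z, ∫⁻ x in cube d, ENNReal.ofReal (W.kernel d j x z ^ 2) =
      ENNReal.ofReal (W.kernel d j z z) := fun {j} hj z => by
    rw [← ofReal_integral_eq_lintegral_ofReal
      ((((W.bddMeasurable_kernel d j).section_right z).pow 2).integrable _)
      (Eventually.of_forall fun x => sq_nonneg _)]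
    simp only [W.kernel_comm j _ z, W.integral_kernel_sq hj]
  have e1 : ∀ x, ∫⁻ y in cube d, ∫⁻ z in cube d,
      ENNReal.ofReal (W.kernel d j₁ x z ^ 2) * ENNReal.ofReal (W.kernel d j₂ y z ^ 2) =
      ∫⁻ z in cube d, ENNReal.ofReal (W.kernel d j₁ x z ^ 2) *
        ENNReal.ofReal (W.kernel d j₂ z z) := fun x => by
    rw [lintegral_lintegral_swap]
    · refine lintegral_congr fun z => ?_
      rw [lintegral_const_mul _ (hm j₂ (u := fun y => y) measurable_id measurable_const), hd hj₂]
    · exact ((hm j₁ measurable_const measurable_snd).mul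
        (hm j₂ measurable_fst measurable_snd)).aemeasurable
  simp only [e1]
  rw [lintegral_lintegral_swap]
  swap
  · refine ((hm j₁ measurable_fst measurable_snd).mul ?_).aemeasurable
    exact ((W.bddMeasurable_kernel d j₂).measurable.comp
      (measurable_snd.prodMk measurable_snd)).ennreal_ofReal
  refine le_trans (b := ∫⁻ _ in cube d,
    ENNReal.ofReal (resolution d j₁ * resolution d j₂ / W.kernelConst d ^ 2)) (by simp)
    (lintegral_mono_ae ?_)
  filter_upwards [W.resolution_le_kernel_self (d := d) hS hj₁,
    W.resolution_le_kernel_self (d := d) hS hj₂] with z h1 h2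
  have hK := W.kernelConst_pos d
  rw [lintegral_mul_const _ (hm j₁ (u := fun y => y) measurable_id measurable_const), hd hj₁,
    ← ENNReal.ofReal_mul (W.kernel_self_nonneg j₁ z)]
  refine ENNReal.ofReal_le_ofReal ?_
  rw [div_le_iff₀ (by positivity)]
  calc resolution d j₁ * resolution d j₂
      ≤ (W.kernelConst d * W.kernel d j₁ z z) * (W.kernelConst d * W.kernel d j₂ z z) :=
        mul_le_mul h1 h2 (by unfold resolution; positivity)
          (mul_nonneg hK.le (W.kernel_self_nonneg j₁ z))
    _ = _ := by ring

lemma measurable_kernel_comp {Ω : Type*} [MeasurableSpace Ω] (j : ℕ) {u v : Ω → Fin d → ℝ}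
    (hu : Measurable u) (hv : Measurable v) : Measurable fun ω => W.kernel d j (u ω) (v ω) :=
  ((W.bddMeasurable_kernel d j).comp (hu.prodMk hv)).measurable

lemma measurable_sq_avg_kernel_mul_bHat (j₁ j₂ : ℕ) :
    Measurable fun z : Sample d n × (Fin d → ℝ) => ENNReal.ofReal
      (avg (fun o => W.kernel d j₁ z.2 o.1 * W.bHat j₂ (z.1 1) o.1) (z.1 3) ^ 2) := by
  refine (Measurable.pow_const ?_ 2).ennreal_ofReal
  exact measurable_avg (F := fun (z : Sample d n × (Fin d → ℝ)) (o : Obs d) =>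
    W.kernel d j₁ z.2 o.1 * W.bHat j₂ (z.1 1) o.1)
    ((W.measurable_kernel_comp j₁ (by fun_prop) (by fun_prop)).mul
      (W.measurable_bHat_comp j₂ (by fun_prop) (by fun_prop))) (by fun_prop)

/-- The average of `p̂ b̂` over the fourth subsample as a weighted average of the first one. -/
lemma estMC_update_zero (j₁ j₂ : ℕ) (D : Sample d n) (E : Fin n → Obs d) (c : ℝ) :
    W.estMC d n j₁ j₂ (Function.update D 0 E) - c =
      (avg (fun o : Obs d => o.2.1 * o.2.2) (D 2) - c) -
        avg (fun o => o.2.1 *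
          avg (fun o' => W.kernel d j₁ o.1 o'.1 * W.bHat j₂ (D 1) o'.1) (D 3)) E := by
  rw [W.estMC_eq]
  simp only [Function.update_self, Function.update_of_ne (show (1 : Fin 4) ≠ 0 by decide),
    Function.update_of_ne (show (2 : Fin 4) ≠ 0 by decide),
    Function.update_of_ne (show (3 : Fin 4) ≠ 0 by decide)]
  have : avg (fun o : Obs d => W.pHat j₁ E o.1 * W.bHat j₂ (D 1) o.1) (D 3) =
      avg (fun o => o.2.1 *
        avg (fun o' => W.kernel d j₁ o.1 o'.1 * W.bHat j₂ (D 1) o'.1) (D 3)) E := by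
    simp only [avg, pHat, Finset.mul_sum, Finset.sum_mul]
    rw [Finset.sum_comm]
    exact Finset.sum_congr rfl fun i _ => Finset.sum_congr rfl fun i' _ => by ring
  rw [this]
  ring

lemma lintegral_kernel_mul_bHat_le_mse_estMC (hP : IsRegression P p b C)
    (hN : HasNoise P p b δ) (hn : 1 ≤ n) (j₁ j₂ : ℕ) :
    ENNReal.ofReal (δ ^ 2 / n) * (∫⁻ x in cube d, ∫⁻ D : Sample d n, ENNReal.ofReal
      (avg (fun o => W.kernel d j₁ x o.1 * W.bHat j₂ (D 1) o.1) (D 3) ^ 2) ∂(sampleLaw P n)) ≤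
      mse P (W.estMC d n j₁ j₂) := by
  have := hP.prob
  rw [mse, lintegral_sampleLaw_update 0 (measurable_sq_sub (W.measurable_estMC j₁ j₂) _),
    ← lintegral_lintegral_swap (f := fun (D : Sample d n) x => ENNReal.ofReal
      (avg (fun o => W.kernel d j₁ x o.1 * W.bHat j₂ (D 1) o.1) (D 3) ^ 2))
      (W.measurable_sq_avg_kernel_mul_bHat j₁ j₂).aemeasurable,
    ← lintegral_const_mul' _ _ ENNReal.ofReal_ne_top]
  refine lintegral_mono fun D => ?_
  have hw : BddMeasurable fun x =>
      avg (fun o => W.kernel d j₁ x o.1 * W.bHat j₂ (D 1) o.1) (D 3) :=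
    (BddMeasurable.sum fun i _ => ((W.bddMeasurable_kernel d j₁).section_right (D 3 i).1).mul
      (BddMeasurable.const _)).const_mul _
  simp only [W.estMC_update_zero]
  rw [← ofReal_mul_integral_sq (by positivity) hw]
  exact hP.hasA.le_lintegral_sq_add_avg hP.bdd_p hN.integral_sq_A hn hw _

lemma lintegral_kernel_mul_kernel_le (hP : IsRegression P p b C)
    (hN : HasNoise P p b δ) (hn : 1 ≤ n) (j₁ j₂ : ℕ) (x : Fin d → ℝ) :
    ENNReal.ofReal (δ ^ 2 / n) * (∫⁻ y in cube d, ∫⁻ D : Sample d n, ENNReal.ofReal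
      (avg (fun o => W.kernel d j₁ x o.1 * W.kernel d j₂ y o.1) (D 3) ^ 2) ∂(sampleLaw P n)) ≤
      ∫⁻ D : Sample d n, ENNReal.ofReal
        (avg (fun o => W.kernel d j₁ x o.1 * W.bHat j₂ (D 1) o.1) (D 3) ^ 2)
          ∂(sampleLaw P n) := by
  have := hP.prob
  have hm₁ : Measurable fun D : Sample d n => ENNReal.ofReal
      (avg (fun o => W.kernel d j₁ x o.1 * W.bHat j₂ (D 1) o.1) (D 3) ^ 2) :=
    (W.measurable_sq_avg_kernel_mul_bHat j₁ j₂).comp (f := fun D => (D, x)) (by fun_prop)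
  have hm₂ : Measurable fun z : (Fin d → ℝ) × Sample d n => ENNReal.ofReal
      (avg (fun o => W.kernel d j₁ x o.1 * W.kernel d j₂ z.1 o.1) (z.2 3) ^ 2) := by
    refine (Measurable.pow_const ?_ 2).ennreal_ofReal
    exact measurable_avg (F := fun (z : (Fin d → ℝ) × Sample d n) (o : Obs d) =>
      W.kernel d j₁ x o.1 * W.kernel d j₂ z.1 o.1)
      ((W.measurable_kernel_comp j₁ (by fun_prop) (by fun_prop)).mul
        (W.measurable_kernel_comp j₂ (by fun_prop) (by fun_prop))) (by fun_prop)
  rw [lintegral_sampleLaw_update 1 hm₁, lintegral_lintegral_swap hm₂.aemeasurable,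
    ← lintegral_const_mul' _ _ ENNReal.ofReal_ne_top]
  refine lintegral_mono fun D => ?_
  have hv : BddMeasurable fun y =>
      avg (fun o => W.kernel d j₁ x o.1 * W.kernel d j₂ y o.1) (D 3) :=
    (BddMeasurable.sum fun i _ => (BddMeasurable.const _).mul
      ((W.bddMeasurable_kernel d j₂).section_right (D 3 i).1)).const_mul _
  have e : ∀ E, avg (fun o => W.kernel d j₁ x o.1 *
      W.bHat j₂ (Function.update D 1 E 1) o.1) (Function.update D 1 E 3) ^ 2 =
      (0 - avg (fun o => o.2.2 *
        avg (fun o' => W.kernel d j₁ x o'.1 * W.kernel d j₂ o.1 o'.1) (D 3)) E) ^ 2 := fun E => by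
    simp only [Function.update_self, Function.update_of_ne (show (3 : Fin 4) ≠ 1 by decide)]
    rw [zero_sub, neg_sq]
    congr 1
    simp only [avg, bHat, Finset.mul_sum]
    rw [Finset.sum_comm]
    exact Finset.sum_congr rfl fun i _ => Finset.sum_congr rfl fun i' _ => by ring
  simp only [e]
  rw [← ofReal_mul_integral_sq (by positivity) hv]
  exact hP.hasY.le_lintegral_sq_add_avg hP.bdd_b hN.integral_sq_Y hn hv _

lemma lintegral_kernel_sq_mul_kernel_sq_le [IsProbabilityMeasure P]
    (hX : P.map (fun o : Obs d => o.1) = volume.restrict (cube d)) (hn : 1 ≤ n) (j₁ j₂ : ℕ)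
    (x y : Fin d → ℝ) :
    ENNReal.ofReal (1 / n) * (∫⁻ z in cube d,
      ENNReal.ofReal (W.kernel d j₁ x z ^ 2) * ENNReal.ofReal (W.kernel d j₂ y z ^ 2)) ≤
      ∫⁻ D : Sample d n, ENNReal.ofReal
        (avg (fun o => W.kernel d j₁ x o.1 * W.kernel d j₂ y o.1) (D 3) ^ 2)
          ∂(sampleLaw P n) := by
  have hf : BddMeasurable fun z => W.kernel d j₁ x z * W.kernel d j₂ y z :=
    ((W.bddMeasurable_kernel d j₁).section_left x).mul
      ((W.bddMeasurable_kernel d j₂).section_left y)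
  have hfX : BddMeasurable fun o : Obs d => W.kernel d j₁ x o.1 * W.kernel d j₂ y o.1 :=
    hf.comp measurable_fst
  rw [lintegral_sampleLaw_eval 3 (F := fun E => ENNReal.ofReal
    (avg (fun o => W.kernel d j₁ x o.1 * W.kernel d j₂ y o.1) E ^ 2))
    (((measurable_avg (F := fun (_ : Fin n → Obs d) (o : Obs d) =>
      W.kernel d j₁ x o.1 * W.kernel d j₂ y o.1) (hfX.measurable.comp measurable_snd)
      measurable_id).pow_const 2).ennreal_ofReal)]
  refine le_trans (le_of_eq ?_) (integral_sq_le_lintegral_sq_avg hn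
    (memLp_two_of_ae_bound hfX.measurable (Eventually.of_forall hfX.2.choose_spec)))
  rw [integral_comp_fst hX (w := fun z => (W.kernel d j₁ x z * W.kernel d j₂ y z) ^ 2)
    (hf.pow 2).measurable, ofReal_mul_integral_sq (by positivity) hf]
  simp only [mul_pow, ENNReal.ofReal_mul (sq_nonneg _)]

/-- The variance of Monte Carlo integration: each of the three subsamples involved contributes a
factor of order `1/n`. -/
lemma resolution_mul_le_mse_estMC (hP : IsRegression P p b C) (hN : HasNoise P p b δ) (hS : 1 ≤ S)
    (hn : 1 ≤ n) {j₁ j₂ : ℕ} (hj₁ : W.J0 ≤ j₁) (hj₂ : W.J0 ≤ j₂) :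
    ENNReal.ofReal (δ ^ 4 / W.kernelConst d ^ 2 *
      (resolution d j₁ * resolution d j₂ / n ^ 3)) ≤ mse P (W.estMC d n j₁ j₂) := by
  have := hP.prob
  have h4 : ∀ x, ENNReal.ofReal (δ ^ 2 / n) * (ENNReal.ofReal (1 / n) *
      ∫⁻ y in cube d, ∫⁻ z in cube d,
        ENNReal.ofReal (W.kernel d j₁ x z ^ 2) * ENNReal.ofReal (W.kernel d j₂ y z ^ 2)) ≤
      ∫⁻ D : Sample d n, ENNReal.ofReal
        (avg (fun o => W.kernel d j₁ x o.1 * W.bHat j₂ (D 1) o.1) (D 3) ^ 2)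
          ∂(sampleLaw P n) := fun x => by
    refine le_trans (mul_le_mul_right ?_ _) (W.lintegral_kernel_mul_kernel_le hP hN hn j₁ j₂ x)
    rw [← lintegral_const_mul' _ _ ENNReal.ofReal_ne_top]
    exact lintegral_mono (W.lintegral_kernel_sq_mul_kernel_sq_le hP.map_fst hn j₁ j₂ x)
  refine le_trans ?_ ((mul_le_mul_right (lintegral_mono h4) _).trans
    (W.lintegral_kernel_mul_bHat_le_mse_estMC hP hN hn j₁ j₂))
  rw [lintegral_const_mul' _ _ ENNReal.ofReal_ne_top,
    lintegral_const_mul' _ _ ENNReal.ofReal_ne_top]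
  refine le_trans (le_of_eq ?_) (mul_le_mul_right (mul_le_mul_right (mul_le_mul_right
    (W.resolution_mul_le_lintegral_kernel_sq hS hj₁ hj₂) _) _) _)
  rw [← ENNReal.ofReal_mul (by positivity), ← ENNReal.ofReal_mul (by positivity),
    ← ENNReal.ofReal_mul (by positivity)]
  congr 1
  ring

end CDVBasis

/-! ### Balancing bias and variance -/

/-- The exponent `ρ` of the rate `n^{-ρ}` that balances the squared bias `k^{-e}` with the variance
`1/n + k^a/n^{a+1}`. -/
noncomputable def rateExp (a : ℕ) (e : ℝ) : ℝ := if 1 ≤ e then 1 else (a + 1) * e / (a + e)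

/-- The exponent `γ` of a resolution `k ≍ n^γ` that balances the squared bias `k^{-e}` with the
variance `1/n + k^a/n^{a+1}`. -/
noncomputable def levelExp (a : ℕ) (e : ℝ) : ℝ := if 1 ≤ e then 1 else (a + 1) / (a + e)

section exponents

variable {a : ℕ} {e : ℝ}

lemma rateExp_le_one (he : 0 < e) : rateExp a e ≤ 1 := by
  unfold rateExp
  split_ifs with h
  · exact le_rfl
  · have ha : (0 : ℝ) ≤ a := by positivity
    rw [div_le_one (by positivity)]
    nlinarith

lemma rateExp_le_mul_levelExp : rateExp a e ≤ e * levelExp a e := by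
  unfold rateExp levelExp
  split_ifs with h
  · simpa using h
  · exact le_of_eq (by ring)

lemma mul_levelExp_sub_le (he : 0 < e) : a * levelExp a e - (a + 1) ≤ -rateExp a e := by
  unfold rateExp levelExp
  split_ifs with h
  · exact le_of_eq (by ring)
  · have ha : (0 : ℝ) ≤ a := by positivity
    refine le_of_eq ?_
    field_simp
    ring

lemma one_le_levelExp (he : 0 < e) : 1 ≤ levelExp a e := by
  unfold levelExp
  split_ifs with h
  · exact le_rfl
  · have ha : (0 : ℝ) ≤ a := by positivity
    rw [one_le_div (by positivity)]
    linarith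

/-- With squared bias `k^{-e}`, `e = 2(s+t)/d`, the rate forces resolutions of larger order than
`n^{d/(2s+d)}` if `t < d/2`. -/
lemma lt_rateExp_div {d s t : ℝ} (hd : 0 < d) (hs : 0 < s) (ht : 0 < t) (htd : t < d / 2) :
    d / (2 * s + d) < rateExp a (2 * (s + t) / d) / (2 * (s + t) / d) := by
  have he : 0 < 2 * (s + t) / d := by positivity
  unfold rateExp
  split_ifs with h
  · rw [one_div_div, div_lt_div_iff_of_pos_left hd (by positivity) (by positivity)]
    linarith
  · have ha : (0 : ℝ) ≤ a := by positivity
    rw [mul_div_assoc, mul_div_assoc, div_div_cancel_left' he.ne', ← div_eq_mul_inv]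
    refine lt_of_lt_of_le (b := 1) ((div_lt_one (by positivity)).2 (by linarith)) ?_
    rw [one_le_div (by positivity)]
    linarith

/-- No resolution balances squared bias and variance at an order below `n^{-ρ}`. -/
lemma rpow_neg_rateExp_le (he : 0 < e) {x k : ℝ} (hx : 1 ≤ x) (hk : 0 < k) :
    x ^ (-rateExp a e) ≤ 1 / x + k ^ a / x ^ (a + 1) + k ^ (-e) := by
  have hx0 : 0 < x := by linarith
  have h1 : 0 ≤ 1 / x := by positivity
  have h2 : 0 ≤ k ^ a / x ^ (a + 1) := by positivity
  have h3 : 0 ≤ k ^ (-e) := by positivity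
  have ha : (0 : ℝ) ≤ a := by positivity
  unfold rateExp
  split_ifs with h
  · rw [Real.rpow_neg_one, ← one_div]
    linarith
  · rcases le_total k (x ^ ((a + 1 : ℝ) / (a + e))) with hkx | hkx
    · have h4 := Real.rpow_le_rpow_of_nonpos hk hkx (neg_nonpos.2 he.le)
      rw [← Real.rpow_mul hx0.le] at h4
      have : (a + 1 : ℝ) / (a + e) * -e = -((a + 1) * e / (a + e)) := by ring
      rw [this] at h4
      linarith
    · have h4 : x ^ (-((a + 1) * e / (a + e))) ≤ k ^ a / x ^ (a + 1) := by
        rw [le_div_iff₀ (by positivity), ← Real.rpow_natCast x (a + 1), ← Real.rpow_add hx0]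
        refine le_trans (le_of_eq ?_) (pow_le_pow_left₀ (by positivity) hkx a)
        rw [← Real.rpow_natCast, ← Real.rpow_mul hx0.le]
        congr 1
        push_cast
        field_simp
        ring
      linarith

variable {x k B c ρ γ : ℝ}

lemma one_div_le_rpow_neg (hx : 1 ≤ x) (hρ : ρ ≤ 1) : 1 / x ≤ x ^ (-ρ) := by
  rw [one_div, ← Real.rpow_neg_one]
  exact Real.rpow_le_rpow_of_exponent_le hx (neg_le_neg hρ)

lemma pow_div_pow_le_rpow_neg (hx : 1 ≤ x) (hk : 0 ≤ k) (hkx : k ≤ B * x ^ γ)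
    (h : a * γ - (a + 1) ≤ -ρ) (hB : 0 ≤ B) : k ^ a / x ^ (a + 1) ≤ B ^ a * x ^ (-ρ) := by
  have hx0 : 0 < x := by linarith
  have h1 := pow_le_pow_left₀ hk hkx a
  rw [div_le_iff₀ (by positivity)]
  refine h1.trans ?_
  rw [mul_pow, mul_assoc]
  refine mul_le_mul_of_nonneg_left ?_ (by positivity)
  rw [← Real.rpow_natCast x (a + 1), ← Real.rpow_add hx0, ← Real.rpow_natCast,
    ← Real.rpow_mul hx0.le]
  refine Real.rpow_le_rpow_of_exponent_le hx ?_
  push_cast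
  linarith

lemma rpow_neg_le_mul_rpow_neg (hx : 1 ≤ x) (hc : 0 < c) (hkx : c * x ^ γ ≤ k) (he : 0 < e)
    (h : ρ ≤ e * γ) : k ^ (-e) ≤ c ^ (-e) * x ^ (-ρ) := by
  have hx0 : 0 < x := by linarith
  refine (Real.rpow_le_rpow_of_nonpos (by positivity) hkx (neg_nonpos.2 he.le)).trans ?_
  rw [Real.mul_rpow hc.le (by positivity), ← Real.rpow_mul hx0.le]
  refine mul_le_mul_of_nonneg_left (Real.rpow_le_rpow_of_exponent_le hx ?_) (by positivity)
  linarith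

lemma tendsto_div_rpow_atTop {k : ℕ → ℝ} {C : ℝ} (hk : ∀ n, 0 < k n) (he : 0 < e) (hC : 0 < C)
    (h : ∀ᶠ n : ℕ in atTop, k n ^ (-e) ≤ C * (n : ℝ) ^ (-ρ)) (hγ : γ < ρ / e) :
    Tendsto (fun n : ℕ => k n / (n : ℝ) ^ γ) atTop atTop := by
  have h1 : Tendsto (fun n : ℕ => (C ^ (-(1 / e))) * (n : ℝ) ^ (ρ / e - γ)) atTop atTop :=
    Tendsto.const_mul_atTop (by positivity)
      ((tendsto_rpow_atTop (sub_pos.2 hγ)).comp tendsto_natCast_atTop_atTop)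
  refine tendsto_atTop_mono' _ ?_ h1
  filter_upwards [h, eventually_ge_atTop 1] with n hn hn1
  have hn0 : (0 : ℝ) < n := by exact_mod_cast hn1
  rw [le_div_iff₀ (by positivity), mul_assoc, ← Real.rpow_add hn0, sub_add_cancel]
  have h2 := Real.rpow_le_rpow_of_nonpos (z := -(1 / e)) (Real.rpow_pos_of_pos (hk n) _) hn
    (neg_nonpos.2 (by positivity))
  rw [Real.mul_rpow hC.le (by positivity), ← Real.rpow_mul hn0.le, ← Real.rpow_mul (hk n).le] at h2
  have e1 : -ρ * -(1 / e) = ρ / e := by ring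
  have e2 : -e * -(1 / e) = 1 := by field_simp
  rwa [e1, e2, Real.rpow_one] at h2

end exponents

/-! ### Resolutions of prescribed order -/

lemma resolution_pos (d j : ℕ) : 0 < resolution d j := by unfold resolution; positivity

lemma monotone_resolution (d : ℕ) : Monotone (resolution d) := fun _ _ h =>
  pow_le_pow_right₀ one_le_two (Nat.mul_le_mul_right d h)

/-- Dyadic rounding: every order `n^γ` is attained by resolutions. -/
lemma exists_resolution_order {d : ℕ} (hd : 1 ≤ d) (J : ℕ) {γ : ℝ} (hγ : 0 ≤ γ) :
    ∃ j : ℕ → ℕ, (∀ n, J ≤ j n) ∧ ∃ c C : ℝ, 0 < c ∧ 0 < C ∧ ∀ n : ℕ, 1 ≤ n →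
      c * (n : ℝ) ^ γ ≤ resolution d (j n) ∧ resolution d (j n) ≤ C * (n : ℝ) ^ γ := by
  have hd0 : (0 : ℝ) < d := by exact_mod_cast hd
  refine ⟨fun n => J + ⌊γ * Real.logb 2 n / d⌋₊, fun n => Nat.le_add_right _ _,
    ((2 : ℝ) ^ d)⁻¹, 2 ^ (J * d), by positivity, by positivity, fun n hn => ?_⟩
  have hn1 : (1 : ℝ) ≤ n := by exact_mod_cast hn
  have hn0 : (0 : ℝ) < n := by linarith
  have hl : 0 ≤ γ * Real.logb 2 n / d :=
    div_nonneg (mul_nonneg hγ (Real.logb_nonneg one_lt_two hn1)) hd0.le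
  have e : (n : ℝ) ^ γ = (2 : ℝ) ^ (γ * Real.logb 2 n / d * d) := by
    rw [div_mul_cancel₀ _ hd0.ne', mul_comm, Real.rpow_mul zero_le_two,
      Real.rpow_logb zero_lt_two (by norm_num) hn0]
  have e2 : resolution d (J + ⌊γ * Real.logb 2 n / d⌋₊) =
      2 ^ (J * d) * (2 : ℝ) ^ ((⌊γ * Real.logb 2 n / d⌋₊ : ℝ) * d) := by
    rw [resolution, add_mul, pow_add, ← Real.rpow_natCast 2 (⌊_⌋₊ * d)]
    push_cast
    rfl
  have h1 : (1 : ℝ) ≤ 2 ^ (J * d) := one_le_pow₀ one_le_two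
  rw [e, e2]
  constructor
  · have h2 : (2 : ℝ) ^ (γ * Real.logb 2 n / d * d) ≤
        2 ^ d * (2 : ℝ) ^ ((⌊γ * Real.logb 2 n / d⌋₊ : ℝ) * d) := by
      rw [← Real.rpow_natCast 2 d, ← Real.rpow_add zero_lt_two]
      refine Real.rpow_le_rpow_of_exponent_le one_le_two ?_
      have := Nat.lt_floor_add_one (γ * Real.logb 2 n / d)
      nlinarith
    rw [inv_mul_le_iff₀ (by positivity)]
    refine h2.trans (mul_le_mul_of_nonneg_left ?_ (by positivity))
    exact le_mul_of_one_le_left (by positivity) h1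
  · refine mul_le_mul_of_nonneg_left ?_ (by positivity)
    refine Real.rpow_le_rpow_of_exponent_le one_le_two ?_
    exact mul_le_mul_of_nonneg_right (Nat.floor_le hl) hd0.le

/-- Prediction-optimality in terms of explicit constants. -/
lemma PredOptimal.exists_bounds {d : ℕ} {s : ℝ} {j : ℕ → ℕ} (h : PredOptimal d s j) :
    ∃ c C : ℝ, 0 < c ∧ 0 < C ∧ ∀ᶠ n : ℕ in atTop,
      c * (n : ℝ) ^ ((d : ℝ) / (2 * s + d)) ≤ resolution d (j n) ∧
        resolution d (j n) ≤ C * (n : ℝ) ^ ((d : ℝ) / (2 * s + d)) := by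
  obtain ⟨C, hC, h1⟩ := h.1.exists_pos
  obtain ⟨c, hc, h2⟩ := h.2.exists_pos
  refine ⟨c⁻¹, C, by positivity, hC, ?_⟩
  filter_upwards [h1.bound, h2.bound] with n h3 h4
  have h5 : (0 : ℝ) ≤ (n : ℝ) ^ ((d : ℝ) / (2 * s + d)) := by positivity
  simp only [predOrder, Real.norm_of_nonneg (resolution_pos d _).le, Real.norm_of_nonneg h5] at h3 h4
  exact ⟨by rwa [inv_mul_le_iff₀ hc], h3⟩

lemma predOptimal_of_bounds {d : ℕ} {s c C : ℝ} {j : ℕ → ℕ} (hc : 0 < c)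
    (h : ∀ n : ℕ, 1 ≤ n → c * (n : ℝ) ^ ((d : ℝ) / (2 * s + d)) ≤ resolution d (j n) ∧
      resolution d (j n) ≤ C * (n : ℝ) ^ ((d : ℝ) / (2 * s + d))) : PredOptimal d s j := by
  constructor
  · refine Asymptotics.IsBigO.of_bound C ((eventually_ge_atTop 1).mono fun n hn => ?_)
    have h5 : (0 : ℝ) ≤ (n : ℝ) ^ ((d : ℝ) / (2 * s + d)) := by positivity
    simp only [predOrder, Real.norm_of_nonneg (resolution_pos d _).le, Real.norm_of_nonneg h5]
    exact (h n hn).2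
  · refine Asymptotics.IsBigO.of_bound c⁻¹ ((eventually_ge_atTop 1).mono fun n hn => ?_)
    have h5 : (0 : ℝ) ≤ (n : ℝ) ^ ((d : ℝ) / (2 * s + d)) := by positivity
    simp only [predOrder, Real.norm_of_nonneg (resolution_pos d _).le, Real.norm_of_nonneg h5]
    rw [le_inv_mul_iff₀ hc]
    exact (h n hn).1

/-! ### Bounds on the worst-case risks -/

lemma mse_le_worstMSE {d n : ℕ} {Q : Set (Measure (Obs d))} {P : Measure (Obs d)} (hP : P ∈ Q)
    (T : (n j₁ j₂ : ℕ) → Sample d n → ℝ) (j₁ j₂ : ℕ) :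
    mse P (T n j₁ j₂) ≤ worstMSE Q T n j₁ j₂ :=
  le_iSup₂ (f := fun (P : Measure (Obs d)) (_ : P ∈ Q) => mse P (T n j₁ j₂)) P hP

lemma worstMSE_le {d n : ℕ} {Q : Set (Measure (Obs d))} {T : (n j₁ j₂ : ℕ) → Sample d n → ℝ}
    {j₁ j₂ : ℕ} {B : ℝ≥0∞} (h : ∀ P ∈ Q, mse P (T n j₁ j₂) ≤ B) :
    worstMSE Q T n j₁ j₂ ≤ B :=
  iSup₂_le h

/-- The risk `R` is at least of order `1/n + K^a/n^{a+1} + K^{-e}`, where `K` is the resolution that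
governs the bias. -/
def RiskLower (R : ℕ → ℕ → ℕ → ℝ≥0∞) (J0 a : ℕ) (e : ℝ) (K : ℕ → ℕ → ℝ) : Prop :=
  ∃ c : ℝ, 0 < c ∧ ∀ n : ℕ, 1 ≤ n → ∀ j₁ j₂, J0 ≤ j₁ → J0 ≤ j₂ →
    ENNReal.ofReal (c * (1 / n + K j₁ j₂ ^ a / n ^ (a + 1) + K j₁ j₂ ^ (-e))) ≤ R n j₁ j₂

/-- The risk `R` is at most of order `(1 + k₁/n)(1 + k₂/n)/n + K^{-e}`, where `K` is the resolution
that governs the bias. -/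
def RiskUpper (R : ℕ → ℕ → ℕ → ℝ≥0∞) (d J0 : ℕ) (e : ℝ) (K : ℕ → ℕ → ℝ) : Prop :=
  ∃ C : ℝ, 0 < C ∧ ∀ n : ℕ, 1 ≤ n → ∀ j₁ j₂, J0 ≤ j₁ → J0 ≤ j₂ →
    R n j₁ j₂ ≤ ENNReal.ofReal (C * (1 / n * ((1 + resolution d j₁ / n) *
      (1 + resolution d j₂ / n)) + K j₁ j₂ ^ (-e)))

/-- The smaller of the two resolutions. -/
noncomputable def minRes (d j₁ j₂ : ℕ) : ℝ := min (resolution d j₁) (resolution d j₂)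

/-- The larger of the two resolutions. -/
noncomputable def maxRes (d j₁ j₂ : ℕ) : ℝ := max (resolution d j₁) (resolution d j₂)

lemma minRes_pos (d j₁ j₂ : ℕ) : 0 < minRes d j₁ j₂ :=
  lt_min (resolution_pos d j₁) (resolution_pos d j₂)

lemma maxRes_pos (d j₁ j₂ : ℕ) : 0 < maxRes d j₁ j₂ := lt_max_of_lt_left (resolution_pos d j₁)

lemma resolution_min (d j₁ j₂ : ℕ) : resolution d (min j₁ j₂) = minRes d j₁ j₂ :=
  (monotone_resolution d).map_min

lemma resolution_max (d j₁ j₂ : ℕ) : resolution d (max j₁ j₂) = maxRes d j₁ j₂ :=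
  (monotone_resolution d).map_max

lemma two_rpow_neg_sq {d : ℕ} (hd : 1 ≤ d) (j : ℕ) (s : ℝ) :
    ((2 : ℝ) ^ (-((j : ℝ) * s))) ^ 2 = resolution d j ^ (-(2 * s / d)) := by
  have hd0 : (d : ℝ) ≠ 0 := by positivity
  rw [resolution, ← Real.rpow_natCast, ← Real.rpow_natCast, ← Real.rpow_mul zero_le_two,
    ← Real.rpow_mul zero_le_two]
  congr 1
  push_cast
  field_simp

lemma ofReal_min_mul_add_le {c₁ c₂ c₃ u₁ u₂ u₃ : ℝ} {R : ℝ≥0∞} (hu₁ : 0 ≤ u₁) (hu₂ : 0 ≤ u₂)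
    (hu₃ : 0 ≤ u₃) (h₁ : ENNReal.ofReal (c₁ * u₁) ≤ R)
    (h₂ : ENNReal.ofReal (c₂ * u₂) ≤ R) (h₃ : ENNReal.ofReal (c₃ * u₃) ≤ R) :
    ENNReal.ofReal (min c₁ (min c₂ c₃) / 3 * (u₁ + u₂ + u₃)) ≤ R := by
  have m₁ : min c₁ (min c₂ c₃) * u₁ ≤ c₁ * u₁ :=
    mul_le_mul_of_nonneg_right (min_le_left _ _) hu₁
  have m₂ : min c₁ (min c₂ c₃) * u₂ ≤ c₂ * u₂ :=
    mul_le_mul_of_nonneg_right ((min_le_right _ _).trans (min_le_left _ _)) hu₂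
  have m₃ : min c₁ (min c₂ c₃) * u₃ ≤ c₃ * u₃ :=
    mul_le_mul_of_nonneg_right ((min_le_right _ _).trans (min_le_right _ _)) hu₃
  have h : min c₁ (min c₂ c₃) / 3 * (u₁ + u₂ + u₃) ≤ max (c₁ * u₁) (max (c₂ * u₂) (c₃ * u₃)) := by
    have l₁ := le_max_left (c₁ * u₁) (max (c₂ * u₂) (c₃ * u₃))
    have l₂ := (le_max_left (c₂ * u₂) (c₃ * u₃)).trans (le_max_right (c₁ * u₁) _)
    have l₃ := (le_max_right (c₂ * u₂) (c₃ * u₃)).trans (le_max_right (c₁ * u₁) _)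
    linarith
  refine (ENNReal.ofReal_le_ofReal h).trans ?_
  rw [ENNReal.ofReal_max, ENNReal.ofReal_max]
  exact max_le h₁ (max_le h₂ h₃)

namespace CDVBasis

variable {S : ℕ} (W : CDVBasis S) {d : ℕ} {α β M C₁ C₂ : ℝ}

lemma abs_waveCoef_le_of_mem_Holder {s : ℝ} {h : (Fin d → ℝ) → ℝ} (hh : h ∈ W.Holder d s M)
    {l : ℕ} (hl : W.J0 ≤ l) {ι : Fin d → Bool} (hι : ∃ i, ι i = true) (m : Fin d → Fin (2 ^ l)) :
    |W.waveCoef d l h ι m| ≤ M * (2 : ℝ) ^ (-((l : ℝ) * (s + (d : ℝ) / 2))) := by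
  have h1 := hh.2 (fun _ => ⟨0, by positivity⟩) l hl m ι hι
  have h2 : 0 ≤ (2 : ℝ) ^ ((W.J0 : ℝ) * (s + (d : ℝ) / 2)) *
      |∫ x in cube d, h x * W.Phi d W.J0 (fun _ => ⟨0, by positivity⟩) x| := by positivity
  rw [Real.rpow_neg zero_le_two, ← div_eq_mul_inv, le_div_iff₀ (by positivity), mul_comm]
  unfold waveCoef
  linarith

/-- The squared bias at resolution `k` is at most of order `k^{-2(α+β)/d}`. -/
lemma errForm_sq_le (hd : 1 ≤ d) (hS : 1 ≤ S) (hM : 0 ≤ M) (hs : 0 < α + β)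
    {p b : (Fin d → ℝ) → ℝ} (hp : p ∈ W.Holder d α M) (hb : b ∈ W.Holder d β M)
    (hpm : BddMeasurable p) (hbm : BddMeasurable b) {j : ℕ} (hj : W.J0 ≤ j) :
    W.errForm d j p b ^ 2 ≤
      biasConst d (α + β) M ^ 2 * resolution d j ^ (-(2 * (α + β) / d)) := by
  have h := W.abs_integral_sub_projForm_le hS hpm hbm hb.1 hM hs
    (fun l hl ι hι m => W.abs_waveCoef_le_of_mem_Holder hp hl hι m)
    (fun l hl ι hι m => W.abs_waveCoef_le_of_mem_Holder hb hl hι m) hj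
  rw [← two_rpow_neg_sq hd, ← mul_pow, ← sq_abs]
  exact pow_le_pow_left₀ (abs_nonneg _) h 2

lemma exists_riskINT_le (hd : 1 ≤ d) (hS : 1 ≤ S) (hM : 0 ≤ M) (hs : 0 < α + β) :
    ∃ C : ℝ, 0 < C ∧ ∀ n : ℕ, 1 ≤ n → ∀ j₁ j₂, W.J0 ≤ j₁ → W.J0 ≤ j₂ →
      riskINT W d α β M C₁ C₂ n j₁ j₂ ≤ ENNReal.ofReal (C * (1 / n + minRes d j₁ j₂ / n ^ 2 +
        minRes d j₁ j₂ ^ (-(2 * (α + β) / d)))) := by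
  set C₀ := max |C₁| |C₂| with hC₀
  set A := 2 * (C₀ ^ 2 * (W.kernelConst d * (C₀ + W.kernelConst d * C₀)) ^ 2) + C₀ ^ 4 with hA
  set B := biasConst d (α + β) M ^ 2 with hB
  have hA0 : 0 ≤ A := by positivity
  have hB0 : 0 ≤ B := by positivity
  refine ⟨2 * (B + A + C₀ ^ 4 + 1), by positivity, fun n hn j₁ j₂ hj₁ hj₂ =>
    worstMSE_le fun P hP => ?_⟩
  obtain ⟨p, b, hp, hb, hR⟩ := exists_isRegression_of_mem_Model hP
  refine (W.mse_estINT_le hR hn hj₁ hj₂).trans (ENNReal.ofReal_le_ofReal ?_)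
  have h1 := W.errForm_sq_le hd hS hM hs hp hb hR.bdd_p hR.bdd_b (le_min hj₁ hj₂)
  rw [resolution_min] at h1
  have hk := minRes_pos d j₁ j₂
  have h2 : 0 ≤ minRes d j₁ j₂ ^ (-(2 * (α + β) / d)) := by positivity
  have h3 : 0 ≤ minRes d j₁ j₂ / n ^ 2 := by positivity
  have h4 : 0 ≤ 1 / (n : ℝ) := by positivity
  rw [mul_assoc]
  refine mul_le_mul_of_nonneg_left ?_ zero_le_two
  have e1 : A / (n : ℝ) = A * (1 / n) := by ring
  have e2 : C₀ ^ 4 * min (resolution d j₁) (resolution d j₂) / (n : ℝ) ^ 2 =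
    C₀ ^ 4 * (minRes d j₁ j₂ / n ^ 2) := by rw [minRes]; ring
  rw [e1, e2]
  have hC4 : 0 ≤ C₀ ^ 4 := by positivity
  nlinarith [mul_nonneg hA0 h2, mul_nonneg hA0 h3, mul_nonneg hB0 h3, mul_nonneg hB0 h4,
    mul_nonneg hC4 h4, mul_nonneg hC4 h2]

/-- Each of `1/n` and `min(k₁, k₂)/n²` is at most `(1 + k₁/n)(1 + k₂/n)/n`. -/
lemma inv_add_minRes_le {n : ℕ} (hn : 1 ≤ n) (j₁ j₂ : ℕ) :
    1 / (n : ℝ) + minRes d j₁ j₂ / n ^ 2 ≤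
      1 / n * ((1 + resolution d j₁ / n) * (1 + resolution d j₂ / n)) := by
  have hn0 : (0 : ℝ) < n := by exact_mod_cast hn
  have h1 := resolution_pos d j₁
  have h2 := resolution_pos d j₂
  have e : 1 / (n : ℝ) + minRes d j₁ j₂ / n ^ 2 = 1 / n * (1 + minRes d j₁ j₂ / n) := by
    field_simp
  rw [e]
  refine mul_le_mul_of_nonneg_left ?_ (by positivity)
  have h3 : minRes d j₁ j₂ / n ≤ resolution d j₁ / n :=
    div_le_div_of_nonneg_right (min_le_left _ _) hn0.le
  have h4 : 0 ≤ resolution d j₂ / n := by positivity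
  have h5 : 0 ≤ resolution d j₁ / n * (resolution d j₂ / n) := by positivity
  nlinarith

lemma riskUpper_riskINT (hd : 1 ≤ d) (hS : 1 ≤ S) (hM : 0 ≤ M) (hs : 0 < α + β) :
    RiskUpper (riskINT W d α β M C₁ C₂) d W.J0 (2 * (α + β) / d) (minRes d) := by
  obtain ⟨C, hC, h⟩ := W.exists_riskINT_le (C₁ := C₁) (C₂ := C₂) hd hS hM hs
  refine ⟨C, hC, fun n hn j₁ j₂ hj₁ hj₂ => (h n hn j₁ j₂ hj₁ hj₂).trans
    (ENNReal.ofReal_le_ofReal ?_)⟩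
  exact mul_le_mul_of_nonneg_left (add_le_add (inv_add_minRes_le hn j₁ j₂) le_rfl) hC.le

lemma riskUpper_riskMC (hd : 1 ≤ d) (hS : 1 ≤ S) (hM : 0 ≤ M) (hs : 0 < α + β) :
    RiskUpper (riskMC W d α β M C₁ C₂) d W.J0 (2 * (α + β) / d) (minRes d) := by
  obtain ⟨C, hC, h⟩ := W.riskUpper_riskINT (C₁ := C₁) (C₂ := C₂) hd hS hM hs
  refine ⟨C + W.fitConst d (max |C₁| |C₂|) ^ 2, by positivity, fun n hn j₁ j₂ hj₁ hj₂ =>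
    worstMSE_le fun P hP => ?_⟩
  obtain ⟨p, b, hp, hb, hR⟩ := exists_isRegression_of_mem_Model hP
  refine ((W.mse_estMC_le hR hn hj₁ hj₂).trans
    (add_le_add ((mse_le_worstMSE hP (W.estINT d) j₁ j₂).trans (h n hn j₁ j₂ hj₁ hj₂))
      le_rfl)).trans ?_
  have h1 := resolution_pos d j₁
  have h2 := resolution_pos d j₂
  have h3 : 0 ≤ minRes d j₁ j₂ ^ (-(2 * (α + β) / d)) := by
    have := minRes_pos d j₁ j₂
    positivity
  rw [← ENNReal.ofReal_add (by positivity) (by positivity)]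
  refine ENNReal.ofReal_le_ofReal ?_
  have h4 := mul_nonneg (sq_nonneg (W.fitConst d (max |C₁| |C₂|))) h3
  linarith

lemma riskUpper_riskIF (hd : 1 ≤ d) (hS : 1 ≤ S) (hM : 0 ≤ M) (hs : 0 < α + β) :
    RiskUpper (riskIF W d α β M C₁ C₂) d W.J0 (2 * (α + β) / d) (maxRes d) := by
  set C₀ := max |C₁| |C₂| with hC₀
  set A := 2 * (C₀ ^ 2 * (W.kernelConst d * (C₀ + W.kernelConst d * C₀)) ^ 2) with hA
  set B := biasConst d (α + β) M ^ 2 with hB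
  set G := W.fitConst d C₀ ^ 2 with hG
  have hA0 : 0 ≤ A := by positivity
  have hB0 : 0 ≤ B := by positivity
  have hG0 : 0 ≤ G := by positivity
  refine ⟨B + (A + C₀ ^ 4) + G + 1, by positivity, fun n hn j₁ j₂ hj₁ hj₂ =>
    worstMSE_le fun P hP => ?_⟩
  obtain ⟨p, b, hp, hb, hR⟩ := exists_isRegression_of_mem_Model hP
  refine (W.mse_estIF_le hR hn hj₁ hj₂).trans (ENNReal.ofReal_le_ofReal ?_)
  have h1 := W.errForm_sq_le hd hS hM hs hp hb hR.bdd_p hR.bdd_b (hj₁.trans (le_max_left j₁ j₂))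
  rw [resolution_max] at h1
  have hk := minRes_pos d j₁ j₂
  have hK := maxRes_pos d j₁ j₂
  have h2 : 0 ≤ maxRes d j₁ j₂ ^ (-(2 * (α + β) / d)) := by positivity
  have h3 : 0 ≤ minRes d j₁ j₂ / n ^ 2 := by positivity
  have h4 : 0 ≤ 1 / (n : ℝ) := by positivity
  have h5 := inv_add_minRes_le (d := d) hn j₁ j₂
  set q := 1 / (n : ℝ) * ((1 + resolution d j₁ / n) * (1 + resolution d j₂ / n))
  have hq : 0 ≤ q := by linarith
  have e1 : A / (n : ℝ) = A * (1 / n) := by ring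
  have e2 : C₀ ^ 4 * min (resolution d j₁) (resolution d j₂) / (n : ℝ) ^ 2 =
    C₀ ^ 4 * (minRes d j₁ j₂ / n ^ 2) := by rw [minRes]; ring
  rw [e1, e2]
  have hC4 : 0 ≤ C₀ ^ 4 := by positivity
  have t1 : A * (1 / n) ≤ A * q := mul_le_mul_of_nonneg_left (by linarith) hA0
  have t2 : C₀ ^ 4 * (minRes d j₁ j₂ / n ^ 2) ≤ C₀ ^ 4 * q :=
    mul_le_mul_of_nonneg_left (by linarith) hC4
  nlinarith [mul_nonneg hA0 h2, mul_nonneg hB0 hq, mul_nonneg hC4 h2, mul_nonneg hG0 h2]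

/-- For every level, a law in the model with non-degenerate noise and bias of maximal order at this
level. -/
lemma exists_law_errForm_ge (hd : 1 ≤ d) (hS : 1 ≤ S) (hα : 0 < α) (hβ : 0 < β)
    (hαS : α < S) (hβS : β < S)
    (hp : ∃ M' < M, ∃ p₀ ∈ W.Holder d α M', ∀ x ∈ cube d, C₁ < p₀ x ∧ p₀ x < C₂)
    (hb : ∃ M' < M, ∃ b₀ ∈ W.Holder d β M', ∀ x ∈ cube d, C₁ < b₀ x ∧ b₀ x < C₂) :
    ∃ c δ : ℝ, 0 < c ∧ 0 < δ ∧ ∀ j, W.J0 ≤ j → ∃ P ∈ Model W d α β M C₁ C₂, ∃ p b,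
      IsRegression P p b (max |C₁| |C₂|) ∧ HasNoise P p b δ ∧
      c * resolution d j ^ (-(2 * (α + β) / d)) ≤ W.errForm d j p b ^ 2 := by
  obtain ⟨c, δ, hc, hδ, h⟩ := W.exists_errForm_ge hd hS hα hβ hαS hβS hp hb
  refine ⟨c ^ 2, δ, by positivity, hδ, fun j hj => ?_⟩
  obtain ⟨p, hpH, b, hbH, hpm, hbm, hp', hb', hpb⟩ := h j hj
  refine ⟨signLaw p b δ, signLaw_mem_Model hδ.le hpm hbm hpH hbH hp' hb', p, b,
    isRegression_signLaw hδ.le hpm hbm hp' hb', hasNoise_signLaw hpm hbm, ?_⟩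
  rw [← two_rpow_neg_sq hd, ← mul_pow, ← sq_abs (W.errForm d j p b)]
  exact pow_le_pow_left₀ (by positivity) hpb 2

lemma riskLower_riskINT (hd : 1 ≤ d) (hS : 1 ≤ S) (hα : 0 < α) (hβ : 0 < β)
    (hαS : α < S) (hβS : β < S)
    (hp : ∃ M' < M, ∃ p₀ ∈ W.Holder d α M', ∀ x ∈ cube d, C₁ < p₀ x ∧ p₀ x < C₂)
    (hb : ∃ M' < M, ∃ b₀ ∈ W.Holder d β M', ∀ x ∈ cube d, C₁ < b₀ x ∧ b₀ x < C₂) :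
    RiskLower (riskINT W d α β M C₁ C₂) W.J0 1 (2 * (α + β) / d) (minRes d) := by
  obtain ⟨c, δ, hc, hδ, h⟩ := W.exists_law_errForm_ge hd hS hα hβ hαS hβS hp hb
  refine ⟨min (δ ^ 4) (min (δ ^ 4) c) / 3, by positivity, fun n hn j₁ j₂ hj₁ hj₂ => ?_⟩
  obtain ⟨P, hP, p, b, hR, hN, he⟩ := h _ (le_min hj₁ hj₂)
  have hk := minRes_pos d j₁ j₂
  rw [resolution_min] at he
  refine le_trans ?_ (mse_le_worstMSE hP (W.estINT d) j₁ j₂)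
  refine ofReal_min_mul_add_le (by positivity) (by positivity) (by positivity)
    (W.inv_le_mse_estINT hR hN hn j₁ j₂) ?_
    ((ENNReal.ofReal_le_ofReal he).trans (W.errForm_sq_le_mse_estINT hR hn hj₁ hj₂))
  rw [pow_one]
  exact W.min_resolution_le_mse_estINT hR hN hn hj₁ hj₂

lemma riskLower_riskMC (hd : 1 ≤ d) (hS : 1 ≤ S) (hα : 0 < α) (hβ : 0 < β)
    (hαS : α < S) (hβS : β < S)
    (hp : ∃ M' < M, ∃ p₀ ∈ W.Holder d α M', ∀ x ∈ cube d, C₁ < p₀ x ∧ p₀ x < C₂)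
    (hb : ∃ M' < M, ∃ b₀ ∈ W.Holder d β M', ∀ x ∈ cube d, C₁ < b₀ x ∧ b₀ x < C₂) :
    RiskLower (riskMC W d α β M C₁ C₂) W.J0 2 (2 * (α + β) / d) (minRes d) := by
  obtain ⟨c, δ, hc, hδ, h⟩ := W.exists_law_errForm_ge hd hS hα hβ hαS hβS hp hb
  have hκ := W.kernelConst_pos d
  refine ⟨min (δ ^ 4) (min (δ ^ 4 / W.kernelConst d ^ 2) c) / 3, by positivity,
    fun n hn j₁ j₂ hj₁ hj₂ => ?_⟩
  obtain ⟨P, hP, p, b, hR, hN, he⟩ := h _ (le_min hj₁ hj₂)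
  have hk := minRes_pos d j₁ j₂
  rw [resolution_min] at he
  refine le_trans ?_ (mse_le_worstMSE hP (W.estMC d) j₁ j₂)
  have h1 := W.mse_estINT_le_mse_estMC hR hn j₁ j₂
  refine ofReal_min_mul_add_le (by positivity) (by positivity) (by positivity)
    ((W.inv_le_mse_estINT hR hN hn j₁ j₂).trans h1) ?_
    ((ENNReal.ofReal_le_ofReal he).trans ((W.errForm_sq_le_mse_estINT hR hn hj₁ hj₂).trans h1))
  refine le_trans (ENNReal.ofReal_le_ofReal ?_)
    (W.resolution_mul_le_mse_estMC hR hN hS hn hj₁ hj₂)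
  refine mul_le_mul_of_nonneg_left (div_le_div_of_nonneg_right ?_ (by positivity)) (by positivity)
  rw [sq]
  exact mul_le_mul (min_le_left _ _) (min_le_right _ _) hk.le (resolution_pos d j₁).le

lemma riskLower_riskIF (hd : 1 ≤ d) (hS : 1 ≤ S) (hα : 0 < α) (hβ : 0 < β)
    (hαS : α < S) (hβS : β < S)
    (hp : ∃ M' < M, ∃ p₀ ∈ W.Holder d α M', ∀ x ∈ cube d, C₁ < p₀ x ∧ p₀ x < C₂)
    (hb : ∃ M' < M, ∃ b₀ ∈ W.Holder d β M', ∀ x ∈ cube d, C₁ < b₀ x ∧ b₀ x < C₂) :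
    RiskLower (riskIF W d α β M C₁ C₂) W.J0 1 (2 * (α + β) / d) (maxRes d) := by
  obtain ⟨c, δ, hc, hδ, h⟩ := W.exists_law_errForm_ge hd hS hα hβ hαS hβS hp hb
  refine ⟨min (δ ^ 4) (min (δ ^ 4) c) / 3, by positivity, fun n hn j₁ j₂ hj₁ hj₂ => ?_⟩
  obtain ⟨P, hP, p, b, hR, hN, he⟩ := h (max j₁ j₂) (hj₁.trans (le_max_left j₁ j₂))
  have hk := maxRes_pos d j₁ j₂
  rw [resolution_max] at he
  refine le_trans ?_ (mse_le_worstMSE hP (W.estIF d) j₁ j₂)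
  refine ofReal_min_mul_add_le (by positivity) (by positivity) (by positivity)
    (W.inv_le_mse_estIF hR hN hn j₁ j₂) ?_
    ((ENNReal.ofReal_le_ofReal he).trans (W.errForm_sq_le_mse_estIF hR hn hj₁ hj₂))
  rw [pow_one, maxRes]
  rcases le_total (resolution d j₁) (resolution d j₂) with hle | hle
  · rw [max_eq_right hle]
    exact W.resolution_right_le_mse_estIF hR hN hn j₁ hj₂
  · rw [max_eq_left hle]
    exact W.resolution_left_le_mse_estIF hR hN hn j₂ hj₁

end CDVBasis

/-! ### Rates achieved by given resolutions -/

section rates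

variable {R : ℕ → ℕ → ℕ → ℝ≥0∞} {d J0 a : ℕ} {e : ℝ} {K : ℕ → ℕ → ℝ}

lemma minimaxRate_eq {d : ℕ} (hd : 1 ≤ d) {α β : ℝ} :
    minimaxRate d α β = fun n : ℕ => (n : ℝ) ^ (-rateExp 1 (2 * (α + β) / d)) := by
  have hd0 : (0 : ℝ) < d := by exact_mod_cast hd
  have h : (d : ℝ) / 4 ≤ (α + β) / 2 ↔ 1 ≤ 2 * (α + β) / d := by
    rw [one_le_div hd0]
    constructor <;> intro h <;> linarith
  funext n
  simp only [minimaxRate, rateExp, h]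
  split_ifs with h1
  · rfl
  · congr 2
    push_cast
    field_simp
    ring

lemma mcRate_eq {d : ℕ} (hd : 1 ≤ d) {α β : ℝ} :
    mcRate d α β = fun n : ℕ => (n : ℝ) ^ (-rateExp 2 (2 * (α + β) / d)) := by
  have hd0 : (0 : ℝ) < d := by exact_mod_cast hd
  have h : (d : ℝ) / 4 ≤ (α + β) / 2 ↔ 1 ≤ 2 * (α + β) / d := by
    rw [one_le_div hd0]
    constructor <;> intro h <;> linarith
  funext n
  simp only [mcRate, rateExp, h]
  split_ifs with h1
  · rfl
  · congr 2
    push_cast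
    have e1 : (2 : ℝ) + 2 * (α + β) / d = 2 * (α + β + d) / d := by field_simp; ring
    have e2 : ((2 : ℝ) + 1) * (2 * (α + β) / d) = 2 * (3 * α + 3 * β) / d := by ring
    rw [e1, e2, div_div_div_cancel_right₀ hd0.ne', mul_div_mul_left _ _ two_ne_zero]

lemma RiskLower.eventually_le (h : RiskLower R J0 a e K) (he : 0 < e) (hK : ∀ j₁ j₂, 0 < K j₁ j₂) :
    ∃ c : ℝ, 0 < c ∧ ∀ᶠ n : ℕ in atTop, ∀ j₁ j₂ : ℕ, J0 ≤ j₁ → J0 ≤ j₂ →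
      ENNReal.ofReal (c * (n : ℝ) ^ (-rateExp a e)) ≤ R n j₁ j₂ := by
  obtain ⟨c, hc, h⟩ := h
  refine ⟨c, hc, (eventually_ge_atTop 1).mono fun n hn j₁ j₂ hj₁ hj₂ =>
    le_trans (ENNReal.ofReal_le_ofReal ?_) (h n hn j₁ j₂ hj₁ hj₂)⟩
  exact mul_le_mul_of_nonneg_left
    (rpow_neg_rateExp_le he (by exact_mod_cast hn) (hK j₁ j₂)) hc.le

/-- Achieving a rate bounds the squared bias. -/
lemma RiskLower.bias_le (h : RiskLower R J0 a e K) (hK : ∀ j₁ j₂, 0 < K j₁ j₂) {j₁ j₂ : ℕ → ℕ}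
    (hj₁ : ∀ n, J0 ≤ j₁ n) (hj₂ : ∀ n, J0 ≤ j₂ n) {ρ : ℝ}
    (hA : AchievesRate R j₁ j₂ fun n : ℕ => (n : ℝ) ^ (-ρ)) :
    ∃ C : ℝ, 0 < C ∧ ∀ᶠ n : ℕ in atTop, K (j₁ n) (j₂ n) ^ (-e) ≤ C * (n : ℝ) ^ (-ρ) := by
  obtain ⟨c, hc, h⟩ := h
  obtain ⟨C, hC, hA⟩ := hA
  refine ⟨C / c, by positivity, ?_⟩
  filter_upwards [hA, eventually_ge_atTop 1] with n hn hn1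
  have h1 := (h n hn1 _ _ (hj₁ n) (hj₂ n)).trans hn
  rw [ENNReal.ofReal_le_ofReal_iff (by positivity)] at h1
  have hk := hK (j₁ n) (j₂ n)
  have h2 : 0 ≤ 1 / (n : ℝ) := by positivity
  have h3 : 0 ≤ K (j₁ n) (j₂ n) ^ a / (n : ℝ) ^ (a + 1) := by positivity
  rw [div_mul_eq_mul_div, le_div_iff₀ hc, mul_comm]
  refine le_trans (mul_le_mul_of_nonneg_left ?_ hc.le) h1
  linarith

lemma RiskUpper.swap (h : RiskUpper R d J0 e K) :
    RiskUpper (fun n j₁ j₂ => R n j₂ j₁) d J0 e fun j₁ j₂ => K j₂ j₁ := by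
  obtain ⟨C, hC, h⟩ := h
  refine ⟨C, hC, fun n hn j₁ j₂ hj₁ hj₂ => ?_⟩
  rw [mul_comm (1 + _)]
  exact h n hn j₂ j₁ hj₂ hj₁

/-- If the second resolution is at most of order `n`, the first one may be as large as
`n^{2-ρ}`. -/
lemma RiskUpper.achievesRate_left (h : RiskUpper R d J0 e K) {j₁ j₂ : ℕ → ℕ}
    (hj₁ : ∀ n, J0 ≤ j₁ n) (hj₂ : ∀ n, J0 ≤ j₂ n) {ρ γ B₁ B₂ E : ℝ} (hρ : ρ ≤ 1)
    (hγ : γ - 2 ≤ -ρ) (hB₁ : 0 < B₁) (hB₂ : 0 < B₂) (hE : 0 < E)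
    (h₁ : ∀ᶠ n : ℕ in atTop, resolution d (j₁ n) ≤ B₁ * (n : ℝ) ^ γ)
    (h₂ : ∀ᶠ n : ℕ in atTop, resolution d (j₂ n) ≤ B₂ * n)
    (hKE : ∀ᶠ n : ℕ in atTop, K (j₁ n) (j₂ n) ^ (-e) ≤ E * (n : ℝ) ^ (-ρ)) :
    AchievesRate R j₁ j₂ fun n : ℕ => (n : ℝ) ^ (-ρ) := by
  obtain ⟨C, hC, h⟩ := h
  refine ⟨C * ((1 + B₁) * (1 + B₂) + E), by positivity, ?_⟩
  filter_upwards [h₁, h₂, hKE, eventually_ge_atTop 1] with n h₁ h₂ hKE hn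
  have hn1 : (1 : ℝ) ≤ n := by exact_mod_cast hn
  have hn0 : (0 : ℝ) < n := by linarith
  refine (h n hn _ _ (hj₁ n) (hj₂ n)).trans (ENNReal.ofReal_le_ofReal ?_)
  rw [mul_assoc, add_mul (_ * _) E]
  refine mul_le_mul_of_nonneg_left (add_le_add ?_ hKE) hC.le
  have k₁ := resolution_pos d (j₁ n)
  have k₂ := resolution_pos d (j₂ n)
  have t₁ := one_div_le_rpow_neg hn1 hρ
  have t₂ := pow_div_pow_le_rpow_neg (a := 1) (ρ := ρ) hn1 k₁.le h₁ (by push_cast; linarith) hB₁.le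
  have t₃ : 1 + resolution d (j₂ n) / n ≤ 1 + B₂ := by
    rw [add_le_add_iff_left, div_le_iff₀ hn0]
    exact h₂
  have e1 : 1 / (n : ℝ) * ((1 + resolution d (j₁ n) / n) * (1 + resolution d (j₂ n) / n)) =
      (1 / n + resolution d (j₁ n) ^ 1 / n ^ (1 + 1)) * (1 + resolution d (j₂ n) / n) := by
    field_simp
    ring
  have e2 : (1 + B₁) * (1 + B₂) * (n : ℝ) ^ (-ρ) =
      ((n : ℝ) ^ (-ρ) + B₁ ^ 1 * (n : ℝ) ^ (-ρ)) * (1 + B₂) := by ring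
  rw [e1, e2]
  exact mul_le_mul (add_le_add t₁ t₂) t₃ (by positivity) (by positivity)

end rates

lemma predExp_nonneg {d : ℕ} {s : ℝ} (hs : 0 < s) : 0 ≤ (d : ℝ) / (2 * s + d) := by positivity

lemma predExp_le_one {d : ℕ} {s : ℝ} (hd : 1 ≤ d) (hs : 0 < s) : (d : ℝ) / (2 * s + d) ≤ 1 := by
  have hd0 : (0 : ℝ) < d := by exact_mod_cast hd
  rw [div_le_one (by positivity)]
  linarith

/-- Prediction-optimal resolutions are at most of order `n`, and their squared bias
`k^{-2(s+t)/d}` is at most of order `1/n` if `t ≥ d/2`. -/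
lemma PredOptimal.exists_le {d : ℕ} (hd : 1 ≤ d) {s : ℝ} (hs : 0 < s) {j : ℕ → ℕ}
    (h : PredOptimal d s j) :
    ∃ B : ℝ, 0 < B ∧ (∀ᶠ n : ℕ in atTop, resolution d (j n) ≤ B * n) ∧
      ∀ t : ℝ, (d : ℝ) / 2 ≤ t → ∃ E : ℝ, 0 < E ∧
        ∀ᶠ n : ℕ in atTop, resolution d (j n) ^ (-(2 * (s + t) / d)) ≤ E * (n : ℝ) ^ (-1 : ℝ) := by
  have hd0 : (0 : ℝ) < d := by exact_mod_cast hd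
  obtain ⟨c, C, hc, hC, h⟩ := h.exists_bounds
  refine ⟨C, hC, ?_, fun t ht => ⟨c ^ (-(2 * (s + t) / d)), by positivity, ?_⟩⟩
  · filter_upwards [h, eventually_ge_atTop 1] with n hn hn1
    refine hn.2.trans (mul_le_mul_of_nonneg_left ?_ hC.le)
    conv_rhs => rw [← Real.rpow_one (n : ℝ)]
    exact Real.rpow_le_rpow_of_exponent_le (by exact_mod_cast hn1) (predExp_le_one hd hs)
  · have ht0 : 0 < t := lt_of_lt_of_le (by positivity) ht
    filter_upwards [h, eventually_ge_atTop 1] with n hn hn1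
    refine rpow_neg_le_mul_rpow_neg (by exact_mod_cast hn1) hc hn.1 (by positivity) ?_
    have : 2 * (s + t) / d * (d / (2 * s + d)) = 2 * (s + t) / (2 * s + d) := by
      field_simp
    rw [this, one_le_div (by positivity)]
    linarith

lemma PredOptimal.eventually_div_le {d : ℕ} {s : ℝ} {j : ℕ → ℕ} (h : PredOptimal d s j) :
    ∃ C : ℝ, ∀ᶠ n : ℕ in atTop, resolution d (j n) / predOrder d s n ≤ C := by
  obtain ⟨c, C, -, -, h⟩ := h.exists_bounds
  refine ⟨C, ?_⟩
  filter_upwards [h, eventually_ge_atTop 1] with n hn hn1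
  have hn0 : (0 : ℝ) < n := by exact_mod_cast hn1
  rw [predOrder, div_le_iff₀ (by positivity)]
  exact hn.2

/-! ### Prediction-optimal and undersmoothed resolutions -/

section predOptimal

variable {R : ℕ → ℕ → ℕ → ℝ≥0∞} {d J0 a : ℕ} {α β : ℝ} {j₁ j₂ : ℕ → ℕ}

/-- If `t < d/2`, a squared bias of the order of the rate at resolution `k` requires `k` to be
undersmoothed for the smoothness `s`. -/
lemma undersmooths_of_bias_le {k : ℕ → ℝ} (hd : 1 ≤ d) {s t : ℝ} (hs : 0 < s) (ht : 0 < t)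
    (htd : t < (d : ℝ) / 2) {C : ℝ} (hC : 0 < C) (hk : ∀ n, 0 < k n)
    (h : ∀ᶠ n : ℕ in atTop, k n ^ (-(2 * (s + t) / d)) ≤
      C * (n : ℝ) ^ (-rateExp a (2 * (s + t) / d))) :
    Tendsto (fun n => k n / predOrder d s n) atTop atTop := by
  have hd0 : (0 : ℝ) < d := by exact_mod_cast hd
  exact tendsto_div_rpow_atTop hk (by positivity) hC h (lt_rateExp_div hd0 hs ht htd)

/-- A plug-in estimator needs both resolutions to control its bias. -/
lemma RiskLower.undersmooths_of_min (h : RiskLower R J0 a (2 * (α + β) / d) (minRes d))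
    (hd : 1 ≤ d) (hα : 0 < α) (hβ : 0 < β) (hj₁ : ∀ n, J0 ≤ j₁ n) (hj₂ : ∀ n, J0 ≤ j₂ n)
    (hA : AchievesRate R j₁ j₂ fun n : ℕ => (n : ℝ) ^ (-rateExp a (2 * (α + β) / d))) :
    (β < (d : ℝ) / 2 → Undersmooths d α j₁) ∧ (α < (d : ℝ) / 2 → Undersmooths d β j₂) := by
  obtain ⟨C, hC, hb⟩ := h.bias_le (minRes_pos d) hj₁ hj₂ hA
  have hk : ∀ n, 0 < minRes d (j₁ n) (j₂ n) := fun n => minRes_pos d _ _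
  have hd0 : (0 : ℝ) < d := by exact_mod_cast hd
  constructor
  · intro hlt
    refine tendsto_atTop_mono (fun n => ?_) (undersmooths_of_bias_le hd hα hβ hlt hC hk hb)
    exact div_le_div_of_nonneg_right (min_le_left _ _) (by unfold predOrder; positivity)
  · intro hlt
    rw [add_comm α β] at hb
    refine tendsto_atTop_mono (fun n => ?_) (undersmooths_of_bias_le hd hβ hα hlt hC hk hb)
    exact div_le_div_of_nonneg_right (min_le_right _ _) (by unfold predOrder; positivity)

/-- The first-order estimator needs only the larger resolution to control its bias. -/
lemma RiskLower.tendsto_max (h : RiskLower R J0 a (2 * (α + β) / d) (maxRes d))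
    (hd : 1 ≤ d) (hα : 0 < α) (hβ : 0 < β) (hlt : max α β < (d : ℝ) / 2)
    (hj₁ : ∀ n, J0 ≤ j₁ n) (hj₂ : ∀ n, J0 ≤ j₂ n)
    (hA : AchievesRate R j₁ j₂ fun n : ℕ => (n : ℝ) ^ (-rateExp a (2 * (α + β) / d))) :
    Tendsto (fun n => max (resolution d (j₁ n) / predOrder d α n)
      (resolution d (j₂ n) / predOrder d β n)) atTop atTop := by
  obtain ⟨C, hC, hb⟩ := h.bias_le (maxRes_pos d) hj₁ hj₂ hA
  have hk : ∀ n, 0 < maxRes d (j₁ n) (j₂ n) := fun n => maxRes_pos d _ _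
  have h1 := undersmooths_of_bias_le hd hα hβ ((le_max_right α β).trans_lt hlt) hC hk hb
  rw [add_comm α β] at hb
  have h2 := undersmooths_of_bias_le hd hβ hα ((le_max_left α β).trans_lt hlt) hC hk hb
  rw [tendsto_atTop] at h1 h2 ⊢
  intro B
  filter_upwards [h1 B, h2 B] with n h3 h4
  rcases le_total (resolution d (j₁ n)) (resolution d (j₂ n)) with hle | hle
  · rw [maxRes, max_eq_right hle] at h4
    exact le_max_of_le_right h4
  · rw [maxRes, max_eq_left hle] at h3
    exact le_max_of_le_left h3

lemma PredOptimal.not_undersmooths {s : ℝ} {j : ℕ → ℕ} (h : PredOptimal d s j) :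
    ¬ Undersmooths d s j := by
  obtain ⟨C, hC⟩ := h.eventually_div_le
  intro h2
  obtain ⟨n, h3, h4⟩ := (hC.and (h2.eventually_gt_atTop C)).exists
  exact absurd h4 (not_lt.2 h3)

lemma rateExp_eq_one (hd : 1 ≤ d) (h : (d : ℝ) / 2 ≤ α + β) :
    rateExp a (2 * (α + β) / d) = 1 := by
  have hd0 : (0 : ℝ) < d := by exact_mod_cast hd
  rw [rateExp, if_pos]
  rw [one_le_div hd0]
  linarith

/-- Prediction-optimal resolutions suffice for a plug-in estimator if both smoothness indices are
at least `d/2`. -/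
lemma RiskUpper.achievesRate_of_min (h : RiskUpper R d J0 (2 * (α + β) / d) (minRes d))
    (hd : 1 ≤ d) (hα : 0 < α) (hβ : 0 < β) (hle : (d : ℝ) / 2 ≤ min α β) (hj₁ : ∀ n, J0 ≤ j₁ n)
    (hj₂ : ∀ n, J0 ≤ j₂ n) (hP₁ : PredOptimal d α j₁) (hP₂ : PredOptimal d β j₂) :
    AchievesRate R j₁ j₂ fun n : ℕ => (n : ℝ) ^ (-rateExp a (2 * (α + β) / d)) := by
  have hαd := hle.trans (min_le_left _ _)
  have hβd := hle.trans (min_le_right _ _)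
  rw [rateExp_eq_one hd (by linarith)]
  obtain ⟨B₁, hB₁, h₁, h₁'⟩ := hP₁.exists_le hd hα
  obtain ⟨B₂, hB₂, h₂, h₂'⟩ := hP₂.exists_le hd hβ
  obtain ⟨E₁, hE₁, k₁⟩ := h₁' β hβd
  obtain ⟨E₂, hE₂, k₂⟩ := h₂' α hαd
  rw [add_comm β α] at k₂
  refine h.achievesRate_left (γ := 1) (E := E₁ + E₂) hj₁ hj₂ le_rfl (by norm_num) hB₁ hB₂
    (by positivity) (by simpa only [Real.rpow_one] using h₁) h₂ ?_
  filter_upwards [k₁, k₂] with n hn₁ hn₂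
  have p₁ := Real.rpow_pos_of_pos (resolution_pos d (j₁ n)) (-(2 * (α + β) / d))
  have p₂ := Real.rpow_pos_of_pos (resolution_pos d (j₂ n)) (-(2 * (α + β) / d))
  rw [minRes, add_mul]
  rcases min_choice (resolution d (j₁ n)) (resolution d (j₂ n)) with hc | hc <;> rw [hc] <;>
    linarith

lemma maxRes_rpow_le_left (he : 0 < α + β) (i j : ℕ) :
    maxRes d i j ^ (-(2 * (α + β) / d)) ≤ resolution d i ^ (-(2 * (α + β) / d)) :=
  Real.rpow_le_rpow_of_nonpos (resolution_pos d i) (le_max_left _ _)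
    (neg_nonpos.2 (by positivity))

lemma maxRes_rpow_le_right (he : 0 < α + β) (i j : ℕ) :
    maxRes d i j ^ (-(2 * (α + β) / d)) ≤ resolution d j ^ (-(2 * (α + β) / d)) :=
  Real.rpow_le_rpow_of_nonpos (resolution_pos d j) (le_max_right _ _)
    (neg_nonpos.2 (by positivity))

/-- Prediction-optimal resolutions suffice for the first-order estimator if one of the smoothness
indices is at least `d/2`. -/
lemma RiskUpper.achievesRate_of_max (h : RiskUpper R d J0 (2 * (α + β) / d) (maxRes d))
    (hd : 1 ≤ d) (hα : 0 < α) (hβ : 0 < β) (hle : (d : ℝ) / 2 ≤ max α β) (hj₁ : ∀ n, J0 ≤ j₁ n)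
    (hj₂ : ∀ n, J0 ≤ j₂ n) (hP₁ : PredOptimal d α j₁) (hP₂ : PredOptimal d β j₂) :
    AchievesRate R j₁ j₂ fun n : ℕ => (n : ℝ) ^ (-rateExp a (2 * (α + β) / d)) := by
  rw [rateExp_eq_one hd (hle.trans (max_le (by linarith) (by linarith)))]
  obtain ⟨B₁, hB₁, h₁, h₁'⟩ := hP₁.exists_le hd hα
  obtain ⟨B₂, hB₂, h₂, h₂'⟩ := hP₂.exists_le hd hβ
  have key : ∃ E : ℝ, 0 < E ∧ ∀ᶠ n : ℕ in atTop,
      maxRes d (j₁ n) (j₂ n) ^ (-(2 * (α + β) / d)) ≤ E * (n : ℝ) ^ (-1 : ℝ) := by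
    rcases le_max_iff.1 hle with hαd | hβd
    · obtain ⟨E, hE, k⟩ := h₂' α hαd
      rw [add_comm β α] at k
      exact ⟨E, hE, k.mono fun n hn => (maxRes_rpow_le_right (by linarith) _ _).trans hn⟩
    · obtain ⟨E, hE, k⟩ := h₁' β hβd
      exact ⟨E, hE, k.mono fun n hn => (maxRes_rpow_le_left (by linarith) _ _).trans hn⟩
  obtain ⟨E, hE, k⟩ := key
  exact h.achievesRate_left (γ := 1) hj₁ hj₂ le_rfl (by norm_num) hB₁ hB₂ hE
    (by simpa only [Real.rpow_one] using h₁) h₂ k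

/-- The first-order estimator achieves its best rate as soon as one resolution is of the balancing
order and the other one is at most of order `n`. -/
lemma RiskUpper.achievesRate_of_levelExp (h : RiskUpper R d J0 (2 * (α + β) / d) (maxRes d))
    (hd : 1 ≤ d) (hα : 0 < α) (hβ : 0 < β) (hj₁ : ∀ n, J0 ≤ j₁ n) (hj₂ : ∀ n, J0 ≤ j₂ n)
    {c C B : ℝ} (hc : 0 < c) (hC : 0 < C) (hB : 0 < B)
    (h₁ : ∀ n : ℕ, 1 ≤ n → c * (n : ℝ) ^ levelExp 1 (2 * (α + β) / d) ≤ resolution d (j₁ n) ∧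
      resolution d (j₁ n) ≤ C * (n : ℝ) ^ levelExp 1 (2 * (α + β) / d))
    (h₂ : ∀ᶠ n : ℕ in atTop, resolution d (j₂ n) ≤ B * n) :
    AchievesRate R j₁ j₂ fun n : ℕ => (n : ℝ) ^ (-rateExp 1 (2 * (α + β) / d)) := by
  have hd0 : (0 : ℝ) < d := by exact_mod_cast hd
  have he : 0 < 2 * (α + β) / d := by positivity
  have hlev := mul_levelExp_sub_le (a := 1) he
  push_cast at hlev
  refine h.achievesRate_left (γ := levelExp 1 (2 * (α + β) / d))
    (E := c ^ (-(2 * (α + β) / d))) hj₁ hj₂ (rateExp_le_one he) (by linarith) hC hB (by positivity)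
    ((eventually_ge_atTop 1).mono fun n hn => (h₁ n hn).2) h₂
    ((eventually_ge_atTop 1).mono fun n hn => ?_)
  exact (maxRes_rpow_le_left (by linarith) _ _).trans (rpow_neg_le_mul_rpow_neg
    (by exact_mod_cast hn) hc (h₁ n hn).1 he rateExp_le_mul_levelExp)

lemma undersmooths_of_levelExp (hd : 1 ≤ d) {s e c : ℝ} (hs : 0 < s) (he : 0 < e) (hc : 0 < c)
    {j : ℕ → ℕ} (h : ∀ n : ℕ, 1 ≤ n → c * (n : ℝ) ^ levelExp 1 e ≤ resolution d (j n)) :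
    Undersmooths d s j := by
  have hd0 : (0 : ℝ) < d := by exact_mod_cast hd
  have hlt : (d : ℝ) / (2 * s + d) < levelExp 1 e :=
    lt_of_lt_of_le ((div_lt_one (by positivity)).2 (by linarith)) (one_le_levelExp he)
  have h1 : Tendsto (fun n : ℕ => c * (n : ℝ) ^ (levelExp 1 e - d / (2 * s + d))) atTop atTop :=
    Tendsto.const_mul_atTop hc
      ((tendsto_rpow_atTop (sub_pos.2 hlt)).comp tendsto_natCast_atTop_atTop)
  refine tendsto_atTop_mono' _ ?_ h1
  filter_upwards [eventually_ge_atTop 1] with n hn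
  have hn0 : (0 : ℝ) < n := by exact_mod_cast hn
  rw [predOrder, le_div_iff₀ (by positivity), mul_assoc, ← Real.rpow_add hn0, sub_add_cancel]
  exact h n hn

lemma exists_predOptimal (hd : 1 ≤ d) (J : ℕ) {s : ℝ} (hs : 0 < s) :
    ∃ j : ℕ → ℕ, (∀ n, J ≤ j n) ∧ PredOptimal d s j := by
  obtain ⟨j, hj, c, C, hc, -, h⟩ := exists_resolution_order hd J (predExp_nonneg (d := d) hs)
  exact ⟨j, hj, predOptimal_of_bounds hc h⟩

end predOptimal

namespace CDVBasis

variable {S : ℕ} (W : CDVBasis S) {d : ℕ} {α β M C₁ C₂ : ℝ}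

lemma exists_achievesRate_riskINT (hd : 1 ≤ d) (hS : 1 ≤ S) (hM : 0 ≤ M) (hα : 0 < α)
    (hβ : 0 < β) :
    ∃ j₁ j₂ : ℕ → ℕ, (∀ n, W.J0 ≤ j₁ n) ∧ (∀ n, W.J0 ≤ j₂ n) ∧
      AchievesRate (riskINT W d α β M C₁ C₂) j₁ j₂
        fun n : ℕ => (n : ℝ) ^ (-rateExp 1 (2 * (α + β) / d)) := by
  have hd0 : (0 : ℝ) < d := by exact_mod_cast hd
  have he : 0 < 2 * (α + β) / d := by positivity
  obtain ⟨C, hC, h⟩ := W.exists_riskINT_le (C₁ := C₁) (C₂ := C₂) hd hS hM (add_pos hα hβ)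
  obtain ⟨j, hj, c, B, hc, hB, hjn⟩ := exists_resolution_order hd W.J0
    (zero_le_one.trans (one_le_levelExp (a := 1) he))
  refine ⟨j, j, hj, hj, C * (1 + B + c ^ (-(2 * (α + β) / d))), by positivity,
    (eventually_ge_atTop 1).mono fun n hn =>
      (h n hn _ _ (hj n) (hj n)).trans (ENNReal.ofReal_le_ofReal ?_)⟩
  have hn1 : (1 : ℝ) ≤ n := by exact_mod_cast hn
  rw [minRes, min_self, mul_assoc]
  refine mul_le_mul_of_nonneg_left ?_ hC.le
  have t₁ := one_div_le_rpow_neg hn1 (rateExp_le_one (a := 1) he)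
  have t₂ := pow_div_pow_le_rpow_neg hn1 (resolution_pos d (j n)).le (hjn n hn).2
    (mul_levelExp_sub_le he) hB.le
  have t₃ := rpow_neg_le_mul_rpow_neg hn1 hc (hjn n hn).1 he (rateExp_le_mul_levelExp (a := 1))
  rw [pow_one, pow_one] at t₂
  norm_num at t₂
  linarith

lemma exists_achievesRate_riskMC (hd : 1 ≤ d) (hS : 1 ≤ S) (hM : 0 ≤ M) (hα : 0 < α)
    (hβ : 0 < β) :
    ∃ j₁ j₂ : ℕ → ℕ, (∀ n, W.J0 ≤ j₁ n) ∧ (∀ n, W.J0 ≤ j₂ n) ∧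
      AchievesRate (riskMC W d α β M C₁ C₂) j₁ j₂
        fun n : ℕ => (n : ℝ) ^ (-rateExp 2 (2 * (α + β) / d)) := by
  have hd0 : (0 : ℝ) < d := by exact_mod_cast hd
  have he : 0 < 2 * (α + β) / d := by positivity
  obtain ⟨C, hC, h⟩ := W.riskUpper_riskMC (C₁ := C₁) (C₂ := C₂) hd hS hM (add_pos hα hβ)
  obtain ⟨j, hj, c, B, hc, hB, hjn⟩ := exists_resolution_order hd W.J0
    (zero_le_one.trans (one_le_levelExp (a := 2) he))
  refine ⟨j, j, hj, hj, C * (2 + 2 * B ^ 2 + c ^ (-(2 * (α + β) / d))), by positivity,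
    (eventually_ge_atTop 1).mono fun n hn =>
      (h n hn _ _ (hj n) (hj n)).trans (ENNReal.ofReal_le_ofReal ?_)⟩
  have hn1 : (1 : ℝ) ≤ n := by exact_mod_cast hn
  have hn0 : (0 : ℝ) < n := by linarith
  rw [minRes, min_self, mul_assoc]
  refine mul_le_mul_of_nonneg_left ?_ hC.le
  have t₁ := one_div_le_rpow_neg hn1 (rateExp_le_one (a := 2) he)
  have t₂ := pow_div_pow_le_rpow_neg hn1 (resolution_pos d (j n)).le (hjn n hn).2
    (mul_levelExp_sub_le he) hB.le
  have t₃ := rpow_neg_le_mul_rpow_neg hn1 hc (hjn n hn).1 he (rateExp_le_mul_levelExp (a := 2))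
  -- the cross term `k/n²` is dominated by the geometric mean of `1/n` and `k²/n³`
  have t₄ : 1 / (n : ℝ) * ((1 + resolution d (j n) / n) * (1 + resolution d (j n) / n)) ≤
      2 * (1 / n) + 2 * (resolution d (j n) ^ 2 / n ^ (2 + 1)) := by
    have e1 : 2 * (1 / (n : ℝ)) + 2 * (resolution d (j n) ^ 2 / n ^ (2 + 1)) =
      1 / n * (2 + 2 * (resolution d (j n) / n) ^ 2) := by
      field_simp
      ring
    rw [e1]
    refine mul_le_mul_of_nonneg_left ?_ (by positivity)
    nlinarith [sq_nonneg (resolution d (j n) / n - 1)]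
  linarith

end CDVBasis

theorem mainTheorem9
    (d S : ℕ) (hd : 1 ≤ d) (hS : 1 ≤ S) (W : CDVBasis S)
    (α β M C₁ C₂ : ℝ) (hα : 0 < α) (hβ : 0 < β) (hαS : α < S) (hβS : β < S) (hM : 0 < M)
    -- the constants `C₁ < C₂` and `M` leave room in the model
    (hp : ∃ M' < M, ∃ p₀ ∈ W.Holder d α M', ∀ x ∈ cube d, C₁ < p₀ x ∧ p₀ x < C₂)
    (hb : ∃ M' < M, ∃ b₀ ∈ W.Holder d β M', ∀ x ∈ cube d, C₁ < b₀ x ∧ b₀ x < C₂) :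
    -- the best rates of the three estimators over all resolutions
    (IsBestRate (riskINT W d α β M C₁ C₂) W.J0 (minimaxRate d α β) ∧
      IsBestRate (riskMC W d α β M C₁ C₂) W.J0 (mcRate d α β) ∧
      IsBestRate (riskIF W d α β M C₁ C₂) W.J0 (minimaxRate d α β)) ∧
    -- prediction-optimal resolutions
    (∀ j₁ j₂ : ℕ → ℕ, (∀ n, W.J0 ≤ j₁ n) → (∀ n, W.J0 ≤ j₂ n) →
      PredOptimal d α j₁ → PredOptimal d β j₂ →
        (AchievesRate (riskINT W d α β M C₁ C₂) j₁ j₂ (minimaxRate d α β) ↔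
          (d : ℝ) / 2 ≤ min α β) ∧
        (AchievesRate (riskMC W d α β M C₁ C₂) j₁ j₂ (mcRate d α β) ↔
          (d : ℝ) / 2 ≤ min α β) ∧
        (AchievesRate (riskIF W d α β M C₁ C₂) j₁ j₂ (minimaxRate d α β) ↔
          (d : ℝ) / 2 ≤ max α β)) ∧
    -- necessity of undersmoothing
    (∀ j₁ j₂ : ℕ → ℕ, (∀ n, W.J0 ≤ j₁ n) → (∀ n, W.J0 ≤ j₂ n) →
      (AchievesRate (riskINT W d α β M C₁ C₂) j₁ j₂ (minimaxRate d α β) →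
        (β < (d : ℝ) / 2 → Undersmooths d α j₁) ∧ (α < (d : ℝ) / 2 → Undersmooths d β j₂)) ∧
      (AchievesRate (riskMC W d α β M C₁ C₂) j₁ j₂ (mcRate d α β) →
        (β < (d : ℝ) / 2 → Undersmooths d α j₁) ∧ (α < (d : ℝ) / 2 → Undersmooths d β j₂)) ∧
      (AchievesRate (riskIF W d α β M C₁ C₂) j₁ j₂ (minimaxRate d α β) →
        max α β < (d : ℝ) / 2 →
          Tendsto (fun n => max (resolution d (j₁ n) / predOrder d α n)
            (resolution d (j₂ n) / predOrder d β n)) atTop atTop)) ∧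
    -- for the first-order estimator it does not matter which resolution is undersmoothed
    (max α β < (d : ℝ) / 2 →
      (∃ j₁ j₂ : ℕ → ℕ, (∀ n, W.J0 ≤ j₁ n) ∧ (∀ n, W.J0 ≤ j₂ n) ∧
        Undersmooths d α j₁ ∧ PredOptimal d β j₂ ∧
        AchievesRate (riskIF W d α β M C₁ C₂) j₁ j₂ (minimaxRate d α β)) ∧
      (∃ j₁ j₂ : ℕ → ℕ, (∀ n, W.J0 ≤ j₁ n) ∧ (∀ n, W.J0 ≤ j₂ n) ∧
        PredOptimal d α j₁ ∧ Undersmooths d β j₂ ∧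
        AchievesRate (riskIF W d α β M C₁ C₂) j₁ j₂ (minimaxRate d α β))) := by
  have hM0 := hM.le
  have hs : 0 < α + β := add_pos hα hβ
  have hd0 : (0 : ℝ) < d := by exact_mod_cast hd
  have he : 0 < 2 * (α + β) / d := by positivity
  have lowINT := W.riskLower_riskINT hd hS hα hβ hαS hβS hp hb
  have lowMC := W.riskLower_riskMC hd hS hα hβ hαS hβS hp hb
  have lowIF := W.riskLower_riskIF hd hS hα hβ hαS hβS hp hb
  have upINT := W.riskUpper_riskINT (C₁ := C₁) (C₂ := C₂) hd hS hM0 hs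
  have upMC := W.riskUpper_riskMC (C₁ := C₁) (C₂ := C₂) hd hS hM0 hs
  have upIF := W.riskUpper_riskIF (C₁ := C₁) (C₂ := C₂) hd hS hM0 hs
  have upIF' : RiskUpper (fun n j₁ j₂ => riskIF W d α β M C₁ C₂ n j₂ j₁) d W.J0
      (2 * (β + α) / d) (maxRes d) := by
    rw [add_comm β α]
    convert upIF.swap using 1
    funext j₁ j₂
    exact max_comm _ _
  obtain ⟨j, hj, c, C, hc, hC, hjn⟩ := exists_resolution_order hd W.J0
    (zero_le_one.trans (one_le_levelExp (a := 1) he))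
  rw [minimaxRate_eq hd, mcRate_eq hd]
  refine ⟨⟨⟨lowINT.eventually_le he (minRes_pos d),
      W.exists_achievesRate_riskINT hd hS hM0 hα hβ⟩,
    ⟨lowMC.eventually_le he (minRes_pos d), W.exists_achievesRate_riskMC hd hS hM0 hα hβ⟩,
    lowIF.eventually_le he (maxRes_pos d), j, fun _ => W.J0, hj, fun _ => le_rfl, ?_⟩,
    fun j₁ j₂ hj₁ hj₂ hP₁ hP₂ => ⟨⟨fun hA => ?_, fun hle => ?_⟩, ⟨fun hA => ?_, fun hle => ?_⟩,
      fun hA => ?_, fun hle => ?_⟩,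
    fun j₁ j₂ hj₁ hj₂ => ⟨lowINT.undersmooths_of_min hd hα hβ hj₁ hj₂,
      lowMC.undersmooths_of_min hd hα hβ hj₁ hj₂,
      fun hA hlt => lowIF.tendsto_max hd hα hβ hlt hj₁ hj₂ hA⟩,
    fun _ => ⟨?_, ?_⟩⟩
  · refine upIF.achievesRate_of_levelExp hd hα hβ hj (fun _ => le_rfl) hc hC
      (resolution_pos d W.J0) hjn ((eventually_ge_atTop 1).mono fun n hn => ?_)
    exact le_mul_of_one_le_right (resolution_pos d W.J0).le (by exact_mod_cast hn)
  · have h := lowINT.undersmooths_of_min hd hα hβ hj₁ hj₂ hA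
    exact le_min (not_lt.1 fun hlt => hP₂.not_undersmooths (h.2 hlt))
      (not_lt.1 fun hlt => hP₁.not_undersmooths (h.1 hlt))
  · exact upINT.achievesRate_of_min hd hα hβ hle hj₁ hj₂ hP₁ hP₂
  · have h := lowMC.undersmooths_of_min hd hα hβ hj₁ hj₂ hA
    exact le_min (not_lt.1 fun hlt => hP₂.not_undersmooths (h.2 hlt))
      (not_lt.1 fun hlt => hP₁.not_undersmooths (h.1 hlt))
  · exact upMC.achievesRate_of_min hd hα hβ hle hj₁ hj₂ hP₁ hP₂
  · by_contra hlt
    have h := lowIF.tendsto_max hd hα hβ (not_le.1 hlt) hj₁ hj₂ hA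
    obtain ⟨B₁, h₁⟩ := hP₁.eventually_div_le
    obtain ⟨B₂, h₂⟩ := hP₂.eventually_div_le
    obtain ⟨n, ⟨h₃, h₄⟩, h₅⟩ := ((h₁.and h₂).and (h.eventually_gt_atTop (max B₁ B₂))).exists
    exact absurd h₅ (not_lt.2 (max_le_max h₃ h₄))
  · exact upIF.achievesRate_of_max hd hα hβ hle hj₁ hj₂ hP₁ hP₂
  · obtain ⟨j₂, hj₂, hP₂⟩ := exists_predOptimal hd W.J0 hβ
    obtain ⟨B, hB, h₂, -⟩ := hP₂.exists_le hd hβ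
    exact ⟨j, j₂, hj, hj₂, undersmooths_of_levelExp hd hα he hc fun n hn => (hjn n hn).1, hP₂,
      upIF.achievesRate_of_levelExp hd hα hβ hj hj₂ hc hC hB hjn h₂⟩
  · obtain ⟨j₁, hj₁, hP₁⟩ := exists_predOptimal hd W.J0 hα
    obtain ⟨B, hB, h₁, -⟩ := hP₁.exists_le hd hα
    rw [add_comm α β] at hjn he ⊢
    exact ⟨j₁, j, hj₁, hj, hP₁, undersmooths_of_levelExp hd hβ he hc fun n hn => (hjn n hn).1,
      upIF'.achievesRate_of_levelExp hd hβ hα hj hj₁ hc hC hB hjn h₁⟩
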